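/- Let $n\ge 1$ be an integer, let $z\cdot\bar w=\sum_j z_j\bar w_j$ and $|z|=(z\cdot\bar z)^{1/2}$ on $\mathbb C^n$, and let $dV$ be Lebesgue measure on $\mathbb C^n$ normalized so that $\int e^{-|z|^2}\,dV(z)=1$. For real $\alpha$ put $dV_\alpha(z)=(1+|z|)^{-\alpha}dV(z)$ and $dW_\alpha(z)=|z|^{-\alpha}dV(z)$; for $r>0$ put $\Omega_r=\{z\in\mathbb C^n:|z|\ge r\}$. For $1\le p\le\infty$ and $\beta$ real, let $F^p_\beta$ be the space of entire functions $f$ on $\mathbb C^n$ whose norm $$\|f\|_{F^p_\beta}=\Big(\int_{\mathbb C^n}|f(z)e^{-|z|^2/2}|^p\,dV_\beta(z)\Big)^{1/p}\ (p<\infty),\qquad \|f\|_{F^\infty_\beta}=\operatorname*{ess\,sup}_{z\in\mathbb C^n}\frac{|f(z)|e^{-|z|^2/2}}{(1+|z|)^\beta}$$ is finite, and let $\mathcal L^{p,r}_\beta$ be the space of Lebesgue measurable functions $\psi$ on $\Omega_r$ whose norm $$\|\psi\|_{\mathcal L^{p,r}_\beta}=\Big(\int_{\Omega_r}|\psi(z)e^{-|z|^2/2}|^p\,dW_\beta(z)\Big)^{1/p}\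 (p<\infty),\qquad \|\psi\|_{\mathcal L^{\infty,r}_\beta}=\operatorname*{ess\,sup}_{z\in\Omega_r}\frac{|\psi(z)|e^{-|z|^2/2}}{|z|^\beta}$$ is finite. Put $(\psi,\varphi)_\alpha=\int_{\mathbb C^n}\psi\,\bar\varphi\,e^{-|z|^2}\,dW_\alpha$, and for an entire function $f$ with homogeneous expansion $f=\sum_{k\ge0}f_k$ put $f_s^-=\sum_{k\le|s|}f_k$ and $f_s^+=f-f_s^-$. Let $F^2_\alpha$ carry the inner product $$\langle f,g\rangle_\alpha=\begin{cases}(f,g)_\alpha&\text{if }\alpha<2n,\\ (f^-_{\alpha/2},g^-_{\alpha/2})_0+(f^+_{\alpha/2},g^+_{\alpha/2})_\alpha&\text{if }\alpha\ge 2n.\end{cases}$$ It has a unique reproducing kernel, that is, a unique family $(K^\alpha_z)_{z\in\mathbb C^n}$ in $F^2_\alpha$ with $f(z)=\langle f,K_z^\alpha\rangle_\alpha$ for all $f\in F^2_\alpha$ and $z\in\mathbb C^n$. For $r>0$ consider the operator $$P^r_\alpha\psi(z)=\int_{\Omega_r}\psi(w)\,\overline{K^\alpha_z(w)}\,e^{-|w|^2}\,dW_\alpha(w),\qquad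 z\in\mathbb C^n .$$ **Theorem 5.4.** Let $1\le p\le\infty$ and let $\alpha,\beta$ be real. (1) For every $r>0$, the integral defining $P^r_\alpha\psi(z)$ converges absolutely for all $\psi\in\mathcal L^{p,r}_\beta$ and $z\in\mathbb C^n$, and $P^r_\alpha$ is a bounded linear operator from $\mathcal L^{p,r}_\beta$ into $F^p_\beta$. (2) There is $r_0>0$, depending only on $n,\alpha,\beta,p$, such that for every $0<r<r_0$ the operator $P^r_\alpha$ (applied to the restrictions to $\Omega_r$ of functions in $F^p_\beta$) is a bounded linear bijection of $F^p_\beta$ onto itself with bounded inverse. -/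

import Mathlib

open MeasureTheory
open scoped ENNReal NNReal ComplexConjugate

noncomputable section

namespace Fock

/-- The complex `n`-space with its Hermitian (Euclidean) norm. -/
abbrev Cn (n : ℕ) : Type := EuclideanSpace ℂ (Fin n)

/-- The volume measure `dV` on `ℂⁿ`, normalized so that `∫ e^{-|z|²} dV(z) = 1`,
see `integral_gaussian`. -/
def V (n : ℕ) : Measure (Cn n) := ENNReal.ofReal ((Real.pi ^ n)⁻¹) • volume

lemma integral_gaussian (n : ℕ) : ∫ z : Cn n, Real.exp (-‖z‖ ^ 2) ∂(V n) = 1 := by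
  have h := GaussianFourier.integral_rexp_neg_mul_sq_norm (V := Cn n) (b := 1) one_pos
  have hd : Module.finrank ℝ (Cn n) = 2 * n := by
    rw [← Module.finrank_mul_finrank ℝ ℂ (Cn n)]; simp
  have hp : (0 : ℝ) < Real.pi ^ n := by positivity
  rw [V, integral_smul_measure, ENNReal.toReal_ofReal (by positivity)]
  rw [hd] at h
  push_cast at h
  rw [mul_div_cancel_left₀ _ (two_ne_zero), div_one, Real.rpow_natCast] at h
  simp only [neg_mul, one_mul] at h
  rw [h, smul_eq_mul, inv_mul_cancel₀ hp.ne']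

/-- `dV_α(z) = (1 + |z|)^{-α} dV(z)`. -/
def Vw (n : ℕ) (α : ℝ) : Measure (Cn n) :=
  (V n).withDensity fun z => ENNReal.ofReal ((1 + ‖z‖) ^ (-α))

/-- `dW_α(z) = |z|^{-α} dV(z)`. -/
def W (n : ℕ) (α : ℝ) : Measure (Cn n) :=
  (V n).withDensity fun z => ENNReal.ofReal (‖z‖ ^ (-α))

/-- The norm of `L^p_α`, with values in `[0, ∞]`:
the `L^p(dV_α)`-norm of `f e^{-|z|²/2}` for `p < ∞`,
and the essential supremum of `|f| e^{-|z|²/2} (1 + |z|)^{-α}` for `p = ∞`. -/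
def normF (n : ℕ) (p : ℝ≥0∞) (α : ℝ) (f : Cn n → ℂ) : ℝ≥0∞ :=
  if p = ∞ then
    eLpNorm (fun z => f z * ((Real.exp (-‖z‖ ^ 2 / 2) / (1 + ‖z‖) ^ α : ℝ) : ℂ)) ∞ (V n)
  else
    eLpNorm (fun z => f z * ((Real.exp (-‖z‖ ^ 2 / 2) : ℝ) : ℂ)) p (Vw n α)

/-- `Ω_r`, the complement of the open ball of radius `r` about the origin. -/
def Om (n : ℕ) (r : ℝ) : Set (Cn n) := (Metric.ball 0 r)ᶜ

/-- The norm of `𝓛^{p,r}_α`, with values in `[0, ∞]`: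
the `L^p(Ω_r, dW_α)`-norm of `ψ e^{-|z|²/2}` for `p < ∞`,
and the essential supremum over `Ω_r` of `|ψ| e^{-|z|²/2} |z|^{-α}` for `p = ∞`. -/
def normL (n : ℕ) (p : ℝ≥0∞) (r α : ℝ) (ψ : Cn n → ℂ) : ℝ≥0∞ :=
  if p = ∞ then
    eLpNorm (fun z => ψ z * ((Real.exp (-‖z‖ ^ 2 / 2) / ‖z‖ ^ α : ℝ) : ℂ)) ∞
      ((V n).restrict (Om n r))
  else
    eLpNorm (fun z => ψ z * ((Real.exp (-‖z‖ ^ 2 / 2) : ℝ) : ℂ)) p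
      ((W n α).restrict (Om n r))

/-- A weighted `L^p` norm (as above) of a sum of two functions is finite if both norms are, and
the norm of a scalar multiple is finite. -/
lemma weighted_add {n : ℕ} {p : ℝ≥0∞} {μ : Measure (Cn n)} {f g : Cn n → ℂ} {w : Cn n → ℝ}
    (hw : Measurable w) (hf : AEStronglyMeasurable f μ) (hg : AEStronglyMeasurable g μ)
    (h1 : eLpNorm (fun z => f z * (w z : ℂ)) p μ < ∞)
    (h2 : eLpNorm (fun z => g z * (w z : ℂ)) p μ < ∞) :
    eLpNorm (fun z => (f + g) z * (w z : ℂ)) p μ < ∞ := by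
  have hw' : AEStronglyMeasurable (fun z => (w z : ℂ)) μ :=
    (Complex.measurable_ofReal.comp hw).aestronglyMeasurable
  have := (MemLp.add (μ := μ) (p := p) ⟨hf.mul hw', h1⟩ ⟨hg.mul hw', h2⟩).2
  refine lt_of_eq_of_lt (congrArg (fun F => eLpNorm F p μ) ?_) this
  funext z
  simp [add_mul]

lemma weighted_smul {n : ℕ} {p : ℝ≥0∞} {μ : Measure (Cn n)} {f : Cn n → ℂ} {w : Cn n → ℝ}
    (c : ℂ) (hw : Measurable w) (hf : AEStronglyMeasurable f μ)
    (h1 : eLpNorm (fun z => f z * (w z : ℂ)) p μ < ∞) :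
    eLpNorm (fun z => (c • f) z * (w z : ℂ)) p μ < ∞ := by
  have hw' : AEStronglyMeasurable (fun z => (w z : ℂ)) μ :=
    (Complex.measurable_ofReal.comp hw).aestronglyMeasurable
  have := (MemLp.const_smul (μ := μ) (p := p) (f := fun z => f z * (w z : ℂ))
    ⟨hf.mul hw', h1⟩ c).2
  refine lt_of_eq_of_lt (congrArg (fun F => eLpNorm F p μ) ?_) this
  funext z
  simp [mul_assoc]

/-- The weighted Fock space `F^p_α`: entire functions with finite `L^p_α`-norm. -/
def spaceF (n : ℕ) (p : ℝ≥0∞) (α : ℝ) : Submodule ℂ (Cn n → ℂ) where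
  carrier := {f | Differentiable ℂ f ∧ normF n p α f < ∞}
  zero_mem' := ⟨differentiable_const 0, by unfold normF; split_ifs <;> simp [← Pi.zero_def]⟩
  add_mem' := by
    rintro f g ⟨hf, hf'⟩ ⟨hg, hg'⟩
    refine ⟨hf.add hg, ?_⟩
    unfold normF at *
    split_ifs at * with h
    · exact weighted_add (by fun_prop) hf.continuous.aestronglyMeasurable
        hg.continuous.aestronglyMeasurable hf' hg'
    · exact weighted_add (by fun_prop) hf.continuous.aestronglyMeasurable
        hg.continuous.aestronglyMeasurable hf' hg'
  smul_mem' := by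
    rintro c f ⟨hf, hf'⟩
    refine ⟨hf.const_smul c, ?_⟩
    unfold normF at *
    split_ifs at * with h
    · exact weighted_smul c (by fun_prop) hf.continuous.aestronglyMeasurable hf'
    · exact weighted_smul c (by fun_prop) hf.continuous.aestronglyMeasurable hf'

lemma restrict_W_ac (n : ℕ) (r α : ℝ) :
    (W n α).restrict (Om n r) ≪ (V n).restrict (Om n r) :=
  (withDensity_absolutelyContinuous _ _).restrict _

/-- The space `𝓛^{p,r}_α` of Lebesgue measurable functions on `Ω_r` with finite norm. Its elements
are represented by functions on `ℂⁿ`, whose values outside `Ω_r` play no role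
(neither for membership, nor for the norm, nor for the operator `opP` below). -/
def spaceL (n : ℕ) (p : ℝ≥0∞) (r α : ℝ) : Submodule ℂ (Cn n → ℂ) where
  carrier := {ψ | AEStronglyMeasurable ψ ((V n).restrict (Om n r)) ∧ normL n p r α ψ < ∞}
  zero_mem' := ⟨aestronglyMeasurable_const, by unfold normL; split_ifs <;> simp [← Pi.zero_def]⟩
  add_mem' := by
    rintro f g ⟨hf, hf'⟩ ⟨hg, hg'⟩
    refine ⟨hf.add hg, ?_⟩
    unfold normL at *
    split_ifs at * with h
    · exact weighted_add (by fun_prop) hf hg hf' hg'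
    · exact weighted_add (by fun_prop) (hf.mono_ac (restrict_W_ac n r α))
        (hg.mono_ac (restrict_W_ac n r α)) hf' hg'
  smul_mem' := by
    rintro c f ⟨hf, hf'⟩
    refine ⟨hf.const_smul c, ?_⟩
    unfold normL at *
    split_ifs at * with h
    · exact weighted_smul c (by fun_prop) hf hf'
    · exact weighted_smul c (by fun_prop) (hf.mono_ac (restrict_W_ac n r α)) hf'

/-- The homogeneous part of degree `k` in the Taylor expansion of `f` at the origin. -/
def homPart {n : ℕ} (k : ℕ) (f : Cn n → ℂ) (z : Cn n) : ℂ :=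
  (k.factorial : ℂ)⁻¹ * iteratedFDeriv ℂ k f 0 (fun _ => z)

/-- `f_s^-`, the part of degree at most `|s|` of the Taylor expansion of `f` at the origin. -/
def lowPart {n : ℕ} (s : ℝ) (f : Cn n → ℂ) (z : Cn n) : ℂ :=
  ∑ k ∈ Finset.range (⌊|s|⌋₊ + 1), homPart k f z

/-- `f_s^+ = f - f_s^-`, the tail of degree bigger than `|s|` of the Taylor expansion. -/
def highPart {n : ℕ} (s : ℝ) (f : Cn n → ℂ) (z : Cn n) : ℂ :=
  f z - lowPart s f z

/-- The pairing `(ψ, φ)_α = ∫ ψ φ̄ e^{-|z|²} dW_α`. -/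
def pairing (n : ℕ) (α : ℝ) (ψ φ : Cn n → ℂ) : ℂ :=
  ∫ z, ψ z * conj (φ z) * ((Real.exp (-‖z‖ ^ 2) : ℝ) : ℂ) ∂(W n α)

/-- The inner product `⟨f, g⟩_α` with which `F^2_α` is endowed. -/
def innerF (n : ℕ) (α : ℝ) (f g : Cn n → ℂ) : ℂ :=
  if α < 2 * n then pairing n α f g
  else pairing n 0 (lowPart (α / 2) f) (lowPart (α / 2) g)
    + pairing n α (highPart (α / 2) f) (highPart (α / 2) g)

/-- `K` is the reproducing kernel of the Hilbert space `F^2_α` with inner product `⟨·,·⟩_α`, where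
`K w` stands for the function `K_w^α`, that is, `K w z = K_w^α(z) = K^α(z, w)`. -/
structure IsReproducingKernel (n : ℕ) (α : ℝ) (K : Cn n → Cn n → ℂ) : Prop where
  mem : ∀ w, K w ∈ spaceF n 2 α
  reproducing : ∀ f ∈ spaceF n 2 α, ∀ z, f z = innerF n α f (K z)

/-- The integrand (with respect to `dW_α`) of `[ψ, K_z^α]_α^r`. -/
def integrandP {n : ℕ} (K : Cn n → Cn n → ℂ) (ψ : Cn n → ℂ) (z w : Cn n) : ℂ :=
  ψ w * conj (K z w) * ((Real.exp (-‖w‖ ^ 2) : ℝ) : ℂ)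

/-- The operator `P_α^r ψ(z) = [ψ, K_z^α]_α^r = ∫_{Ω_r} ψ(w) conj(K_z^α(w)) e^{-|w|²} dW_α(w)`
induced by the kernel `K = K^α`. -/
def opP (n : ℕ) (α r : ℝ) (K : Cn n → Cn n → ℂ) (ψ : Cn n → ℂ) (z : Cn n) : ℂ :=
  ∫ w in Om n r, integrandP K ψ z w ∂(W n α)

end Fock

end

/-!
The kernel is a power series in the inner product of its arguments whose coefficients, apart from
finitely many, are `Γ(n + k) / (Γ(n + k - α/2) k!)`. The ratio of the Gamma functions is of order
`k ^ (α/2)`, whence `|K^α_z(w)| ≤ C (1 + |x|) ^ (α/2) (exp (Re x) + exp (|x|/2))` for `x = w · z̄`.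
After multiplication by the weights this is dominated by a Gaussian in `z - w`, and convolution
with a Gaussian is bounded on `L^p`; this gives (1).

On the homogeneous polynomials of degree `k` the operator `P^r_α` is multiplication by a number
`m_k > 0`, where `1/m_k - 1` decays so fast that `∑ |1/m_k - 1| < ∞`. The operator with the
multipliers `1/m_k - 1` is therefore an average of the rotations `f ↦ f (e^{iθ} ·)` against an
absolutely convergent Fourier series. Since rotations are isometries of `F^p_β`, it is bounded
there, and adding the identity to it gives the inverse of `P^r_α`, whatever the size of `r`.
-/

noncomputable section

namespace Fock

section Circle

open AddCircle

lemma integrable_of_continuous_of_compactSpace {X E : Type*} [TopologicalSpace X] [CompactSpace X]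
    [MeasurableSpace X] [OpensMeasurableSpace X] {μ : Measure X} [IsFiniteMeasureOnCompacts μ]
    [NormedAddCommGroup E] {f : X → E} (hf : Continuous f) : Integrable f μ :=
  hf.integrable_of_hasCompactSupport (.of_compactSpace f)

lemma differentiable_integral_of_compactSpace {X 𝕜 E F : Type*} [TopologicalSpace X]
    [CompactSpace X] [MeasurableSpace X] [OpensMeasurableSpace X] {μ : Measure X}
    [IsFiniteMeasure μ] [RCLike 𝕜] [NormedAddCommGroup E] [NormedSpace 𝕜 E] [ProperSpace E]
    [NormedAddCommGroup F] [NormedSpace 𝕜 F] [NormedSpace ℝ F] {G : E → X → F}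
    {G' : E → X → E →L[𝕜] F} (hG : ∀ z, Continuous (G z)) (hG' : Continuous ↿G')
    (h : ∀ z x, HasFDerivAt (G · x) (G' z x) z) : Differentiable 𝕜 fun z => ∫ x, G z x ∂μ := by
  intro z
  obtain ⟨C, hC⟩ := ((isCompact_closedBall z 1).prod isCompact_univ).exists_bound_of_continuousOn
    hG'.continuousOn
  have hG'z : Continuous (G' z) := hG'.comp (by fun_prop : Continuous fun x => (z, x))
  exact (hasFDerivAt_integral_of_dominated_of_fderiv_le (bound := fun _ => C)
    (Metric.closedBall_mem_nhds z one_pos)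
    (.of_forall fun y => (integrable_of_continuous_of_compactSpace (hG y)).aestronglyMeasurable)
    (integrable_of_continuous_of_compactSpace (hG z))
    (integrable_of_continuous_of_compactSpace hG'z).aestronglyMeasurable
    (.of_forall fun x y hy => hC (y, x) ⟨hy, Set.mem_univ x⟩) (integrable_const C)
    (.of_forall fun x y _ => h y x)).differentiableAt

variable {T : ℝ} [hT : Fact (0 < T)] {F : Type*} [NormedAddCommGroup F] [NormedSpace ℂ F]

lemma integral_fourier (m : ℤ) :
    ∫ t : AddCircle T, fourier m t ∂haarAddCircle = if m = 0 then 1 else 0 := by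
  split_ifs with hm
  · simp [hm]
  · exact integral_eq_zero_of_add_right_eq_neg (fourier_add_half_inv_index hm hT.elim)

lemma fourierCoeff_of_hasSum_pow [CompleteSpace F] {b : ℕ → F} {f : AddCircle T → F}
    (hb : Summable fun j => ‖b j‖)
    (hf : ∀ t, HasSum (fun j => (toCircle t : ℂ) ^ j • b j) (f t)) (k : ℕ) :
    fourierCoeff f k = b k := by
  have hterm (j : ℕ) (t : AddCircle T) :
      fourier (-(k : ℤ)) t • (toCircle t : ℂ) ^ j • b j = fourier (j - k : ℤ) t • b j := by
    rw [smul_smul, sub_eq_neg_add, fourier_add, fourier_apply (n := j), toCircle_zsmul]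
    simp
  have h := hasSum_integral_of_summable_integral_norm (μ := haarAddCircle)
    (F := fun (j : ℕ) (t : AddCircle T) => fourier (j - k : ℤ) t • b j)
    (fun j => integrable_of_continuous_of_compactSpace (by fun_prop))
    (by simpa only [norm_smul, fourier_apply, Circle.norm_coe, one_mul, integral_const,
      probReal_univ, one_smul] using hb)
  simp only [integral_smul_const, integral_fourier] at h
  simp only [← hterm, ((hf _).const_smul _).tsum_eq] at h
  refine h.unique ?_
  convert hasSum_ite_eq k (b k) using 2 with j
  split_ifs <;> simp_all [sub_eq_zero]

lemma fourierCoeff_entire [CompleteSpace F] {g : ℂ → F} (hg : Differentiable ℂ g) (k : ℕ) :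
    fourierCoeff (fun t : AddCircle T => g (toCircle t)) k =
      (k.factorial : ℂ)⁻¹ • iteratedDeriv k g 0 := by
  have h (x : ℂ) : HasSum (fun j => x ^ j • (j.factorial : ℂ)⁻¹ • iteratedDeriv j g 0) (g x) := by
    simpa only [sub_zero, smul_comm (x ^ _)] using Complex.hasSum_taylorSeries_of_entire hg 0 x
  obtain ⟨C, hC⟩ := (h 2).summable.tendsto_atTop_zero.norm.bddAbove_range
  refine fourierCoeff_of_hasSum_pow (b := fun j => (j.factorial : ℂ)⁻¹ • iteratedDeriv j g 0)
    (.of_nonneg_of_le (fun j => norm_nonneg _) (fun j => ?_) (summable_geometric_two.mul_left C))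
    (fun t => h _) k
  have hj : ‖(2 : ℂ) ^ j • (j.factorial : ℂ)⁻¹ • iteratedDeriv j g 0‖ ≤ C := hC ⟨j, rfl⟩
  rw [norm_smul, norm_pow, Complex.norm_ofNat] at hj
  rwa [one_div, inv_pow, ← div_eq_mul_inv, le_div_iff₀' (by positivity)]

end Circle

section Entire

open AddCircle

variable {E F : Type*} [NormedAddCommGroup E] [NormedSpace ℂ E] [NormedAddCommGroup F]
  [NormedSpace ℂ F] [CompleteSpace F] {f : E → F}

lemma fderiv_apply_eq_fourierCoeff (hf : Differentiable ℂ f) (z v : E) :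
    fderiv ℂ f z v =
      fourierCoeff (fun t : UnitAddCircle => f (z + (toCircle t : ℂ) • v)) 1 := by
  have h := fourierCoeff_entire (T := 1) (g := fun x : ℂ => f (z + x • v)) (by fun_prop) 1
  have hline : HasDerivAt (fun x : ℂ => z + x • v) v 0 := by
    simpa using ((hasDerivAt_id (0 : ℂ)).smul_const v).const_add z
  have hfz : HasFDerivAt f (fderiv ℂ f z) (z + (0 : ℂ) • v) := by
    simpa using (hf z).hasFDerivAt
  have hderiv : deriv (fun x : ℂ => f (z + x • v)) 0 = fderiv ℂ f z v :=
    (hfz.comp_hasDerivAt (0 : ℂ) hline).deriv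
  rw [← hderiv]
  simpa using h.symm

variable [FiniteDimensional ℂ E]

lemma continuous_fderiv_of_entire (hf : Differentiable ℂ f) : Continuous (fderiv ℂ f) := by
  have hc := hf.continuous
  refine continuous_clm_apply.2 fun v => ?_
  simp_rw [fderiv_apply_eq_fourierCoeff hf, fourierCoeff]
  simpa using continuous_parametric_integral_of_continuous (μ := haarAddCircle)
    (f := fun z (t : UnitAddCircle) => fourier (-1) t • f (z + (toCircle t : ℂ) • v))
    (by unfold Function.uncurry; fun_prop) isCompact_univ

lemma differentiable_fderiv_apply (hf : Differentiable ℂ f) (v : E) :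
    Differentiable ℂ fun z => fderiv ℂ f z v := by
  have : ProperSpace E := FiniteDimensional.proper ℂ E
  have hc := hf.continuous
  have hc' := continuous_fderiv_of_entire hf
  simp_rw [fderiv_apply_eq_fourierCoeff hf, fourierCoeff]
  refine differentiable_integral_of_compactSpace
    (G' := fun z t => fourier (-1) t • fderiv ℂ f (z + (toCircle t : ℂ) • v))
    (fun z => by fun_prop) (by unfold Function.HasUncurry.uncurry; fun_prop) fun z t => ?_
  exact ((hf _).hasFDerivAt.comp z ((hasFDerivAt_id z).add_const _)).const_smul _

lemma contDiff_of_entire (hf : Differentiable ℂ f) (k : ℕ) : ContDiff ℂ k f := by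
  induction k generalizing f with
  | zero => exact contDiff_zero.2 hf.continuous
  | succ k ih =>
    push_cast
    rw [contDiff_succ_iff_fderiv]
    refine ⟨hf, fun h => absurd h (by simp), ?_⟩
    exact contDiff_clm_apply_iff.2 fun v => ih (differentiable_fderiv_apply hf v)

end Entire

section HomPart

open AddCircle

variable {n : ℕ} {f g : Cn n → ℂ}

lemma homPart_eq_iteratedDeriv (hf : Differentiable ℂ f) (k : ℕ) (z : Cn n) :
    homPart k f z = (k.factorial : ℂ)⁻¹ * iteratedDeriv k (fun x : ℂ => f (x • z)) 0 := by
  have h := ContinuousLinearMap.iteratedFDeriv_comp_right (.toSpanSingleton ℂ z)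
    (contDiff_of_entire hf k) (0 : ℂ) (i := k) le_rfl
  have hline : f ∘ ⇑(ContinuousLinearMap.toSpanSingleton ℂ z) = fun x : ℂ => f (x • z) := rfl
  rw [hline] at h
  simp [homPart, iteratedDeriv_eq_iteratedFDeriv, h]

lemma homPart_eq_fourierCoeff (hf : Differentiable ℂ f) (k : ℕ) (z : Cn n) :
    homPart k f z = fourierCoeff (fun t : UnitAddCircle => f (toCircle t • z)) k := by
  rw [homPart_eq_iteratedDeriv hf, ← smul_eq_mul, ← fourierCoeff_entire (T := 1) (by fun_prop)]
  rfl

lemma homPart_smul (f : Cn n → ℂ) (k : ℕ) (c : ℂ) (z : Cn n) :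
    homPart k f (c • z) = c ^ k * homPart k f z := by
  have h := (iteratedFDeriv ℂ k f 0).map_smul_univ (fun _ => c) (fun _ => z)
  simp only [homPart, h, Finset.prod_const, Finset.card_univ, Fintype.card_fin, smul_eq_mul]
  ring

lemma hasSum_homPart (hf : Differentiable ℂ f) (z : Cn n) :
    HasSum (fun k => homPart k f z) (f z) := by
  have h := Complex.hasSum_taylorSeries_of_entire (f := fun x : ℂ => f (x • z)) (by fun_prop) 0 1
  simpa [homPart_eq_iteratedDeriv hf] using h

lemma eq_of_homPart_eq (hf : Differentiable ℂ f) (hg : Differentiable ℂ g)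
    (h : ∀ k z, homPart k f z = homPart k g z) : f = g := by
  ext z
  have hsum := hasSum_homPart hf z
  simp only [h] at hsum
  exact hsum.unique (hasSum_homPart hg z)

lemma homPart_eq_of_hasSum (hf : Differentiable ℂ f) {z : Cn n} {b : ℕ → ℂ}
    (h : ∀ c : ℂ, HasSum (fun k => c ^ k * b k) (f (c • z))) (k : ℕ) : homPart k f z = b k := by
  rw [homPart_eq_fourierCoeff hf]
  exact fourierCoeff_of_hasSum_pow (by simpa using (h 1).summable.norm) (fun t => h _) k

lemma homPart_sub (hf : Differentiable ℂ f) (hg : Differentiable ℂ g) (k : ℕ) (z : Cn n) :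
    homPart k (f - g) z = homPart k f z - homPart k g z := by
  have h := iteratedFDeriv_sub_apply (x := (0 : Cn n)) (contDiff_of_entire hf k).contDiffAt
    (contDiff_of_entire hg k).contDiffAt
  simp [homPart, h, mul_sub]

@[fun_prop]
lemma differentiable_homPart (f : Cn n → ℂ) (k : ℕ) : Differentiable ℂ (homPart k f) := by
  have h : Differentiable ℂ (iteratedFDeriv ℂ k f 0) :=
    ((iteratedFDeriv ℂ k f 0).contDiff (n := 1)).differentiable one_ne_zero
  exact (h.comp (by fun_prop)).const_mul _

lemma differentiable_lowPart (f : Cn n → ℂ) (s : ℝ) : Differentiable ℂ (lowPart s f) :=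
  Differentiable.fun_sum fun k _ => differentiable_homPart f k

lemma differentiable_highPart (hf : Differentiable ℂ f) (s : ℝ) : Differentiable ℂ (highPart s f) :=
  hf.sub (differentiable_lowPart f s)

lemma homPart_lowPart (f : Cn n → ℂ) (s : ℝ) (k : ℕ) (z : Cn n) :
    homPart k (lowPart s f) z = if k ≤ ⌊|s|⌋₊ then homPart k f z else 0 := by
  refine homPart_eq_of_hasSum (differentiable_lowPart f s)
    (b := fun k => if k ≤ ⌊|s|⌋₊ then homPart k f z else 0) (fun c => ?_) k
  have h : lowPart s f (c • z) = ∑ k ∈ Finset.range (⌊|s|⌋₊ + 1),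
      c ^ k * if k ≤ ⌊|s|⌋₊ then homPart k f z else 0 :=
    Finset.sum_congr rfl fun k hk => by
      rw [homPart_smul, if_pos (Nat.lt_succ_iff.1 (Finset.mem_range.1 hk))]
  rw [h]
  refine hasSum_sum_of_ne_finset_zero fun k hk => ?_
  rw [if_neg (by simpa using hk), mul_zero]

lemma homPart_highPart (hf : Differentiable ℂ f) (s : ℝ) (k : ℕ) (z : Cn n) :
    homPart k (highPart s f) z = if k ≤ ⌊|s|⌋₊ then 0 else homPart k f z := by
  rw [show highPart s f = f - lowPart s f from rfl, homPart_sub hf (differentiable_lowPart f s),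
    homPart_lowPart]
  split_ifs <;> simp

lemma norm_homPart_le (hf : Differentiable ℂ f) (k : ℕ) {z : Cn n} {M : ℝ}
    (hM : ∀ w : Cn n, ‖w‖ = ‖z‖ → ‖f w‖ ≤ M) : ‖homPart k f z‖ ≤ M := by
  rw [homPart_eq_fourierCoeff hf]
  refine (norm_integral_le_of_norm_le_const (C := M) (.of_forall fun t => ?_)).trans (by simp)
  simpa only [norm_smul, fourier_apply, Circle.norm_coe, one_mul] using
    hM (toCircle t • z) (by rw [Circle.norm_smul])

lemma norm_homPart_le_mul_pow (hf : Differentiable ℂ f) {M R : ℝ} (hR : 0 < R)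
    (hM : ∀ w : Cn n, ‖w‖ ≤ R → ‖f w‖ ≤ M) (k : ℕ) (z : Cn n) :
    ‖homPart k f z‖ ≤ M * (‖z‖ / R) ^ k := by
  obtain ⟨w, hw, hzw⟩ : ∃ w : Cn n, ‖w‖ ≤ R ∧ z = ((‖z‖ / R : ℝ) : ℂ) • w := by
    refine ⟨((‖z‖ / R : ℝ) : ℂ)⁻¹ • z, ?_, ?_⟩ <;> rcases eq_or_ne z 0 with rfl | hz
    · simpa using hR.le
    · rw [norm_smul, norm_inv, Complex.norm_real, Real.norm_of_nonneg (by positivity)]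
      exact le_of_eq (by have := norm_ne_zero_iff.2 hz; field_simp)
    · simp
    · rw [smul_inv_smul₀ (by simpa using ⟨hz, hR.ne'⟩)]
  have hbound : ‖homPart k f w‖ ≤ M := norm_homPart_le hf k fun v hv => hM v (hv.trans_le hw)
  calc ‖homPart k f z‖ = (‖z‖ / R) ^ k * ‖homPart k f w‖ := by
        conv_lhs => rw [hzw, homPart_smul, norm_mul, norm_pow, Complex.norm_real,
          Real.norm_of_nonneg (by positivity)]
    _ ≤ M * (‖z‖ / R) ^ k := by rw [mul_comm]; gcongr

lemma exists_norm_le_pow (hf : Differentiable ℂ f) {m : ℕ}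
    (h0 : ∀ k < m, ∀ z, homPart k f z = 0) :
    ∃ C : ℝ, 0 ≤ C ∧ ∀ z : Cn n, ‖z‖ ≤ 1 → ‖f z‖ ≤ C * ‖z‖ ^ m := by
  obtain ⟨M, hM⟩ := (isCompact_closedBall (0 : Cn n) 2).exists_bound_of_continuousOn
    hf.continuous.continuousOn
  have hM0 : 0 ≤ M := (norm_nonneg _).trans (hM 0 (by simp))
  refine ⟨M * 2, by positivity, fun z hz => ?_⟩
  have hterm (k : ℕ) : ‖homPart k f z‖ ≤ (M * ‖z‖ ^ m) * (1 / 2) ^ k := by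
    rcases lt_or_ge k m with hk | hk
    · rw [h0 k hk, norm_zero]
      positivity
    calc ‖homPart k f z‖ ≤ M * (‖z‖ / 2) ^ k :=
          norm_homPart_le_mul_pow hf two_pos (fun w hw => hM w (by simpa using hw)) k z
      _ = M * ‖z‖ ^ k * (1 / 2) ^ k := by ring
      _ ≤ (M * ‖z‖ ^ m) * (1 / 2) ^ k := by
        gcongr ?_ * ?_ * _
        exact pow_le_pow_of_le_one (norm_nonneg z) hz hk
  calc ‖f z‖ = ‖∑' k, homPart k f z‖ := by rw [(hasSum_homPart hf z).tsum_eq]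
    _ ≤ (M * ‖z‖ ^ m) * 2 := tsum_of_norm_bounded (hasSum_geometric_two.mul_left _) hterm
    _ = M * 2 * ‖z‖ ^ m := by ring

end HomPart

section Growth

lemma exists_one_add_rpow_le_exp (M : ℝ) {c : ℝ} (hc : 0 < c) :
    ∃ C : ℝ, 0 < C ∧ ∀ t : ℝ, 0 ≤ t → (1 + t) ^ M ≤ C * Real.exp (c * t) := by
  obtain ⟨δ, hδ, hMδ⟩ : ∃ δ, 0 < δ ∧ δ * |M| ≤ c :=
    ⟨c / (|M| + 1), by positivity, by
      rw [div_mul_eq_mul_div, div_le_iff₀ (by positivity)]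
      linarith⟩
  refine ⟨(1 + 1 / δ) ^ |M|, by positivity, fun t ht => ?_⟩
  have hbase : 1 + t ≤ (1 + 1 / δ) * Real.exp (δ * t) := by
    calc 1 + t ≤ (1 + 1 / δ) * (δ * t + 1) := by
          have : (1 + 1 / δ) * (δ * t + 1) = 1 + t + δ * t + 1 / δ := by field_simp; ring
          rw [this]
          have : 0 ≤ δ * t + 1 / δ := by positivity
          linarith
      _ ≤ (1 + 1 / δ) * Real.exp (δ * t) := by gcongr; exact Real.add_one_le_exp _
  calc (1 + t) ^ M ≤ (1 + t) ^ |M| :=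
        Real.rpow_le_rpow_of_exponent_le (by linarith) (le_abs_self M)
    _ ≤ ((1 + 1 / δ) * Real.exp (δ * t)) ^ |M| := by gcongr
    _ = (1 + 1 / δ) ^ |M| * Real.exp (δ * |M| * t) := by
      rw [Real.mul_rpow (by positivity) (Real.exp_nonneg _), ← Real.exp_mul]
      ring_nf
    _ ≤ (1 + 1 / δ) ^ |M| * Real.exp (c * t) := by gcongr

lemma exists_one_add_rpow_mul_exp_le_exp_sq (M R : ℝ) {c : ℝ} (hc : 0 < c) :
    ∃ C : ℝ, 0 < C ∧ ∀ t : ℝ, 0 ≤ t →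
      (1 + t) ^ M * Real.exp (R * t) ≤ C * Real.exp (c * t ^ 2) := by
  obtain ⟨C, hC, h⟩ := exists_one_add_rpow_le_exp M one_pos
  refine ⟨C * Real.exp ((1 + R) ^ 2 / (4 * c)), by positivity, fun t ht => ?_⟩
  have hsquare : (1 + R) * t ≤ (1 + R) ^ 2 / (4 * c) + c * t ^ 2 := by
    have : (1 + R) ^ 2 / (4 * c) + c * t ^ 2 - (1 + R) * t = (1 + R - 2 * c * t) ^ 2 / (4 * c) := by
      field_simp
      ring
    have : 0 ≤ (1 + R - 2 * c * t) ^ 2 / (4 * c) := by positivity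
    linarith
  calc (1 + t) ^ M * Real.exp (R * t) ≤ C * Real.exp (1 * t) * Real.exp (R * t) := by
        gcongr
        exact h t ht
    _ = C * Real.exp ((1 + R) * t) := by rw [mul_assoc, ← Real.exp_add, ← add_mul]
    _ ≤ C * Real.exp ((1 + R) ^ 2 / (4 * c) + c * t ^ 2) := by gcongr
    _ = C * Real.exp ((1 + R) ^ 2 / (4 * c)) * Real.exp (c * t ^ 2) := by
      rw [Real.exp_add, mul_assoc]

end Growth

section Volume

open AddCircle

variable {n : ℕ}

instance : (V n).IsAddHaarMeasure :=
  Measure.IsAddHaarMeasure.smul volume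
    (by simp only [ne_eq, ENNReal.ofReal_eq_zero, not_le]; positivity) ENNReal.ofReal_ne_top

lemma integrable_gaussian {c : ℝ} (hc : 0 < c) :
    Integrable (fun z : Cn n => Real.exp (-c * ‖z‖ ^ 2)) (V n) := by
  refine Integrable.smul_measure (.of_integral_ne_zero ?_) ENNReal.ofReal_ne_top
  rw [GaussianFourier.integral_rexp_neg_mul_sq_norm hc]
  positivity

lemma integrable_of_norm_le_gaussian {F : Type*} [NormedAddCommGroup F] {f : Cn n → F}
    (hf : AEStronglyMeasurable f (V n)) {A M R c : ℝ} (hA : 0 ≤ A) (hc : 0 < c)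
    (h : ∀ z, ‖f z‖ ≤ A * ((1 + ‖z‖) ^ M * Real.exp (R * ‖z‖)) * Real.exp (-c * ‖z‖ ^ 2)) :
    Integrable f (V n) := by
  obtain ⟨C, _, hbound⟩ := exists_one_add_rpow_mul_exp_le_exp_sq M R (half_pos hc)
  refine ((integrable_gaussian (half_pos hc)).const_mul (A * C)).mono' hf
    (.of_forall fun z => (h z).trans ?_)
  calc A * ((1 + ‖z‖) ^ M * Real.exp (R * ‖z‖)) * Real.exp (-c * ‖z‖ ^ 2)
      ≤ A * (C * Real.exp (c / 2 * ‖z‖ ^ 2)) * Real.exp (-c * ‖z‖ ^ 2) := by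
        gcongr A * ?_ * _
        exact hbound ‖z‖ (norm_nonneg z)
    _ = A * C * (Real.exp (c / 2 * ‖z‖ ^ 2) * Real.exp (-c * ‖z‖ ^ 2)) := by ring
    _ = A * C * Real.exp (-(c / 2) * ‖z‖ ^ 2) := by rw [← Real.exp_add]; ring_nf

lemma measurePreserving_circle_smul (c : Circle) :
    MeasurePreserving (fun z : Cn n => c • z) (V n) (V n) :=
  let e : Cn n ≃ₗᵢ[ℝ] Cn n :=
    { DistribMulAction.toLinearEquiv ℝ (Cn n) c with norm_map' := Circle.norm_smul c }
  e.measurePreserving.smul_measure _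

lemma measurePreserving_toCircle_smul :
    MeasurePreserving (fun x : UnitAddCircle × Cn n => toCircle x.1 • x.2)
      (haarAddCircle.prod (V n)) (V n) := by
  have h : MeasurePreserving (fun x : UnitAddCircle × Cn n => (x.1, toCircle x.1 • x.2))
      (haarAddCircle.prod (V n)) (haarAddCircle.prod (V n)) :=
    (MeasurePreserving.id haarAddCircle).skew_product
      (g := fun t (z : Cn n) => toCircle t • z)
      (Continuous.measurable (by unfold Function.uncurry; fun_prop))
      (.of_forall fun t => (measurePreserving_circle_smul (toCircle t)).map_eq)
  exact measurePreserving_snd.comp h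

lemma integral_eq_integral_integral_circle_smul {F : Type*} [NormedAddCommGroup F]
    [NormedSpace ℝ F] [CompleteSpace F] {g : Cn n → F} (hg : Integrable g (V n)) :
    ∫ z, g z ∂(V n) = ∫ z, ∫ t : UnitAddCircle, g (toCircle t • z) ∂haarAddCircle ∂(V n) := by
  have hint : Integrable (Function.uncurry fun (t : UnitAddCircle) (z : Cn n) =>
      g (toCircle t • z)) (haarAddCircle.prod (V n)) :=
    measurePreserving_toCircle_smul.integrable_comp_of_integrable hg
  have hrot (t : UnitAddCircle) : ∫ z, g (toCircle t • z) ∂(V n) = ∫ z, g z ∂(V n) :=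
    (measurePreserving_circle_smul (toCircle t)).integral_comp
      (Homeomorph.smul (toCircle t)).measurableEmbedding g
  rw [← integral_integral_swap hint]
  simp_rw [hrot]
  rw [integral_const, probReal_univ, one_smul]

end Volume

section Polar

variable {F : Type*} [NormedAddCommGroup F] [NormedSpace ℝ F]

lemma integral_volumeIoiPow (m : ℕ) (f : ℝ → F) :
    ∫ t : Set.Ioi (0 : ℝ), f t ∂(Measure.volumeIoiPow m) = ∫ t in Set.Ioi (0 : ℝ), t ^ m • f t := by
  simp only [Measure.volumeIoiPow, ENNReal.ofReal]
  rw [integral_withDensity_eq_integral_smul (measurable_subtype_coe.pow_const _).real_toNNReal,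
    integral_subtype_comap measurableSet_Ioi fun t : ℝ => Real.toNNReal (t ^ m) • f t]
  refine setIntegral_congr_fun measurableSet_Ioi fun t ht => ?_
  rw [NNReal.smul_def, Real.coe_toNNReal _ (pow_nonneg (le_of_lt ht) _)]

lemma integral_radial_smul_of_homogeneous {E : Type*} [NormedAddCommGroup E] [NormedSpace ℝ E]
    [FiniteDimensional ℝ E] [Nontrivial E] [MeasurableSpace E] [BorelSpace E] (μ : Measure E)
    [μ.IsAddHaarMeasure] {h : E → F} {d : ℕ}
    (hh : ∀ t : ℝ, 0 < t → ∀ x, h (t • x) = t ^ d • h x) (ρ : ℝ → ℝ) :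
    ∫ x, ρ ‖x‖ • h x ∂μ =
      (∫ t in Set.Ioi (0 : ℝ), t ^ (Module.finrank ℝ E - 1) * (t ^ d * ρ t)) •
        ∫ x : Metric.sphere (0 : E) 1, h x ∂μ.toSphere := by
  let g : Metric.sphere (0 : E) 1 × Set.Ioi (0 : ℝ) → F :=
    fun y => ((y.2 : ℝ) ^ d * ρ y.2) • h y.1
  have hg (x : ({0}ᶜ : Set E)) : ρ ‖x.1‖ • h x = g (homeomorphUnitSphereProd E x) := by
    have hx : 0 < ‖x.1‖ := norm_pos_iff.2 x.2
    have hpolar : ‖x.1‖ • ((homeomorphUnitSphereProd E x).1 : E) = x := by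
      rw [homeomorphUnitSphereProd_apply_fst_coe, smul_inv_smul₀ hx.ne']
    simp only [g, homeomorphUnitSphereProd_apply_snd_coe]
    conv_lhs => rw [← hpolar, hh _ hx, smul_smul, hpolar, mul_comm]
  calc ∫ x, ρ ‖x‖ • h x ∂μ
      = ∫ x : ({0}ᶜ : Set E), ρ ‖x.1‖ • h x ∂(μ.comap (↑)) := by
        rw [integral_subtype_comap (measurableSet_singleton _).compl fun x => ρ ‖x‖ • h x,
          restrict_compl_singleton]
    _ = ∫ y, g y ∂μ.toSphere.prod (.volumeIoiPow (Module.finrank ℝ E - 1)) := by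
        simp_rw [hg]
        exact μ.measurePreserving_homeomorphUnitSphereProd.integral_comp
          (Homeomorph.measurableEmbedding _) g
    _ = ∫ y, g y.swap ∂(Measure.volumeIoiPow (Module.finrank ℝ E - 1)).prod μ.toSphere :=
        (integral_prod_swap g).symm
    _ = (∫ t : Set.Ioi (0 : ℝ), (t : ℝ) ^ d * ρ t ∂.volumeIoiPow (Module.finrank ℝ E - 1)) •
          ∫ x : Metric.sphere (0 : E) 1, h x ∂μ.toSphere :=
        integral_prod_smul (fun t : Set.Ioi (0 : ℝ) => (t : ℝ) ^ d * ρ t)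
          fun x : Metric.sphere (0 : E) 1 => h x
    _ = _ := by
        rw [integral_volumeIoiPow _ fun t => t ^ d * ρ t]
        simp only [smul_eq_mul]

variable {n : ℕ}

/-- The radial factor, in polar coordinates on `ℂⁿ`, of the integral of a function which is
homogeneous of degree `2k` against the radial weight `ρ`. -/
def radialMoment (n : ℕ) (ρ : ℝ → ℝ) (k : ℕ) : ℝ :=
  ∫ t in Set.Ioi (0 : ℝ), t ^ (2 * n - 1) * (t ^ (2 * k) * ρ t)

lemma finrank_real_Cn (n : ℕ) : Module.finrank ℝ (Cn n) = 2 * n := by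
  rw [← Module.finrank_mul_finrank ℝ ℂ (Cn n)]
  simp

lemma integral_radial_smul_eq_radialMoment_smul (hn : 1 ≤ n) {h : Cn n → F} {k : ℕ}
    (hh : ∀ t : ℝ, 0 < t → ∀ z, h (t • z) = t ^ (2 * k) • h z) (ρ : ℝ → ℝ) :
    ∫ z, ρ ‖z‖ • h z ∂(V n) =
      radialMoment n ρ k • ∫ x : Metric.sphere (0 : Cn n) 1, h x ∂(V n).toSphere := by
  have : Nonempty (Fin n) := ⟨⟨0, hn⟩⟩
  rw [integral_radial_smul_of_homogeneous (V n) hh ρ, finrank_real_Cn, radialMoment]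

lemma radialMoment_rpow_mul_exp (hn : 1 ≤ n) {α : ℝ} {k : ℕ} (h : 0 < k + n - α / 2) :
    radialMoment n (fun t => t ^ (-α) * Real.exp (-t ^ 2)) k = Real.Gamma (k + n - α / 2) / 2 := by
  have hgamma := integral_rpow_mul_exp_neg_rpow (p := 2) (q := 2 * n - 1 + 2 * k - α) two_pos
    (by linarith)
  rw [show (2 * (n : ℝ) - 1 + 2 * k - α + 1) / 2 = k + n - α / 2 by ring] at hgamma
  rw [div_eq_inv_mul, ← one_div, ← hgamma]
  refine setIntegral_congr_fun measurableSet_Ioi fun t ht => ?_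
  have hexp : (2 * (n : ℝ) - 1 + 2 * k - α) = ((2 * n - 1 : ℕ) : ℝ) + ((2 * k : ℕ) : ℝ) + -α := by
    push_cast [Nat.cast_sub (show 1 ≤ 2 * n by lia)]
    ring
  simp only [hexp, Real.rpow_add ht, Real.rpow_natCast, Real.rpow_two]
  ring

lemma radialMoment_gaussian (hn : 1 ≤ n) (k : ℕ) :
    radialMoment n (fun t => Real.exp (-t ^ 2)) k = Real.Gamma (k + n) / 2 := by
  have : (0 : ℝ) < n := by exact_mod_cast hn
  simpa using radialMoment_rpow_mul_exp hn (α := 0) (k := k)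
    (by simp only [zero_div, sub_zero]; positivity)

lemma radialMoment_gaussian_pos (hn : 1 ≤ n) (k : ℕ) :
    0 < radialMoment n (fun t => Real.exp (-t ^ 2)) k := by
  have : (0 : ℝ) < n := by exact_mod_cast hn
  rw [radialMoment_gaussian hn]
  exact half_pos (Real.Gamma_pos_of_pos (by positivity))

end Polar

section Gaussian

open AddCircle

variable {n : ℕ}

lemma norm_cexp_inner_le (w z : Cn n) : ‖Complex.exp (inner ℂ w z)‖ ≤ Real.exp (‖z‖ * ‖w‖) := by
  rw [Complex.norm_exp, mul_comm]
  gcongr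
  exact (Complex.re_le_norm _).trans (norm_inner_le_norm w z)

lemma inner_circle_smul_left (c : Circle) (w z : Cn n) :
    inner ℂ (c • w) z = conj (c : ℂ) * inner ℂ w z := by
  rw [Circle.smul_def, inner_smul_left]

lemma fourier_neg_natCast_apply {T : ℝ} (k : ℕ) (t : AddCircle T) :
    fourier (-k : ℤ) t = conj (toCircle t : ℂ) ^ k := by
  rw [fourier_neg, fourier_apply, natCast_zsmul, toCircle_nsmul, Circle.coe_pow, map_pow]

lemma integral_gaussian_smul_entire {G : Cn n → ℂ} (hG : Differentiable ℂ G)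
    (hi : Integrable (fun u => Real.exp (-‖u‖ ^ 2) • G u) (V n)) :
    ∫ u, Real.exp (-‖u‖ ^ 2) • G u ∂(V n) = G 0 := by
  have hmean (u : Cn n) : ∫ t : UnitAddCircle, G (toCircle t • u) ∂haarAddCircle = G 0 := by
    have := fourierCoeff_entire (T := 1) (g := fun c : ℂ => G (c • u)) (by fun_prop) 0
    simpa [fourierCoeff, Circle.smul_def] using this
  rw [integral_eq_integral_integral_circle_smul hi]
  simp only [Circle.norm_smul, integral_smul, hmean]
  rw [integral_smul_const, integral_gaussian, one_smul]

lemma integrable_gaussian_smul_mul_cexp_inner {q : Cn n → ℂ} (hq : Continuous q) {A M : ℝ}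
    (hA : ∀ w, ‖q w‖ ≤ A * (1 + ‖w‖) ^ M) (z : Cn n) :
    Integrable (fun w => Real.exp (-‖w‖ ^ 2) • (q w * Complex.exp (inner ℂ w z))) (V n) := by
  have hA0 : 0 ≤ A := (norm_nonneg (q 0)).trans (by simpa using hA 0)
  refine integrable_of_norm_le_gaussian (Continuous.aestronglyMeasurable (by fun_prop)) hA0
    (M := M) (R := ‖z‖) one_pos fun w => ?_
  rw [norm_smul, norm_mul, Real.norm_of_nonneg (Real.exp_nonneg _), mul_comm, ← mul_assoc,
    neg_one_mul]
  gcongr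
  · exact hA w
  · exact norm_cexp_inner_le w z

/- Translating by `z` turns `exp ⟪w, z⟫ * exp (-|w|²)` into `exp (-⟪z, u⟫) * exp (-|u|²)`, which is
a holomorphic function of `u` times the Gaussian. -/
lemma integral_gaussian_smul_mul_cexp_inner {q : Cn n → ℂ} (hq : Differentiable ℂ q) {A M : ℝ}
    (hA : ∀ w, ‖q w‖ ≤ A * (1 + ‖w‖) ^ M) (z : Cn n) :
    ∫ w, Real.exp (-‖w‖ ^ 2) • (q w * Complex.exp (inner ℂ w z)) ∂(V n) = q z := by
  have hi := integrable_gaussian_smul_mul_cexp_inner hq.continuous hA z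
  let G : Cn n → ℂ := fun u => q (u + z) * Complex.exp (-inner ℂ z u)
  have hG : Differentiable ℂ G := by
    have : Differentiable ℂ fun u : Cn n => inner ℂ z u := (innerSL ℂ z).differentiable
    fun_prop
  have hshift (u : Cn n) : Real.exp (-‖u + z‖ ^ 2) • (q (u + z) * Complex.exp (inner ℂ (u + z) z))
      = Real.exp (-‖u‖ ^ 2) • G u := by
    have hsq (x : Cn n) : (‖x‖ : ℂ) ^ 2 = inner ℂ x x := (inner_self_eq_norm_sq_to_K x).symm
    have hexp : Complex.exp (-‖u + z‖ ^ 2) * Complex.exp (inner ℂ (u + z) z) =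
        Complex.exp (-‖u‖ ^ 2) * Complex.exp (-inner ℂ z u) := by
      simp only [← Complex.exp_add, hsq, inner_add_left, inner_add_right]
      ring_nf
    simp only [G, Complex.real_smul, Complex.ofReal_exp, Complex.ofReal_neg, Complex.ofReal_pow]
    linear_combination q (u + z) * hexp
  rw [← integral_add_right_eq_self _ z]
  have hi' := hi.comp_add_right z
  simp only [hshift] at hi' ⊢
  rw [integral_gaussian_smul_entire hG hi']
  simp [G]

lemma integral_circle_pow_mul_cexp_conj_mul (c : ℂ) (k : ℕ) :
    ∫ t : UnitAddCircle, (toCircle t : ℂ) ^ k * Complex.exp (conj (toCircle t : ℂ) * c)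
      ∂haarAddCircle = (k.factorial : ℂ)⁻¹ * c ^ k := by
  have hcoeff := fourierCoeff_entire (T := 1) (g := fun x : ℂ => Complex.exp (c * x))
    (by fun_prop) k
  rw [iteratedDeriv_cexp_const_mul] at hcoeff
  simp only [mul_zero, Complex.exp_zero, mul_one, smul_eq_mul] at hcoeff
  rw [← hcoeff, fourierCoeff, ← integral_neg_eq_self]
  refine integral_congr_ae (.of_forall fun t => ?_)
  simp only [fourier_neg_natCast_apply, toCircle_neg, Circle.coe_inv_eq_conj, Complex.conj_conj,
    mul_comm c, smul_eq_mul]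

lemma norm_homPart_le_opNorm (k : ℕ) (f : Cn n → ℂ) (z : Cn n) :
    ‖homPart k f z‖ ≤ (k.factorial : ℝ)⁻¹ * ‖iteratedFDeriv ℂ k f 0‖ * ‖z‖ ^ k := by
  rw [homPart, norm_mul, norm_inv, Complex.norm_natCast, mul_assoc]
  gcongr
  simpa using (iteratedFDeriv ℂ k f 0).le_opNorm fun _ => z

lemma integral_gaussian_smul_homPart_mul_inner_pow (f : Cn n → ℂ) (k : ℕ) (z : Cn n) :
    ∫ w, Real.exp (-‖w‖ ^ 2) • (homPart k f w * inner ℂ w z ^ k) ∂(V n) =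
      k.factorial * homPart k f z := by
  have hgrowth (w : Cn n) : ‖homPart k f w‖ ≤
      (k.factorial : ℝ)⁻¹ * ‖iteratedFDeriv ℂ k f 0‖ * (1 + ‖w‖) ^ (k : ℝ) := by
    refine (norm_homPart_le_opNorm k f w).trans ?_
    rw [Real.rpow_natCast]
    gcongr
    linarith
  have hdiff := differentiable_homPart f k
  have haverage (w : Cn n) : ∫ t : UnitAddCircle,
      homPart k f (toCircle t • w) * Complex.exp (inner ℂ (toCircle t • w) z) ∂haarAddCircle =
        (k.factorial : ℂ)⁻¹ • (homPart k f w * inner ℂ w z ^ k) := by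
    simp only [smul_eq_mul, Circle.smul_def, homPart_smul, inner_smul_left]
    rw [mul_left_comm, ← integral_circle_pow_mul_cexp_conj_mul, ← integral_const_mul]
    congr! 2
    ring
  rw [← integral_gaussian_smul_mul_cexp_inner hdiff hgrowth z,
    integral_eq_integral_integral_circle_smul
      (integrable_gaussian_smul_mul_cexp_inner hdiff.continuous hgrowth z)]
  simp only [Circle.norm_smul, integral_smul, haverage, smul_comm _ (k.factorial : ℂ)⁻¹]
  rw [smul_eq_mul, mul_inv_cancel_left₀ (Nat.cast_ne_zero.2 k.factorial_ne_zero)]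

lemma integral_radial_smul_mul_inner_pow (hn : 1 ≤ n) {f : Cn n → ℂ} (hf : Differentiable ℂ f)
    {ρ : ℝ → ℝ} {k : ℕ} {z : Cn n}
    (hi : Integrable (fun w => ρ ‖w‖ • (f w * inner ℂ w z ^ k)) (V n)) :
    ∫ w, ρ ‖w‖ • (f w * inner ℂ w z ^ k) ∂(V n) =
      k.factorial * (radialMoment n ρ k / radialMoment n (fun t => Real.exp (-t ^ 2)) k) *
        homPart k f z := by
  have haverage (w : Cn n) :
      ∫ t : UnitAddCircle, f (toCircle t • w) * inner ℂ (toCircle t • w) z ^ k ∂haarAddCircle =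
        homPart k f w * inner ℂ w z ^ k := by
    rw [homPart_eq_fourierCoeff hf, fourierCoeff, ← integral_mul_const]
    congr! 2
    rw [inner_circle_smul_left, mul_pow, fourier_neg_natCast_apply, smul_eq_mul]
    ring
  have hhom (t : ℝ) (_ : 0 < t) (w : Cn n) : homPart k f (t • w) * inner ℂ (t • w) z ^ k =
      t ^ (2 * k) • (homPart k f w * inner ℂ w z ^ k) := by
    rw [← Complex.coe_smul, homPart_smul, inner_smul_left, Complex.conj_ofReal, Complex.real_smul]
    push_cast
    ring
  have hpolar := integral_radial_smul_eq_radialMoment_smul hn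
    (h := fun w => homPart k f w * inner ℂ w z ^ k) hhom
  have hgauss := hpolar fun t => Real.exp (-t ^ 2)
  rw [integral_gaussian_smul_homPart_mul_inner_pow] at hgauss
  have hpos : (radialMoment n (fun t => Real.exp (-t ^ 2)) k : ℂ) ≠ 0 :=
    Complex.ofReal_ne_zero.2 (radialMoment_gaussian_pos hn k).ne'
  rw [integral_eq_integral_integral_circle_smul hi]
  simp only [Circle.norm_smul, integral_smul, haverage]
  rw [hpolar]
  simp only [Complex.real_smul] at hgauss ⊢
  field_simp
  linear_combination -(radialMoment n ρ k : ℂ) * hgauss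

end Gaussian

section ExpSeries

variable {A : Type*} [NormedCommRing A] [NormedAlgebra ℝ A] {a : ℕ → ℝ}

/-- The exponential generating function `∑ₖ aₖ xᵏ / k!` of the sequence `a`. Over `ℂ` these are the
kernels and over `ℝ` their majorants. -/
def expSeries (a : ℕ → ℝ) (x : A) : A := ∑' k, (a k / k.factorial) • x ^ k

lemma norm_expSeries_term_le [NormOneClass A] (ha : ∀ k, 0 ≤ a k) (x : A) (k : ℕ) :
    ‖(a k / k.factorial) • x ^ k‖ ≤ (a k / k.factorial) • ‖x‖ ^ k := by
  rw [norm_smul, Real.norm_of_nonneg (div_nonneg (ha k) k.factorial.cast_nonneg), smul_eq_mul]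
  have := ha k
  gcongr
  exact norm_pow_le x k

lemma hasSum_expSeries [NormOneClass A] [CompleteSpace A] (ha : ∀ k, 0 ≤ a k)
    (hs : ∀ x : ℝ, Summable fun k => (a k / k.factorial) • x ^ k) (x : A) :
    HasSum (fun k => (a k / k.factorial) • x ^ k) (expSeries a x) :=
  (Summable.of_norm_bounded (hs ‖x‖) (norm_expSeries_term_le ha x)).hasSum

lemma conj_expSeries (a : ℕ → ℝ) (x : ℂ) : conj (expSeries a x) = expSeries a (conj x) := by
  simp only [expSeries, Complex.conj_tsum, Complex.real_smul, map_mul, map_pow, Complex.conj_ofReal]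

end ExpSeries

section Pairing

lemma hasSum_integral_smul_mul_expSeries {X : Type*} [MeasurableSpace X] {μ : Measure X}
    {ρ : X → ℝ} {f u : X → ℂ} {b : X → ℝ} (hρ : AEStronglyMeasurable ρ μ)
    (hf : AEStronglyMeasurable f μ) (hu : AEStronglyMeasurable u μ) (hub : ∀ᵐ x ∂μ, ‖u x‖ ≤ b x)
    {a : ℕ → ℝ} (ha : ∀ k, 0 ≤ a k) (hs : ∀ x : ℝ, Summable fun k => (a k / k.factorial) • x ^ k)
    (hi : Integrable (fun x => ‖ρ x‖ * (‖f x‖ * expSeries a (b x))) μ) :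
    (∀ k, a k ≠ 0 → Integrable (fun x => ρ x • (f x * u x ^ k)) μ) ∧
    HasSum (fun k => (a k / k.factorial) • ∫ x, ρ x • (f x * u x ^ k) ∂μ)
      (∫ x, ρ x • (f x * expSeries a (u x)) ∂μ) := by
  let F (k : ℕ) (x : X) : ℂ := (a k / k.factorial) • ρ x • (f x * u x ^ k)
  let B (k : ℕ) (x : X) : ℝ := ‖ρ x‖ * (‖f x‖ * ((a k / k.factorial) • b x ^ k))
  have hFmeas (k : ℕ) : AEStronglyMeasurable (F k) μ :=
    (hρ.smul (hf.mul (hu.pow k))).const_smul (a k / k.factorial)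
  have hFB : ∀ᵐ x ∂μ, ∀ k, ‖F k x‖ ≤ B k x := by
    filter_upwards [hub] with x hx k
    have := ha k
    calc ‖F k x‖ = ‖ρ x‖ * (‖f x‖ * ((a k / k.factorial) • ‖u x‖ ^ k)) := by
          rw [norm_smul, norm_smul, norm_mul, norm_pow, Real.norm_of_nonneg (by positivity),
            smul_eq_mul]
          ring
      _ ≤ B k x := by simp only [B, smul_eq_mul]; gcongr
  have hB (x : X) : HasSum (B · x) (‖ρ x‖ * (‖f x‖ * expSeries a (b x))) :=
    ((hs (b x)).hasSum.mul_left _).mul_left _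
  have hF (x : X) : HasSum (F · x) (ρ x • (f x * expSeries a (u x))) := by
    simpa only [F, smul_comm (a _ / _), mul_smul_comm] using
      ((hasSum_expSeries ha hs (u x)).mul_left (f x)).const_smul (ρ x)
  constructor
  · intro k hk
    have hFi : Integrable (F k) μ := hi.mono' (hFmeas k) <| by
      filter_upwards [hFB] with x hx
      exact (hx k).trans (le_hasSum (hB x) k fun j _ => (norm_nonneg _).trans (hx j))
    exact (integrable_fun_smul_iff (by positivity) _).1 hFi
  · simp only [← integral_smul]
    exact hasSum_integral_of_dominated_convergence B hFmeas (fun k => hFB.mono fun x hx => hx k)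
      (.of_forall fun x => (hB x).summable) (by simpa only [(hB _).tsum_eq] using hi)
      (.of_forall hF)

lemma hasSum_integral_radial_smul_mul_expSeries_inner {n : ℕ} (hn : 1 ≤ n) {f : Cn n → ℂ}
    (hf : Differentiable ℂ f) {ρ : ℝ → ℝ} (hρ : Measurable ρ) {a : ℕ → ℝ} (ha : ∀ k, 0 ≤ a k)
    (hs : ∀ x : ℝ, Summable fun k => (a k / k.factorial) • x ^ k) {z : Cn n}
    (hi : Integrable (fun w => ‖ρ ‖w‖‖ * (‖f w‖ * expSeries a (‖w‖ * ‖z‖))) (V n)) :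
    HasSum (fun k => ((a k * (radialMoment n ρ k /
        radialMoment n (fun t => Real.exp (-t ^ 2)) k) : ℝ) : ℂ) * homPart k f z)
      (∫ w, ρ ‖w‖ • (f w * expSeries a (inner ℂ w z)) ∂(V n)) := by
  have hf' := hf.continuous
  obtain ⟨hint, hsum⟩ := hasSum_integral_smul_mul_expSeries (ρ := fun w => ρ ‖w‖)
    (u := fun w => inner ℂ w z) (b := fun w => ‖w‖ * ‖z‖)
    (hρ.comp measurable_norm).aestronglyMeasurable hf'.aestronglyMeasurable
    (Continuous.aestronglyMeasurable (by fun_prop))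
    (.of_forall fun w => norm_inner_le_norm w z) ha hs hi
  refine hsum.congr_fun fun k => ?_
  by_cases hk : a k = 0
  · simp [hk]
  · rw [integral_radial_smul_mul_inner_pow hn hf (hint k hk), Complex.real_smul]
    have : (k.factorial : ℂ) ≠ 0 := Nat.cast_ne_zero.2 k.factorial_ne_zero
    push_cast
    field_simp

end Pairing

section BetaIntegral

variable {u v : ℝ}

lemma re_betaIntegrand {t : ℝ} (ht : t ∈ Set.Ioo (0 : ℝ) 1) :
    ((t : ℂ) ^ ((u : ℂ) - 1) * (1 - (t : ℂ)) ^ ((v : ℂ) - 1)).re =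
      t ^ (u - 1) * (1 - t) ^ (v - 1) := by
  rw [← Complex.ofReal_one, ← Complex.ofReal_sub, ← Complex.ofReal_sub, ← Complex.ofReal_sub,
    ← Complex.ofReal_cpow ht.1.le, ← Complex.ofReal_cpow (sub_pos.2 ht.2).le, ← Complex.ofReal_mul,
    Complex.ofReal_re]

lemma integrableOn_cpow_beta (hu : 0 < u) (hv : 0 < v) :
    IntegrableOn (fun t : ℝ => (t : ℂ) ^ ((u : ℂ) - 1) * (1 - (t : ℂ)) ^ ((v : ℂ) - 1))
      (Set.Ioo 0 1) :=
  (intervalIntegrable_iff_integrableOn_Ioo_of_le zero_le_one).1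
    (Complex.betaIntegral_convergent (by simpa) (by simpa))

lemma integrableOn_beta (hu : 0 < u) (hv : 0 < v) :
    IntegrableOn (fun t : ℝ => t ^ (u - 1) * (1 - t) ^ (v - 1)) (Set.Ioo 0 1) :=
  IntegrableOn.congr_fun (integrableOn_cpow_beta hu hv).re (fun _ ht => re_betaIntegrand ht)
    measurableSet_Ioo

lemma integral_beta (hu : 0 < u) (hv : 0 < v) :
    ∫ t in Set.Ioo (0 : ℝ) 1, t ^ (u - 1) * (1 - t) ^ (v - 1) =
      Real.Gamma u * Real.Gamma v / Real.Gamma (u + v) := by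
  rw [← ProbabilityTheory.beta, ProbabilityTheory.beta_eq_betaIntegralReal u v hu hv,
    Complex.betaIntegral, intervalIntegral.integral_of_le zero_le_one,
    integral_Ioc_eq_integral_Ioo]
  exact (setIntegral_congr_fun measurableSet_Ioo fun t ht => (re_betaIntegrand ht).symm).trans
    (integral_re (integrableOn_cpow_beta hu hv))

lemma integrableOn_rpow_sub_one (hu : 0 < u) :
    IntegrableOn (fun t : ℝ => t ^ (u - 1)) (Set.Ioo 0 1) := by
  simpa using integrableOn_beta hu one_pos

lemma integrableOn_exp_mul_rpow (hu : 0 < u) (s : ℝ) :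
    IntegrableOn (fun t : ℝ => Real.exp ((1 - t) * s) * t ^ (u - 1)) (Set.Ioo 0 1) :=
  (((integrableOn_Icc_iff_integrableOn_Ioo).2 (integrableOn_rpow_sub_one hu)).continuousOn_mul
    (by fun_prop) isCompact_Icc).mono_set Set.Ioo_subset_Icc_self

lemma integral_exp_mul_rpow_le_Gamma (hu : 0 < u) {s : ℝ} (hs : 0 < s) :
    ∫ t in Set.Ioo (0 : ℝ) 1, Real.exp ((1 - t) * s) * t ^ (u - 1) ≤
      Real.exp s * ((1 / s) ^ u * Real.Gamma u) := by
  have hGamma := Real.integral_rpow_mul_exp_neg_mul_Ioi hu hs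
  have hint : IntegrableOn (fun t : ℝ => t ^ (u - 1) * Real.exp (-(s * t))) (Set.Ioi 0) := by
    refine .of_integral_ne_zero ?_
    rw [hGamma]
    have := Real.Gamma_pos_of_pos hu
    positivity
  calc ∫ t in Set.Ioo (0 : ℝ) 1, Real.exp ((1 - t) * s) * t ^ (u - 1)
      = Real.exp s * ∫ t in Set.Ioo (0 : ℝ) 1, t ^ (u - 1) * Real.exp (-(s * t)) := by
        rw [← integral_const_mul]
        refine setIntegral_congr_fun measurableSet_Ioo fun t _ => ?_
        rw [show (1 - t) * s = s + -(s * t) by ring, Real.exp_add]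
        ring
    _ ≤ Real.exp s * ∫ t in Set.Ioi (0 : ℝ), t ^ (u - 1) * Real.exp (-(s * t)) := by
        refine mul_le_mul_of_nonneg_left
          (setIntegral_mono_set hint ?_ Set.Ioo_subset_Ioi_self.eventuallyLE) (Real.exp_nonneg s)
        filter_upwards [ae_restrict_mem measurableSet_Ioi] with t (ht : 0 < t)
        simp only [Pi.zero_apply]
        positivity
    _ = Real.exp s * ((1 / s) ^ u * Real.Gamma u) := by rw [hGamma]

lemma integral_exp_mul_rpow_le_exp (hu : 0 < u) {s m : ℝ} (hm : 0 ≤ m) (hsm : s ≤ m) :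
    ∫ t in Set.Ioo (0 : ℝ) 1, Real.exp ((1 - t) * s) * t ^ (u - 1) ≤
      Real.exp m * ∫ t in Set.Ioo (0 : ℝ) 1, t ^ (u - 1) := by
  rw [← integral_const_mul]
  refine setIntegral_mono_on (integrableOn_exp_mul_rpow hu s)
    ((integrableOn_rpow_sub_one hu).const_mul _) measurableSet_Ioo fun t ht => ?_
  have := Real.rpow_nonneg ht.1.le (u - 1)
  gcongr
  nlinarith [ht.1, ht.2]

end BetaIntegral

section KernelBound

/-- The function with which the kernels are compared. The second summand takes over where `x` is
far away from the positive real axis. -/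
def kernelBound (σ : ℝ) (x : ℂ) : ℝ :=
  (1 + ‖x‖) ^ σ * (Real.exp x.re + Real.exp (‖x‖ / 2))

lemma kernelBound_nonneg (σ : ℝ) (x : ℂ) : 0 ≤ kernelBound σ x := by
  unfold kernelBound
  positivity

lemma rpow_mul_exp_re_le_kernelBound (σ : ℝ) (x : ℂ) :
    (1 + ‖x‖) ^ σ * Real.exp x.re ≤ kernelBound σ x := by
  unfold kernelBound
  gcongr
  exact le_add_of_nonneg_right (Real.exp_nonneg _)

lemma kernelBound_add_one (σ : ℝ) (x : ℂ) :
    kernelBound (σ + 1) x = (1 + ‖x‖) * kernelBound σ x := by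
  unfold kernelBound
  rw [Real.rpow_add_one (by positivity)]
  ring

lemma exists_kernelBound_le_exp (σ : ℝ) :
    ∃ C : ℝ, 0 ≤ C ∧ ∀ x : ℂ, kernelBound σ x ≤ C * Real.exp (2 * ‖x‖) := by
  obtain ⟨C, hC, hgrowth⟩ := exists_one_add_rpow_le_exp σ one_pos
  refine ⟨C * 2, by positivity, fun x => ?_⟩
  have hre : x.re ≤ ‖x‖ := Complex.re_le_norm x
  calc kernelBound σ x ≤ C * Real.exp (1 * ‖x‖) * (Real.exp ‖x‖ + Real.exp ‖x‖) := by
        unfold kernelBound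
        gcongr
        · exact hgrowth _ (norm_nonneg x)
        · linarith [norm_nonneg x]
    _ = C * 2 * Real.exp (2 * ‖x‖) := by
        rw [one_mul, two_mul ‖x‖, Real.exp_add]
        ring

lemma exists_rpow_mul_exp_le_kernelBound (M σ : ℝ) :
    ∃ C : ℝ, 0 < C ∧ ∀ x : ℂ, (1 + ‖x‖) ^ M * Real.exp (‖x‖ / 4) ≤ C * kernelBound σ x := by
  obtain ⟨C, hC, hgrowth⟩ := exists_one_add_rpow_le_exp (M - σ) (c := 1 / 4) (by norm_num)
  refine ⟨C, hC, fun x => ?_⟩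
  calc (1 + ‖x‖) ^ M * Real.exp (‖x‖ / 4)
      = (1 + ‖x‖) ^ σ * ((1 + ‖x‖) ^ (M - σ) * Real.exp (‖x‖ / 4)) := by
        rw [← mul_assoc, ← Real.rpow_add (by positivity), add_sub_cancel]
    _ ≤ (1 + ‖x‖) ^ σ * (C * Real.exp (1 / 4 * ‖x‖) * Real.exp (‖x‖ / 4)) := by
        gcongr
        exact hgrowth _ (norm_nonneg x)
    _ = C * ((1 + ‖x‖) ^ σ * Real.exp (‖x‖ / 2)) := by
        rw [mul_assoc C, ← Real.exp_add]
        ring_nf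
    _ ≤ C * kernelBound σ x := by
        unfold kernelBound
        gcongr
        exact le_add_of_nonneg_left (Real.exp_nonneg _)

/- If `Re x ≥ |x| / 4` the mass of the integral sits within `1 / Re x` of `0`; otherwise
`exp ((1 - t) Re x)` is at most `exp (|x| / 4)`, which is absorbed by `exp (|x| / 2)`. -/
lemma exists_integral_exp_mul_rpow_le_kernelBound {γ : ℝ} (hγ : 0 < γ) :
    ∃ C : ℝ, 0 ≤ C ∧ ∀ x : ℂ, ∫ t in Set.Ioo (0 : ℝ) 1, Real.exp ((1 - t) * x.re) * t ^ (γ - 1) ≤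
      C * kernelBound (-γ) x := by
  set J : ℝ := ∫ t in Set.Ioo (0 : ℝ) 1, t ^ (γ - 1)
  have hJ : 0 ≤ J := setIntegral_nonneg measurableSet_Ioo fun t ht => Real.rpow_nonneg ht.1.le _
  have := Real.Gamma_pos_of_pos hγ
  obtain ⟨C, hC, habsorb⟩ := exists_rpow_mul_exp_le_kernelBound 0 (-γ)
  refine ⟨8 ^ γ * Real.Gamma γ + Real.exp 1 * J * C, by positivity, fun x => ?_⟩
  have hB := kernelBound_nonneg (-γ) x
  by_cases hx : 1 ≤ ‖x‖ ∧ ‖x‖ / 4 ≤ x.re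
  · have hre : 0 < x.re := by linarith
    calc ∫ t in Set.Ioo (0 : ℝ) 1, Real.exp ((1 - t) * x.re) * t ^ (γ - 1)
        ≤ Real.exp x.re * ((1 / x.re) ^ γ * Real.Gamma γ) := integral_exp_mul_rpow_le_Gamma hγ hre
      _ ≤ Real.exp x.re * ((8 / (1 + ‖x‖)) ^ γ * Real.Gamma γ) := by
          have : 1 / x.re ≤ 8 / (1 + ‖x‖) := by
            rw [div_le_div_iff₀ hre (by positivity)]
            linarith
          gcongr Real.exp x.re * (?_ ^ γ * Real.Gamma γ)
      _ = 8 ^ γ * Real.Gamma γ * ((1 + ‖x‖) ^ (-γ) * Real.exp x.re) := by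
          rw [Real.div_rpow (by norm_num) (by positivity), Real.rpow_neg (by positivity)]
          ring
      _ ≤ (8 ^ γ * Real.Gamma γ + Real.exp 1 * J * C) * kernelBound (-γ) x := by
          gcongr
          · exact le_add_of_nonneg_right (by positivity)
          · exact rpow_mul_exp_re_le_kernelBound _ x
  · have hre : x.re ≤ 1 + ‖x‖ / 4 := by
      by_contra! h
      exact hx ⟨by linarith [Complex.re_le_norm x], by linarith⟩
    calc ∫ t in Set.Ioo (0 : ℝ) 1, Real.exp ((1 - t) * x.re) * t ^ (γ - 1)
        ≤ Real.exp (1 + ‖x‖ / 4) * J := integral_exp_mul_rpow_le_exp hγ (by positivity) hre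
      _ = Real.exp 1 * J * ((1 + ‖x‖) ^ (0 : ℝ) * Real.exp (‖x‖ / 4)) := by
          rw [Real.exp_add, Real.rpow_zero]
          ring
      _ ≤ Real.exp 1 * J * (C * kernelBound (-γ) x) := by
          gcongr Real.exp 1 * J * ?_
          exact habsorb x
      _ ≤ (8 ^ γ * Real.Gamma γ + Real.exp 1 * J * C) * kernelBound (-γ) x := by
          rw [← mul_assoc]
          gcongr
          exact le_add_of_nonneg_left (by positivity)

end KernelBound

section ExpSeriesGrowth

variable {σ : ℝ} {a b : ℕ → ℝ}

/-- The exponential generating function of `a` is entire and dominated by `kernelBound σ`. -/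
def ExpSeriesGrowth (σ : ℝ) (a : ℕ → ℝ) : Prop :=
  (∀ x : ℂ, Summable fun k => (a k / k.factorial) • x ^ k) ∧
    ∃ C : ℝ, 0 ≤ C ∧ ∀ x : ℂ, ‖expSeries a x‖ ≤ C * kernelBound σ x

namespace ExpSeriesGrowth

lemma add (ha : ExpSeriesGrowth σ a) (hb : ExpSeriesGrowth σ b) : ExpSeriesGrowth σ (a + b) := by
  obtain ⟨hsa, C, hC, hCa⟩ := ha
  obtain ⟨hsb, D, hD, hDb⟩ := hb
  have hterm (x : ℂ) (k : ℕ) : ((a + b) k / k.factorial) • x ^ k =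
      (a k / k.factorial) • x ^ k + (b k / k.factorial) • x ^ k := by
    rw [Pi.add_apply, add_div, add_smul]
  refine ⟨fun x => by simpa only [hterm] using (hsa x).add (hsb x), C + D, add_nonneg hC hD,
    fun x => ?_⟩
  have hsum : expSeries (a + b) x = expSeries a x + expSeries b x := by
    simp only [expSeries, hterm, (hsa x).tsum_add (hsb x)]
  rw [hsum, add_mul]
  exact norm_add_le_of_le (hCa x) (hDb x)

lemma const_mul (ha : ExpSeriesGrowth σ a) (c : ℝ) : ExpSeriesGrowth σ fun k => c * a k := by
  obtain ⟨hs, C, hC, hCa⟩ := ha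
  have hterm (x : ℂ) (k : ℕ) :
      (c * a k / k.factorial) • x ^ k = c • (a k / k.factorial) • x ^ k := by
    rw [mul_div_assoc, mul_smul]
  refine ⟨fun x => by simpa only [hterm] using (hs x).const_smul c, ‖c‖ * C, by positivity,
    fun x => ?_⟩
  simp only [expSeries, hterm, tsum_const_smul'', norm_smul, mul_assoc]
  gcongr
  exact hCa x

lemma add_one (ha : ExpSeriesGrowth σ a) : ExpSeriesGrowth (σ + 1) a := by
  obtain ⟨hs, C, hC, hCa⟩ := ha
  refine ⟨hs, C, hC, fun x => (hCa x).trans ?_⟩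
  rw [kernelBound_add_one]
  gcongr
  exact le_mul_of_one_le_left (kernelBound_nonneg σ x) (by linarith [norm_nonneg x])

lemma natCast_mul (ha : ExpSeriesGrowth σ fun k => a (k + 1)) :
    ExpSeriesGrowth (σ + 1) fun k => k * a k := by
  obtain ⟨hs, C, hC, hCa⟩ := ha
  have hsum (x : ℂ) : HasSum (fun k : ℕ => (k * a k / k.factorial) • x ^ k)
      (x * expSeries (fun k => a (k + 1)) x) := by
    rw [← hasSum_nat_add_iff' 1]
    simp only [Finset.range_one, Finset.sum_singleton, Nat.cast_zero, zero_mul, zero_div, zero_smul,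
      sub_zero]
    refine ((hs x).hasSum.mul_left x).congr_fun fun k => ?_
    rw [pow_succ', mul_smul_comm, Nat.factorial_succ]
    push_cast
    rw [mul_div_mul_left _ _ (by positivity)]
  refine ⟨fun x => (hsum x).summable, C, hC, fun x => ?_⟩
  rw [expSeries, (hsum x).tsum_eq, norm_mul, kernelBound_add_one]
  calc ‖x‖ * ‖expSeries (fun k => a (k + 1)) x‖ ≤ (1 + ‖x‖) * (C * kernelBound σ x) := by
        gcongr
        · linarith
        · exact hCa x
    _ = C * ((1 + ‖x‖) * kernelBound σ x) := by ring

lemma of_eventually_zero {N : ℕ} (ha : ∀ k, N ≤ k → a k = 0) : ExpSeriesGrowth σ a := by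
  obtain ⟨C, hC, habsorb⟩ := exists_rpow_mul_exp_le_kernelBound N σ
  have hzero (x : ℂ) (k : ℕ) (hk : k ∉ Finset.range N) : (a k / k.factorial) • x ^ k = 0 := by
    rw [ha k (by simpa using hk), zero_div, zero_smul]
  refine ⟨fun x => summable_of_ne_finset_zero (hzero x),
    (∑ k ∈ Finset.range N, ‖a k / k.factorial‖) * C, by positivity, fun x => ?_⟩
  rw [expSeries, tsum_eq_sum (hzero x), mul_assoc, Finset.sum_mul]
  refine norm_sum_le_of_le _ fun k hk => ?_
  rw [norm_smul, norm_pow]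
  gcongr
  calc ‖x‖ ^ k ≤ (1 + ‖x‖) ^ k := by gcongr; linarith
    _ ≤ (1 + ‖x‖) ^ N :=
        pow_le_pow_right₀ (by linarith [norm_nonneg x]) (Finset.mem_range.1 hk).le
    _ ≤ (1 + ‖x‖) ^ (N : ℝ) * Real.exp (‖x‖ / 4) := by
        rw [Real.rpow_natCast]
        exact le_mul_of_one_le_right (by positivity) (Real.one_le_exp (by positivity))
    _ ≤ C * kernelBound σ x := habsorb x

lemma congr_eventually (ha : ExpSeriesGrowth σ a) {N : ℕ} (hb : ∀ k, N ≤ k → b k = a k) :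
    ExpSeriesGrowth σ b := by
  have hdiff : ExpSeriesGrowth σ (b - a) :=
    of_eventually_zero fun k hk => by rw [Pi.sub_apply, hb k hk, sub_self]
  simpa using ha.add hdiff

end ExpSeriesGrowth

lemma Gamma_div_Gamma_eq_integral {b γ : ℝ} (hb : 0 < b) (hγ : 0 < γ) (k : ℕ) :
    Real.Gamma (k + b) / Real.Gamma (k + b + γ) = (Real.Gamma γ)⁻¹ *
      ∫ t in Set.Ioo (0 : ℝ) 1, t ^ (γ - 1) * (1 - t) ^ (b - 1) * (1 - t) ^ k := by
  have hbeta := integral_beta hγ (show 0 < k + b by positivity)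
  have hpow : ∫ t in Set.Ioo (0 : ℝ) 1, t ^ (γ - 1) * (1 - t) ^ (b - 1) * (1 - t) ^ k =
      ∫ t in Set.Ioo (0 : ℝ) 1, t ^ (γ - 1) * (1 - t) ^ (k + b - 1) := by
    refine setIntegral_congr_fun measurableSet_Ioo fun t ht => ?_
    rw [mul_assoc, ← Real.rpow_add_natCast (sub_pos.2 ht.2).ne']
    ring_nf
  rw [hpow, hbeta, add_comm γ]
  have := (Real.Gamma_pos_of_pos hγ).ne'
  field_simp

lemma expSeries_one (x : ℂ) : expSeries (fun _ => 1) x = Complex.exp x := by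
  simp only [expSeries, Complex.exp_eq_exp_ℂ, NormedSpace.exp_eq_tsum_div, one_div,
    Complex.real_smul, Complex.ofReal_inv, Complex.ofReal_natCast, ← div_eq_inv_mul]

lemma hasSum_Gamma_div_Gamma {b γ : ℝ} (hb : 0 < b) (hγ : 0 < γ) (x : ℂ) :
    HasSum (fun k : ℕ => (Real.Gamma (k + b) / Real.Gamma (k + b + γ) / k.factorial) • x ^ k)
      ((Real.Gamma γ)⁻¹ • ∫ t in Set.Ioo (0 : ℝ) 1,
        (t ^ (γ - 1) * (1 - t) ^ (b - 1)) • Complex.exp (x * (1 - t : ℝ))) := by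
  have hint := integrableOn_beta hγ hb
  have hle : ∀ᵐ t ∂volume.restrict (Set.Ioo (0 : ℝ) 1), ‖x * (1 - t : ℝ)‖ ≤ ‖x‖ := by
    filter_upwards [ae_restrict_mem measurableSet_Ioo] with t ht
    rw [norm_mul, Complex.norm_real, Real.norm_of_nonneg (sub_pos.2 ht.2).le]
    exact mul_le_of_le_one_right (norm_nonneg x) (sub_le_self 1 ht.1.le)
  have hsum := (hasSum_integral_smul_mul_expSeries hint.aestronglyMeasurable
    (f := fun _ => 1) aestronglyMeasurable_const
    (Continuous.aestronglyMeasurable (by fun_prop)) hle (a := fun _ => 1) (fun _ => zero_le_one)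
    (fun y => by simpa [div_eq_inv_mul] using Real.summable_pow_div_factorial y)
    (hint.norm.mul_const _)).2
  simp only [one_mul, expSeries_one] at hsum
  refine (hsum.const_smul (Real.Gamma γ)⁻¹).congr_fun fun k => ?_
  have hpow (t : ℝ) : (t ^ (γ - 1) * (1 - t) ^ (b - 1)) • (x * (1 - t : ℝ)) ^ k =
      (t ^ (γ - 1) * (1 - t) ^ (b - 1) * (1 - t) ^ k) • x ^ k := by
    rw [mul_pow, Complex.real_smul, Complex.real_smul, Complex.ofReal_mul (_ * _),
      Complex.ofReal_pow]
    ring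
  simp only [hpow]
  rw [integral_smul_const, Gamma_div_Gamma_eq_integral hb hγ, smul_smul, smul_smul]
  ring_nf

lemma expSeriesGrowth_Gamma_div_Gamma {b γ : ℝ} (hb : 1 ≤ b) (hγ : 0 < γ) :
    ExpSeriesGrowth (-γ) fun k => Real.Gamma (k + b) / Real.Gamma (k + b + γ) := by
  obtain ⟨C, hC0, hC⟩ := exists_integral_exp_mul_rpow_le_kernelBound hγ
  have hsum := hasSum_Gamma_div_Gamma (zero_lt_one.trans_le hb) hγ
  have hΓ := inv_pos.2 (Real.Gamma_pos_of_pos hγ)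
  refine ⟨fun x => (hsum x).summable, (Real.Gamma γ)⁻¹ * C, by positivity, fun x => ?_⟩
  rw [expSeries, (hsum x).tsum_eq, norm_smul, Real.norm_of_nonneg hΓ.le, mul_assoc]
  gcongr
  refine le_trans ?_ (hC x)
  refine norm_integral_le_of_norm_le (integrableOn_exp_mul_rpow hγ _) ?_
  filter_upwards [ae_restrict_mem measurableSet_Ioo] with t ⟨ht0, ht1⟩
  have hweight : t ^ (γ - 1) * (1 - t) ^ (b - 1) ≤ t ^ (γ - 1) :=
    mul_le_of_le_one_right (by positivity)
      (Real.rpow_le_one (by linarith) (by linarith) (by linarith))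
  have hweight0 : 0 ≤ t ^ (γ - 1) * (1 - t) ^ (b - 1) :=
    mul_nonneg (by positivity) (Real.rpow_nonneg (by linarith) _)
  rw [norm_smul, Complex.norm_exp, Complex.re_mul_ofReal, Real.norm_of_nonneg hweight0, mul_comm,
    mul_comm x.re]
  gcongr

/- The case `s < 0` is a Beta integral. Since `b + k - s` times the coefficient for `s - 1` is the
one for `s`, induction gives larger `s`, provided that shifted sequences are treated as well. -/
lemma expSeriesGrowth_Gamma_ratio {b : ℝ} (hb : 1 ≤ b) (s : ℝ) :
    ExpSeriesGrowth s fun k => Real.Gamma (k + b) / Real.Gamma (k + b - s) := by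
  obtain ⟨m, hm⟩ := exists_nat_gt s
  induction m generalizing b s with
  | zero =>
    simpa only [neg_neg, ← sub_eq_add_neg] using
      expSeriesGrowth_Gamma_div_Gamma hb (γ := -s) (by simpa using hm)
  | succ m ih =>
    have hs : s - 1 < m := by
      push_cast at hm
      linarith
    let a (k : ℕ) : ℝ := Real.Gamma (k + b) / Real.Gamma (k + b - (s - 1))
    have hshift : ExpSeriesGrowth (s - 1) fun k => a (k + 1) := by
      simpa only [a, Nat.cast_add_one, add_assoc, add_comm 1 b] using
        ih (b := b + 1) (by linarith) _ hs
    have h := hshift.natCast_mul.add ((ih hb _ hs).const_mul (b - s)).add_one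
    rw [sub_add_cancel] at h
    convert h using 2 with k
    have hrec : Real.Gamma (k + b) / Real.Gamma (k + b - s) = (k + b - s) * a k := by
      simp only [a, show (k : ℝ) + b - (s - 1) = k + b - s + 1 by ring]
      by_cases h0 : (k : ℝ) + b - s = 0
      · simp [h0]
      · rw [Real.Gamma_add_one h0]
        field_simp
    rw [Pi.add_apply, hrec]
    simp only [a]
    ring

end ExpSeriesGrowth

section ExpSeries

variable {σ : ℝ} {a : ℕ → ℝ}

lemma ofReal_expSeries (a : ℕ → ℝ) (x : ℝ) : ((expSeries a x : ℝ) : ℂ) = expSeries a (x : ℂ) := by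
  simp [expSeries, Complex.ofReal_tsum]

lemma expSeries_nonneg (ha : ∀ k, 0 ≤ a k) {x : ℝ} (hx : 0 ≤ x) : 0 ≤ expSeries a x :=
  tsum_nonneg fun k => by have := ha k; positivity

lemma expSeries_mul_le (ha : ∀ k, 0 ≤ a k)
    (hs : ∀ x : ℝ, Summable fun k => (a k / k.factorial) • x ^ k) {m : ℕ} (hm : ∀ k < m, a k = 0)
    {t x : ℝ} (ht0 : 0 ≤ t) (ht : t ≤ 1) (hx : 0 ≤ x) :
    expSeries a (t * x) ≤ t ^ m * expSeries a x := by
  unfold expSeries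
  rw [← tsum_mul_left]
  refine (hs _).tsum_le_tsum (fun k => ?_) ((hs x).mul_left _)
  obtain hk | hk := lt_or_ge k m
  · simp [hm k hk]
  · have := ha k
    have htk : t ^ k ≤ t ^ m := pow_le_pow_of_le_one ht0 ht hk
    calc (a k / k.factorial) • (t * x) ^ k = (a k / k.factorial) * (t ^ k * x ^ k) := by
          rw [mul_pow, smul_eq_mul]
      _ ≤ (a k / k.factorial) * (t ^ m * x ^ k) := by gcongr
      _ = t ^ m * ((a k / k.factorial) • x ^ k) := by rw [smul_eq_mul]; ring

namespace ExpSeriesGrowth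

lemma summable_real (h : ExpSeriesGrowth σ a) (x : ℝ) :
    Summable fun k => (a k / k.factorial) • x ^ k := by
  rw [← Complex.summable_ofReal]
  simpa using h.1 x

lemma exists_norm_expSeries_le_exp (h : ExpSeriesGrowth σ a) :
    ∃ C : ℝ, 0 ≤ C ∧ ∀ x : ℂ, ‖expSeries a x‖ ≤ C * Real.exp (2 * ‖x‖) := by
  obtain ⟨-, C, hC, hbound⟩ := h
  obtain ⟨D, hD, hkernel⟩ := exists_kernelBound_le_exp σ
  refine ⟨C * D, by positivity, fun x => (hbound x).trans ?_⟩
  rw [mul_assoc]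
  gcongr
  exact hkernel x

lemma differentiable_expSeries (h : ExpSeriesGrowth σ a) :
    Differentiable ℂ (expSeries a : ℂ → ℂ) := by
  intro x
  have hball : DifferentiableOn ℂ (expSeries a : ℂ → ℂ) (Metric.ball 0 (‖x‖ + 1)) := by
    refine Complex.differentiableOn_tsum_of_summable_norm (h.summable_real (‖x‖ + 1)).norm
      (fun k => by fun_prop) Metric.isOpen_ball fun k w hw => ?_
    rw [norm_smul, norm_smul, norm_pow, norm_pow, Real.norm_of_nonneg (by positivity : 0 ≤ ‖x‖ + 1)]
    gcongr
    simpa using (Metric.mem_ball.1 hw).le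
  exact hball.differentiableAt (Metric.isOpen_ball.mem_nhds (by simp))

lemma continuous_expSeries_real (h : ExpSeriesGrowth σ a) : Continuous (expSeries a : ℝ → ℝ) := by
  have : Continuous fun x : ℝ => (expSeries a (x : ℂ)).re :=
    Complex.continuous_re.comp
      (h.differentiable_expSeries.continuous.comp Complex.continuous_ofReal)
  simpa only [← ofReal_expSeries, Complex.ofReal_re] using this

end ExpSeriesGrowth

end ExpSeries

section Weights

variable {n : ℕ}

lemma eLpNorm_withDensity_ofReal {X E : Type*} [MeasurableSpace X] {μ : Measure X}
    [NormedAddCommGroup E] [NormedSpace ℝ E] {p : ℝ≥0∞} (hp0 : p ≠ 0) (hp : p ≠ ∞) {d : X → ℝ}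
    (hd : Measurable d) (hd0 : ∀ x, 0 ≤ d x) (f : X → E) :
    eLpNorm f p (μ.withDensity fun x => ENNReal.ofReal (d x)) =
      eLpNorm (fun x => d x ^ p.toReal⁻¹ • f x) p μ := by
  have hp' : 0 < p.toReal := ENNReal.toReal_pos hp0 hp
  have hdensity (x : X) : ‖d x ^ p.toReal⁻¹‖ₑ ^ p.toReal = ENNReal.ofReal (d x) := by
    have hroot : 0 ≤ d x ^ p.toReal⁻¹ := Real.rpow_nonneg (hd0 x) _
    rw [Real.enorm_of_nonneg hroot, ENNReal.ofReal_rpow_of_nonneg hroot hp'.le,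
      Real.rpow_inv_rpow (hd0 x) hp'.ne']
  rw [eLpNorm_eq_lintegral_rpow_enorm_toReal hp0 hp, eLpNorm_eq_lintegral_rpow_enorm_toReal hp0 hp,
    lintegral_withDensity_eq_lintegral_mul_non_measurable _ (by fun_prop)
      (.of_forall fun _ => ENNReal.ofReal_lt_top)]
  simp only [enorm_smul, ENNReal.mul_rpow_of_nonneg _ _ hp'.le, hdensity, Pi.mul_apply]

/-- The exponent `γ` for which the norms of `F^p_β` and `𝓛^{p,r}_β` are the unweighted `L^p` norms
of `weightF γ • f` and `weightL γ • f`. -/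
def weightExp (p : ℝ≥0∞) (β : ℝ) : ℝ := if p = ∞ then β else β / p.toReal

lemma ite_eLpNorm_eq_eLpNorm_weight_smul {p : ℝ≥0∞} (hp : 1 ≤ p) (β : ℝ) {μ : Measure (Cn n)}
    {u : Cn n → ℝ} (hu : Measurable u) (hu0 : ∀ z, 0 ≤ u z) (f : Cn n → ℂ) :
    (if p = ∞ then
      eLpNorm (fun z => f z * ((Real.exp (-‖z‖ ^ 2 / 2) / u z ^ β : ℝ) : ℂ)) ∞ μ
    else eLpNorm (fun z => f z * ((Real.exp (-‖z‖ ^ 2 / 2) : ℝ) : ℂ)) p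
      (μ.withDensity fun z => ENNReal.ofReal (u z ^ (-β)))) =
      eLpNorm (fun z => (Real.exp (-‖z‖ ^ 2 / 2) * u z ^ (-weightExp p β)) • f z) p μ := by
  unfold weightExp
  split_ifs with h
  · subst h
    congr 1 with z
    rw [Real.rpow_neg (hu0 z), div_eq_mul_inv, Complex.real_smul, mul_comm]
  · rw [eLpNorm_withDensity_ofReal (zero_lt_one.trans_le hp).ne' h (by fun_prop)
      fun z => Real.rpow_nonneg (hu0 z) _]
    congr 1 with z
    rw [← Real.rpow_mul (hu0 z), Complex.real_smul, Complex.real_smul, neg_mul, ← div_eq_mul_inv]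
    push_cast
    ring

/-- The weight of the space `F^p_β`, with `γ = weightExp p β`. -/
def weightF (γ : ℝ) (z : Cn n) : ℝ := Real.exp (-‖z‖ ^ 2 / 2) * (1 + ‖z‖) ^ (-γ)

/-- The weight of the space `𝓛^{p,r}_β`, with `γ = weightExp p β`. -/
def weightL (γ : ℝ) (z : Cn n) : ℝ := Real.exp (-‖z‖ ^ 2 / 2) * ‖z‖ ^ (-γ)

lemma weightF_pos (γ : ℝ) (z : Cn n) : 0 < weightF γ z := by
  unfold weightF
  positivity

lemma weightL_nonneg (γ : ℝ) (z : Cn n) : 0 ≤ weightL γ z := by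
  unfold weightL
  positivity

lemma measurable_weightL (γ : ℝ) : Measurable (weightL γ : Cn n → ℝ) := by
  unfold weightL
  fun_prop

lemma continuous_weightF (γ : ℝ) : Continuous (weightF γ : Cn n → ℝ) :=
  Continuous.mul (by fun_prop)
    (Continuous.rpow_const (by fun_prop) fun z => .inl (by positivity))

lemma measurableSet_Om (r : ℝ) : MeasurableSet (Om n r) := Metric.isOpen_ball.measurableSet.compl

lemma mem_Om {r : ℝ} {z : Cn n} : z ∈ Om n r ↔ r ≤ ‖z‖ := by simp [Om]

lemma weightL_pos {r : ℝ} (hr : 0 < r) (γ : ℝ) {z : Cn n} (hz : z ∈ Om n r) :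
    0 < weightL γ z := by
  have : 0 < ‖z‖ := hr.trans_le (mem_Om.1 hz)
  unfold weightL
  positivity

lemma restrict_W (r α : ℝ) : (W n α).restrict (Om n r) =
    ((V n).restrict (Om n r)).withDensity fun z => ENNReal.ofReal (‖z‖ ^ (-α)) :=
  restrict_withDensity (measurableSet_Om r) _

lemma normF_eq {p : ℝ≥0∞} (hp : 1 ≤ p) (β : ℝ) (f : Cn n → ℂ) :
    normF n p β f = eLpNorm (fun z => weightF (weightExp p β) z • f z) p (V n) :=
  ite_eLpNorm_eq_eLpNorm_weight_smul hp β (by fun_prop) (fun z => by positivity) f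

lemma normL_eq {p : ℝ≥0∞} (hp : 1 ≤ p) (r β : ℝ) (f : Cn n → ℂ) : normL n p r β f =
    eLpNorm (fun z => weightL (weightExp p β) z • f z) p ((V n).restrict (Om n r)) := by
  rw [normL, restrict_W]
  exact ite_eLpNorm_eq_eLpNorm_weight_smul hp β (by fun_prop) (fun z => by positivity) f

lemma integral_W_restrict (r α : ℝ) (g : Cn n → ℂ) :
    ∫ z in Om n r, g z ∂(W n α) = ∫ z in Om n r, ‖z‖ ^ (-α) • g z ∂(V n) := by
  rw [restrict_W, integral_withDensity_eq_integral_toReal_smul (by fun_prop)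
    (.of_forall fun _ => ENNReal.ofReal_lt_top)]
  simp only [ENNReal.toReal_ofReal (Real.rpow_nonneg (norm_nonneg _) _)]

lemma integral_W (α : ℝ) (g : Cn n → ℂ) :
    ∫ z, g z ∂(W n α) = ∫ z, ‖z‖ ^ (-α) • g z ∂(V n) := by
  simpa [Om] using integral_W_restrict 0 α g

lemma integrableOn_W_iff {r α : ℝ} {g : Cn n → ℂ} :
    IntegrableOn g (Om n r) (W n α) ↔
      IntegrableOn (fun z => ‖z‖ ^ (-α) • g z) (Om n r) (V n) := by
  rw [IntegrableOn, restrict_W, integrable_withDensity_iff_integrable_smul' (by fun_prop)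
    (.of_forall fun _ => ENNReal.ofReal_lt_top)]
  simp only [ENNReal.toReal_ofReal (Real.rpow_nonneg (norm_nonneg _) _), IntegrableOn]

lemma exists_rpow_le_one_add_rpow {r : ℝ} (hr : 0 < r) (M : ℝ) :
    ∃ C : ℝ, 0 < C ∧ ∀ t, r ≤ t → t ^ M ≤ C * (1 + t) ^ M := by
  obtain hM | hM := le_total 0 M
  · refine ⟨1, one_pos, fun t ht => ?_⟩
    rw [one_mul]
    exact Real.rpow_le_rpow (by linarith) (by linarith) hM
  · refine ⟨(r / (1 + r)) ^ M, by positivity, fun t ht => ?_⟩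
    rw [← Real.mul_rpow (by positivity) (by linarith)]
    refine Real.rpow_le_rpow_of_nonpos (by positivity [hr.trans_le ht]) ?_ hM
    rw [div_mul_eq_mul_div, div_le_iff₀ (by positivity)]
    nlinarith

lemma exists_one_add_rpow_le_rpow {r : ℝ} (hr : 0 < r) (M : ℝ) :
    ∃ C : ℝ, 0 < C ∧ ∀ t, r ≤ t → (1 + t) ^ M ≤ C * t ^ M := by
  obtain ⟨C, hC, h⟩ := exists_rpow_le_one_add_rpow hr (-M)
  refine ⟨C, hC, fun t ht => ?_⟩
  have ht0 : 0 < t := hr.trans_le ht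
  have := h t ht
  rwa [Real.rpow_neg ht0.le, Real.rpow_neg (by positivity), ← div_eq_mul_inv,
    inv_le_comm₀ (by positivity) (by positivity), inv_div, div_le_iff₀' hC] at this

lemma exists_weightL_le_weightF {r : ℝ} (hr : 0 < r) (γ : ℝ) :
    ∃ C : ℝ, 0 < C ∧ ∀ z ∈ Om n r, weightL γ z ≤ C * weightF γ z := by
  obtain ⟨C, hC, h⟩ := exists_rpow_le_one_add_rpow hr (-γ)
  refine ⟨C, hC, fun z hz => ?_⟩
  unfold weightL weightF
  rw [mul_left_comm]
  gcongr
  exact h ‖z‖ (mem_Om.1 hz)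

lemma exists_weightF_le_weightL {r : ℝ} (hr : 0 < r) (γ : ℝ) :
    ∃ C : ℝ, 0 < C ∧ ∀ z ∈ Om n r, weightF γ z ≤ C * weightL γ z := by
  obtain ⟨C, hC, h⟩ := exists_one_add_rpow_le_rpow hr (-γ)
  refine ⟨C, hC, fun z hz => ?_⟩
  unfold weightL weightF
  rw [mul_left_comm]
  gcongr
  exact h ‖z‖ (mem_Om.1 hz)

lemma exists_weightF_le_exp (γ : ℝ) {c : ℝ} (hc : c < 1 / 2) :
    ∃ C : ℝ, 0 < C ∧ ∀ z : Cn n, weightF γ z ≤ C * Real.exp (-c * ‖z‖ ^ 2) := by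
  obtain ⟨C, hC, h⟩ := exists_one_add_rpow_mul_exp_le_exp_sq (-γ) 0 (sub_pos.2 hc)
  refine ⟨C, hC, fun z => ?_⟩
  have hpow := h ‖z‖ (norm_nonneg z)
  rw [zero_mul, Real.exp_zero, mul_one] at hpow
  calc weightF γ z ≤ Real.exp (-‖z‖ ^ 2 / 2) * (C * Real.exp ((1 / 2 - c) * ‖z‖ ^ 2)) := by
        unfold weightF
        gcongr
    _ = C * Real.exp (-c * ‖z‖ ^ 2) := by
        rw [mul_left_comm, ← Real.exp_add]
        ring_nf

lemma exists_inv_weightL_le_exp {r : ℝ} (hr : 0 < r) (γ : ℝ) {c : ℝ} (hc : 1 / 2 < c) :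
    ∃ C : ℝ, 0 < C ∧ ∀ z ∈ Om n r, (weightL γ z)⁻¹ ≤ C * Real.exp (c * ‖z‖ ^ 2) := by
  obtain ⟨C₁, hC₁, h₁⟩ := exists_rpow_le_one_add_rpow hr γ
  obtain ⟨C₂, hC₂, h₂⟩ := exists_one_add_rpow_mul_exp_le_exp_sq γ 0 (sub_pos.2 hc)
  refine ⟨C₁ * C₂, by positivity, fun z hz => ?_⟩
  have hpow := h₂ ‖z‖ (norm_nonneg z)
  rw [zero_mul, Real.exp_zero, mul_one] at hpow
  calc (weightL γ z)⁻¹ = Real.exp (‖z‖ ^ 2 / 2) * ‖z‖ ^ γ := by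
        rw [weightL, mul_inv, ← Real.exp_neg, Real.rpow_neg (norm_nonneg z), inv_inv]
        ring_nf
    _ ≤ Real.exp (‖z‖ ^ 2 / 2) * (C₁ * (C₂ * Real.exp ((c - 1 / 2) * ‖z‖ ^ 2))) := by
        gcongr
        refine (h₁ ‖z‖ (mem_Om.1 hz)).trans ?_
        gcongr
    _ = C₁ * C₂ * (Real.exp (‖z‖ ^ 2 / 2) * Real.exp ((c - 1 / 2) * ‖z‖ ^ 2)) := by ring
    _ = C₁ * C₂ * Real.exp (c * ‖z‖ ^ 2) := by
        rw [← Real.exp_add]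
        ring_nf

lemma memLp_gaussian {c : ℝ} (hc : 0 < c) {p : ℝ≥0∞} (hp0 : p ≠ 0) :
    MemLp (fun z : Cn n => Real.exp (-c * ‖z‖ ^ 2)) p (V n) := by
  have hmeas : AEStronglyMeasurable (fun z : Cn n => Real.exp (-c * ‖z‖ ^ 2)) (V n) :=
    Continuous.aestronglyMeasurable (by fun_prop)
  obtain rfl | hp := eq_or_ne p ∞
  · refine memLp_top_of_bound hmeas 1 (.of_forall fun z => ?_)
    rw [Real.norm_of_nonneg (Real.exp_nonneg _), Real.exp_le_one_iff, neg_mul, neg_nonpos]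
    positivity
  · rw [← integrable_norm_rpow_iff hmeas hp0 hp]
    refine (integrable_gaussian (mul_pos hc (ENNReal.toReal_pos hp0 hp))).congr
      (.of_forall fun z => ?_)
    simp only [Real.norm_of_nonneg (Real.exp_nonneg _), ← Real.exp_mul]
    ring_nf

end Weights

section Spaces

variable {n : ℕ} {p : ℝ≥0∞} {β : ℝ}

lemma exists_normL_le_normF (hp : 1 ≤ p) {r : ℝ} (hr : 0 < r) (β : ℝ) :
    ∃ C : ℝ≥0, ∀ f : Cn n → ℂ, normL n p r β f ≤ C * normF n p β f := by
  obtain ⟨C, hC, hweight⟩ := exists_weightL_le_weightF (n := n) hr (weightExp p β)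
  refine ⟨C.toNNReal, fun f => ?_⟩
  rw [normL_eq hp, normF_eq hp]
  refine (eLpNorm_le_nnreal_smul_eLpNorm_of_ae_le_mul
    (g := fun z => weightF (weightExp p β) z • f z) (c := C.toNNReal) ?_ p).trans
    (mul_le_mul_right (eLpNorm_mono_measure _ Measure.restrict_le_self) _)
  filter_upwards [ae_restrict_mem (measurableSet_Om r)] with z hz
  rw [← NNReal.coe_le_coe, NNReal.coe_mul, Real.coe_toNNReal _ hC.le, coe_nnnorm, coe_nnnorm,
    norm_smul, norm_smul, Real.norm_of_nonneg (weightL_nonneg _ z),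
    Real.norm_of_nonneg (weightF_pos _ z).le, ← mul_assoc]
  gcongr
  exact hweight z hz

lemma spaceF_le_spaceL (hp : 1 ≤ p) {r : ℝ} (hr : 0 < r) (β : ℝ) :
    spaceF n p β ≤ spaceL n p r β := by
  rintro f ⟨hf, hf'⟩
  obtain ⟨C, hC⟩ := exists_normL_le_normF (n := n) hp hr β
  exact ⟨hf.continuous.aestronglyMeasurable,
    (hC f).trans_lt (ENNReal.mul_lt_top ENNReal.coe_lt_top hf')⟩

lemma integrableOn_mul_of_mem_spaceL (hp : 1 ≤ p) {r : ℝ} (hr : 0 < r) {ψ : Cn n → ℂ}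
    (hψ : ψ ∈ spaceL n p r β) {g : Cn n → ℂ} (hg : Measurable g) {A c : ℝ} (hc : 1 / 2 < c)
    (hgauss : ∀ w ∈ Om n r, ‖g w‖ ≤ A * Real.exp (-c * ‖w‖ ^ 2)) :
    IntegrableOn (fun w => ψ w * g w) (Om n r) (V n) := by
  obtain ⟨hψm, hψn⟩ := hψ
  rw [normL_eq hp] at hψn
  set γ := weightExp p β
  obtain ⟨d, hd, hdc⟩ := exists_between hc
  obtain ⟨C, hC, hinv⟩ := exists_inv_weightL_le_exp (n := n) hr γ hd
  have hψL : MemLp (fun w => weightL γ w • ψ w) p ((V n).restrict (Om n r)) :=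
    ⟨(measurable_weightL γ).aestronglyMeasurable.smul hψm, hψn⟩
  have hq0 : p.conjExponent ≠ 0 := (zero_lt_one.trans_le le_self_add).ne'
  have hgL : MemLp (fun w => (weightL γ w)⁻¹ • g w) p.conjExponent ((V n).restrict (Om n r)) := by
    refine (((memLp_gaussian (n := n) (sub_pos.2 hdc) hq0).restrict (Om n r)).const_mul
      (C * A)).of_le ((measurable_weightL γ).inv.smul hg).aestronglyMeasurable ?_
    filter_upwards [ae_restrict_mem (measurableSet_Om r)] with w hw
    have hwpos := weightL_pos hr γ hw
    calc ‖(weightL γ w)⁻¹ • g w‖ ≤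
          C * Real.exp (d * ‖w‖ ^ 2) * (A * Real.exp (-c * ‖w‖ ^ 2)) := by
          rw [norm_smul, norm_inv, Real.norm_of_nonneg hwpos.le]
          gcongr
          exacts [hinv w hw, hgauss w hw]
      _ = C * A * (Real.exp (d * ‖w‖ ^ 2) * Real.exp (-c * ‖w‖ ^ 2)) := by ring
      _ = C * A * Real.exp (-(c - d) * ‖w‖ ^ 2) := by
          rw [← Real.exp_add]
          ring_nf
      _ ≤ ‖C * A * Real.exp (-(c - d) * ‖w‖ ^ 2)‖ := Real.le_norm_self _
  have := ENNReal.HolderConjugate.conjExponent hp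
  refine (hψL.integrable_mul hgL).congr ?_
  filter_upwards [ae_restrict_mem (measurableSet_Om r)] with w hw
  rw [Pi.mul_apply, smul_mul_smul_comm, mul_inv_cancel₀ (weightL_pos hr γ hw).ne', one_smul]

lemma mem_spaceF_of_norm_le_exp_sq (hp : 1 ≤ p) {f : Cn n → ℂ} (hf : Differentiable ℂ f)
    {A c : ℝ} (hc : c < 1 / 2) (h : ∀ z, ‖f z‖ ≤ A * Real.exp (c * ‖z‖ ^ 2)) :
    f ∈ spaceF n p β := by
  refine ⟨hf, ?_⟩
  rw [normF_eq hp]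
  set γ := weightExp p β
  obtain ⟨d, hcd, hd⟩ := exists_between hc
  obtain ⟨C, hC, hweight⟩ := exists_weightF_le_exp (n := n) γ hd
  refine (((memLp_gaussian (n := n) (sub_pos.2 hcd) (zero_lt_one.trans_le hp).ne').const_mul
    (C * A)).of_le ((continuous_weightF γ).smul hf.continuous).aestronglyMeasurable
    (.of_forall fun z => ?_)).2
  calc ‖weightF γ z • f z‖ ≤ C * Real.exp (-d * ‖z‖ ^ 2) * (A * Real.exp (c * ‖z‖ ^ 2)) := by
        rw [norm_smul, Real.norm_of_nonneg (weightF_pos γ z).le]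
        gcongr
        exacts [hweight z, h z]
    _ = C * A * (Real.exp (-d * ‖z‖ ^ 2) * Real.exp (c * ‖z‖ ^ 2)) := by ring
    _ = C * A * Real.exp (-(d - c) * ‖z‖ ^ 2) := by
        rw [← Real.exp_add]
        ring_nf
    _ ≤ ‖C * A * Real.exp (-(d - c) * ‖z‖ ^ 2)‖ := Real.le_norm_self _

lemma homPart_mem_spaceF (hp : 1 ≤ p) (f : Cn n → ℂ) (k : ℕ) : homPart k f ∈ spaceF n p β := by
  obtain ⟨C, -, hC⟩ := exists_one_add_rpow_mul_exp_le_exp_sq k 0 (c := 1 / 4) (by norm_num)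
  refine mem_spaceF_of_norm_le_exp_sq hp (differentiable_homPart f k) (c := 1 / 4) (by norm_num)
    (A := (k.factorial : ℝ)⁻¹ * ‖iteratedFDeriv ℂ k f 0‖ * C) fun z =>
    (norm_homPart_le_opNorm k f z).trans ?_
  rw [mul_assoc _ C]
  gcongr
  calc ‖z‖ ^ k ≤ (1 + ‖z‖) ^ k := by gcongr; linarith
    _ = (1 + ‖z‖) ^ (k : ℝ) * Real.exp (0 * ‖z‖) := by
        rw [Real.rpow_natCast, zero_mul, Real.exp_zero, mul_one]
    _ ≤ C * Real.exp (1 / 4 * ‖z‖ ^ 2) := hC _ (norm_nonneg z)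

lemma lowPart_mem_spaceF (hp : 1 ≤ p) (s : ℝ) (f : Cn n → ℂ) : lowPart s f ∈ spaceF n p β := by
  have hsum : lowPart s f = ∑ k ∈ Finset.range (⌊|s|⌋₊ + 1), homPart k f := by
    ext z
    simp [lowPart]
  rw [hsum]
  exact Submodule.sum_mem _ fun k _ => homPart_mem_spaceF hp f k

lemma highPart_mem_spaceF (hp : 1 ≤ p) (s : ℝ) {f : Cn n → ℂ} (hf : f ∈ spaceF n p β) :
    highPart s f ∈ spaceF n p β :=
  Submodule.sub_mem _ hf (lowPart_mem_spaceF hp s f)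

namespace ExpSeriesGrowth

variable {σ : ℝ} {a : ℕ → ℝ}

lemma differentiable_expSeries_inner (h : ExpSeriesGrowth σ a) (z : Cn n) :
    Differentiable ℂ fun w : Cn n => expSeries a (inner ℂ z w) :=
  h.differentiable_expSeries.comp (innerSL ℂ z).differentiable

lemma expSeries_inner_mem_spaceF (h : ExpSeriesGrowth σ a) (hp : 1 ≤ p) (z : Cn n) :
    (fun w : Cn n => expSeries a (inner ℂ z w)) ∈ spaceF n p β := by
  obtain ⟨C, hC, hexp⟩ := h.exists_norm_expSeries_le_exp
  obtain ⟨D, -, habsorb⟩ :=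
    exists_one_add_rpow_mul_exp_le_exp_sq 0 (2 * ‖z‖) (c := 1 / 4) (by norm_num)
  refine mem_spaceF_of_norm_le_exp_sq hp (h.differentiable_expSeries_inner z) (c := 1 / 4)
    (by norm_num) (A := C * D) fun w => (hexp _).trans ?_
  rw [mul_assoc C]
  gcongr
  calc Real.exp (2 * ‖inner ℂ z w‖) ≤ (1 + ‖w‖) ^ (0 : ℝ) * Real.exp (2 * ‖z‖ * ‖w‖) := by
        rw [Real.rpow_zero, one_mul, mul_assoc]
        gcongr
        exact norm_inner_le_norm z w
    _ ≤ D * Real.exp (1 / 4 * ‖w‖ ^ 2) := habsorb _ (norm_nonneg w)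

lemma homPart_expSeries_inner (h : ExpSeriesGrowth σ a) (z w : Cn n) (k : ℕ) :
    homPart k (fun w : Cn n => expSeries a (inner ℂ z w)) w =
      (a k / k.factorial) • (inner ℂ z w) ^ k := by
  refine homPart_eq_of_hasSum (h.differentiable_expSeries_inner z)
    (b := fun k => (a k / k.factorial) • (inner ℂ z w) ^ k) (fun c => ?_) k
  refine (h.1 (inner ℂ z (c • w))).hasSum.congr_fun fun k => ?_
  rw [inner_smul_right, mul_pow, mul_smul_comm]

end ExpSeriesGrowth

end Spaces

section RadialDensity

variable {n : ℕ} {σ : ℝ} {a : ℕ → ℝ}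

/-- The density of `e^{-|z|²} dW_α(z)` with respect to `dV(z)`, as a function of `t = |z|`. -/
def radialDensity (α t : ℝ) : ℝ := t ^ (-α) * Real.exp (-t ^ 2)

lemma radialDensity_nonneg (α : ℝ) {t : ℝ} (ht : 0 ≤ t) : 0 ≤ radialDensity α t := by
  unfold radialDensity
  positivity

lemma measurable_radialDensity (α : ℝ) : Measurable (radialDensity α) := by
  unfold radialDensity
  fun_prop

lemma exists_radialDensity_mul_exp_le {r : ℝ} (hr : 0 < r) (α R : ℝ) {c : ℝ} (hc : c < 1) :
    ∃ C : ℝ, 0 < C ∧ ∀ t, r ≤ t →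
      radialDensity α t * Real.exp (R * t) ≤ C * Real.exp (-c * t ^ 2) := by
  obtain ⟨C₁, hC₁, h₁⟩ := exists_rpow_le_one_add_rpow hr (-α)
  obtain ⟨C₂, hC₂, h₂⟩ := exists_one_add_rpow_mul_exp_le_exp_sq (-α) R (sub_pos.2 hc)
  refine ⟨C₁ * C₂, by positivity, fun t ht => ?_⟩
  calc radialDensity α t * Real.exp (R * t)
      ≤ C₁ * (1 + t) ^ (-α) * Real.exp (-t ^ 2) * Real.exp (R * t) := by
        unfold radialDensity
        gcongr ?_ * Real.exp (-t ^ 2) * Real.exp (R * t)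
        exact h₁ t ht
    _ = C₁ * ((1 + t) ^ (-α) * Real.exp (R * t)) * Real.exp (-t ^ 2) := by ring
    _ ≤ C₁ * (C₂ * Real.exp ((1 - c) * t ^ 2)) * Real.exp (-t ^ 2) := by
        gcongr C₁ * ?_ * Real.exp (-t ^ 2)
        exact h₂ t (hr.le.trans ht)
    _ = C₁ * C₂ * (Real.exp ((1 - c) * t ^ 2) * Real.exp (-t ^ 2)) := by ring
    _ = C₁ * C₂ * Real.exp (-c * t ^ 2) := by
        rw [← Real.exp_add]
        ring_nf

lemma pairing_eq_integral (α : ℝ) (f g : Cn n → ℂ) :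
    pairing n α f g = ∫ w, radialDensity α ‖w‖ • (f w * conj (g w)) ∂(V n) := by
  rw [pairing, integral_W]
  simp only [radialDensity, mul_smul, mul_comm _ ((Real.exp _ : ℝ) : ℂ), ← Complex.real_smul]

lemma integrableOn_ball_norm_rpow (hn : 1 ≤ n) {c : ℝ} (hc : 0 < c + 2 * n) :
    IntegrableOn (fun w : Cn n => ‖w‖ ^ c) (Metric.ball 0 1) (V n) := by
  have : Nonempty (Fin n) := ⟨⟨0, hn⟩⟩
  rw [integrableOn_fun_norm_addHaar (V n) (f := fun t => t ^ c), finrank_real_Cn]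
  have hrpow : IntegrableOn (fun t : ℝ => t ^ (2 * (n : ℝ) - 1 + c)) (Set.Ioo 0 1) :=
    (intervalIntegral.integrableOn_Ioo_rpow_iff one_pos).2 (by linarith)
  refine hrpow.congr_fun (fun t ht => ?_) measurableSet_Ioo
  simp only [smul_eq_mul]
  rw [Real.rpow_add ht.1, ← Real.rpow_natCast t (2 * n - 1), Nat.cast_sub (by omega)]
  push_cast
  rfl

lemma integrableOn_radialDensity_mul_exp {p : ℝ≥0∞} (hp : 1 ≤ p) {r : ℝ} (hr : 0 < r) {β : ℝ}
    (α : ℝ) {ψ : Cn n → ℂ} (hψ : ψ ∈ spaceL n p r β) (R : ℝ) :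
    IntegrableOn (fun w => radialDensity α ‖w‖ * (‖ψ w‖ * Real.exp (R * ‖w‖))) (Om n r) (V n) := by
  obtain ⟨C, -, hdensity⟩ := exists_radialDensity_mul_exp_le hr α R (c := 3 / 4) (by norm_num)
  let g (w : Cn n) : ℂ := ((radialDensity α ‖w‖ * Real.exp (R * ‖w‖) : ℝ) : ℂ)
  have hgnorm (w : Cn n) : ‖g w‖ = radialDensity α ‖w‖ * Real.exp (R * ‖w‖) := by
    rw [Complex.norm_real, Real.norm_of_nonneg
      (mul_nonneg (radialDensity_nonneg α (norm_nonneg w)) (Real.exp_nonneg _))]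
  have hg : Measurable g := Complex.measurable_ofReal.comp
    (((measurable_radialDensity α).comp measurable_norm).mul (by fun_prop))
  refine (integrableOn_mul_of_mem_spaceL hp hr hψ hg (A := C) (c := 3 / 4) (by norm_num)
    fun w hw => ?_).norm.congr (.of_forall fun w => ?_)
  · rw [hgnorm]
    exact hdensity ‖w‖ (mem_Om.1 hw)
  · simp only [norm_mul, hgnorm]
    ring

lemma integrableOn_radialDensity_mul_expSeries {p : ℝ≥0∞} (hp : 1 ≤ p) {r : ℝ} (hr : 0 < r)
    {β : ℝ} (α : ℝ) {ψ : Cn n → ℂ} (hψ : ψ ∈ spaceL n p r β) (ha : ∀ k, 0 ≤ a k)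
    (h : ExpSeriesGrowth σ a) {R : ℝ} (hR : 0 ≤ R) :
    IntegrableOn (fun w => radialDensity α ‖w‖ * (‖ψ w‖ * expSeries a (‖w‖ * R))) (Om n r)
      (V n) := by
  obtain ⟨C, _, hexp⟩ := h.exists_norm_expSeries_le_exp
  refine ((integrableOn_radialDensity_mul_exp hp hr α hψ (2 * R)).const_mul C).mono' ?_
    (.of_forall fun w => ?_)
  · have hseries : Continuous fun w : Cn n => expSeries a (‖w‖ * R) :=
      h.continuous_expSeries_real.comp (by fun_prop)
    exact ((measurable_radialDensity α).comp measurable_norm).aestronglyMeasurable.mul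
      (hψ.1.norm.mul hseries.aestronglyMeasurable)
  have hρ := radialDensity_nonneg α (norm_nonneg w)
  have hseries0 := expSeries_nonneg ha (x := ‖w‖ * R) (by positivity)
  have hseries : expSeries a (‖w‖ * R) ≤ C * Real.exp (2 * R * ‖w‖) := by
    have := hexp ((‖w‖ * R : ℝ) : ℂ)
    rwa [← ofReal_expSeries, Complex.norm_real, Complex.norm_real, Real.norm_of_nonneg hseries0,
      Real.norm_of_nonneg (by positivity), mul_comm ‖w‖, ← mul_assoc, mul_comm R] at this
  rw [Real.norm_of_nonneg (by positivity)]
  calc radialDensity α ‖w‖ * (‖ψ w‖ * expSeries a (‖w‖ * R))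
      ≤ radialDensity α ‖w‖ * (‖ψ w‖ * (C * Real.exp (2 * R * ‖w‖))) := by gcongr
    _ = C * (radialDensity α ‖w‖ * (‖ψ w‖ * Real.exp (2 * R * ‖w‖))) := by ring

/- Near the origin the vanishing of both factors to order `m` compensates for `|w| ^ (-α)`. -/
lemma integrableOn_ball_radialDensity_mul_expSeries (hn : 1 ≤ n) {α : ℝ} {f : Cn n → ℂ}
    (hf : Differentiable ℂ f) (ha : ∀ k, 0 ≤ a k) (h : ExpSeriesGrowth σ a) {m : ℕ}
    (hfm : ∀ k < m, ∀ z, homPart k f z = 0) (ham : ∀ k < m, a k = 0) (hm : α / 2 < m + n) {R : ℝ}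
    (hR : 0 ≤ R) :
    IntegrableOn (fun w => radialDensity α ‖w‖ * (‖f w‖ * expSeries a (‖w‖ * R)))
      (Metric.ball 0 1) (V n) := by
  obtain ⟨C, hC, hfC⟩ := exists_norm_le_pow hf hfm
  have : Nonempty (Fin n) := ⟨⟨0, hn⟩⟩
  refine ((integrableOn_ball_norm_rpow hn (c := 2 * m - α) (by linarith)).const_mul
    (C * expSeries a R)).mono' ?_ ?_
  · have hseries : Measurable fun w : Cn n => expSeries a (‖w‖ * R) :=
      h.continuous_expSeries_real.measurable.comp (by fun_prop)
    exact (((measurable_radialDensity α).comp measurable_norm).mul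
      (hf.continuous.norm.measurable.mul hseries)).aestronglyMeasurable
  filter_upwards [ae_restrict_mem measurableSet_ball, ae_restrict_of_ae (Measure.ae_ne _ 0)]
    with w hw hw0
  have hw1 : ‖w‖ ≤ 1 := (mem_ball_zero_iff.1 hw).le
  have hwpos : 0 < ‖w‖ := norm_pos_iff.2 hw0
  have hexp : Real.exp (-‖w‖ ^ 2) ≤ 1 := Real.exp_le_one_iff.2 (by simp)
  have ha0 := expSeries_nonneg ha (x := ‖w‖ * R) (by positivity)
  have := expSeries_nonneg ha hR
  rw [Real.norm_of_nonneg (mul_nonneg (radialDensity_nonneg α hwpos.le) (by positivity))]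
  calc radialDensity α ‖w‖ * (‖f w‖ * expSeries a (‖w‖ * R))
      ≤ ‖w‖ ^ (-α) * 1 * (C * ‖w‖ ^ m * (‖w‖ ^ m * expSeries a R)) := by
        unfold radialDensity
        gcongr
        exacts [hfC w hw1, expSeries_mul_le ha h.summable_real ham hwpos.le hw1 hR]
    _ = C * expSeries a R * (‖w‖ ^ m * ‖w‖ ^ m * ‖w‖ ^ (-α)) := by ring
    _ = C * expSeries a R * ‖w‖ ^ (2 * m - α) := by
        rw [← Real.rpow_natCast, ← Real.rpow_add hwpos, ← Real.rpow_add hwpos]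
        ring_nf

lemma hasSum_pairing_expSeries (hn : 1 ≤ n) {α : ℝ} {f : Cn n → ℂ} (hf : f ∈ spaceF n 2 α)
    (ha : ∀ k, 0 ≤ a k) (h : ExpSeriesGrowth σ a) {m : ℕ}
    (hfm : ∀ k < m, ∀ z, homPart k f z = 0) (ham : ∀ k < m, a k = 0) (hm : α / 2 < m + n)
    (z : Cn n) :
    HasSum (fun k => ((a k * (Real.Gamma (k + n - α / 2) / Real.Gamma (k + n)) : ℝ) : ℂ) *
      homPart k f z) (pairing n α f fun w => expSeries a (inner ℂ z w)) := by
  have hint : Integrable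
      (fun w => ‖radialDensity α ‖w‖‖ * (‖f w‖ * expSeries a (‖w‖ * ‖z‖))) (V n) := by
    simp only [Real.norm_of_nonneg (radialDensity_nonneg α (norm_nonneg _))]
    rw [← integrableOn_univ, ← Set.union_compl_self (Metric.ball 0 1)]
    exact (integrableOn_ball_radialDensity_mul_expSeries hn hf.1 ha h hfm ham hm
      (norm_nonneg z)).union (integrableOn_radialDensity_mul_expSeries one_le_two one_pos α
      (spaceF_le_spaceL one_le_two one_pos α hf) ha h (norm_nonneg z))
  have hsum := hasSum_integral_radial_smul_mul_expSeries_inner hn hf.1 (measurable_radialDensity α)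
    ha h.summable_real hint
  simp only [pairing_eq_integral, conj_expSeries, inner_conj_symm]
  refine hsum.congr_fun fun k => ?_
  obtain hk | hk := lt_or_ge k m
  · simp [ham k hk]
  · have hmk : (m : ℝ) ≤ k := by exact_mod_cast hk
    unfold radialDensity
    rw [radialMoment_rpow_mul_exp hn (by linarith), radialMoment_gaussian hn,
      div_div_div_cancel_right₀ two_ne_zero]

lemma pairing_expSeries_eq_apply (hn : 1 ≤ n) {α : ℝ} {f : Cn n → ℂ} (hf : f ∈ spaceF n 2 α)
    (ha : ∀ k, 0 ≤ a k) (h : ExpSeriesGrowth σ a) {m : ℕ}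
    (hfm : ∀ k < m, ∀ z, homPart k f z = 0) (ham : ∀ k < m, a k = 0) (hm : α / 2 < m + n)
    {z : Cn n} (hinv : ∀ k : ℕ, homPart k f z ≠ 0 →
      a k * (Real.Gamma (k + n - α / 2) / Real.Gamma (k + n)) = 1) :
    (pairing n α f fun w => expSeries a (inner ℂ z w)) = f z := by
  refine (hasSum_pairing_expSeries hn hf ha h hfm ham hm z).unique
    ((hasSum_homPart hf.1 z).congr_fun fun k => ?_)
  by_cases hk : homPart k f z = 0
  · simp [hk]
  · rw [hinv k hk, Complex.ofReal_one, one_mul]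

end RadialDensity

section Kernel

variable {n : ℕ} {α : ℝ}

/-- The coefficients of degree at most `|s|`, so that the series with these coefficients is the
`lowPart s` of the original one. -/
def lowCoeff (s : ℝ) (a : ℕ → ℝ) (k : ℕ) : ℝ := if k ≤ ⌊|s|⌋₊ then a k else 0

/-- The coefficients of degree bigger than `|s|`, see `lowCoeff`. -/
def highCoeff (s : ℝ) (a : ℕ → ℝ) (k : ℕ) : ℝ := if k ≤ ⌊|s|⌋₊ then 0 else a k

namespace ExpSeriesGrowth

variable {σ : ℝ} {a : ℕ → ℝ}

lemma lowCoeff (σ s : ℝ) (a : ℕ → ℝ) : ExpSeriesGrowth σ (lowCoeff s a) :=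
  of_eventually_zero (N := ⌊|s|⌋₊ + 1) fun _ hk => if_neg (by omega)

lemma highCoeff (h : ExpSeriesGrowth σ a) (s : ℝ) : ExpSeriesGrowth σ (highCoeff s a) :=
  h.congr_eventually (N := ⌊|s|⌋₊ + 1) fun _ hk => if_neg (by omega)

lemma lowPart_expSeries_inner (h : ExpSeriesGrowth σ a) (s : ℝ) (z : Cn n) :
    lowPart s (fun w : Cn n => expSeries a (inner ℂ z w)) =
      fun w => expSeries (Fock.lowCoeff s a) (inner ℂ z w) := by
  have hlow := lowCoeff σ s a
  refine eq_of_homPart_eq (differentiable_lowPart _ s) (hlow.differentiable_expSeries_inner z)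
    fun k w => ?_
  rw [homPart_lowPart, h.homPart_expSeries_inner, hlow.homPart_expSeries_inner, Fock.lowCoeff]
  split_ifs <;> simp

lemma highPart_expSeries_inner (h : ExpSeriesGrowth σ a) (s : ℝ) (z : Cn n) :
    highPart s (fun w : Cn n => expSeries a (inner ℂ z w)) =
      fun w => expSeries (Fock.highCoeff s a) (inner ℂ z w) := by
  have hz := h.differentiable_expSeries_inner z
  have hhigh := h.highCoeff s
  refine eq_of_homPart_eq (differentiable_highPart hz s) (hhigh.differentiable_expSeries_inner z)
    fun k w => ?_
  rw [homPart_highPart hz, h.homPart_expSeries_inner, hhigh.homPart_expSeries_inner,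
    Fock.highCoeff]
  split_ifs <;> simp

end ExpSeriesGrowth

/-- The coefficients of the reproducing kernel. -/
def kernelCoeff (n : ℕ) (α : ℝ) (k : ℕ) : ℝ :=
  if α < 2 * n ∨ ⌊|α / 2|⌋₊ < k then Real.Gamma (k + n) / Real.Gamma (k + n - α / 2) else 1

/-- The reproducing kernel of `F^2_α`. -/
def kernel (n : ℕ) (α : ℝ) (z w : Cn n) : ℂ := expSeries (kernelCoeff n α) (inner ℂ z w)

lemma Gamma_add_pos (hn : 1 ≤ n) (k : ℕ) : 0 < Real.Gamma (k + n) :=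
  Real.Gamma_pos_of_pos (by positivity)

lemma add_sub_half_pos (hn : 1 ≤ n) {k : ℕ} (h : α < 2 * n ∨ ⌊|α / 2|⌋₊ < k) :
    0 < k + n - α / 2 := by
  have hn' : (1 : ℝ) ≤ n := by exact_mod_cast hn
  obtain h | h := h
  · linarith [(k.cast_nonneg : (0 : ℝ) ≤ k)]
  · linarith [(Nat.floor_lt (abs_nonneg (α / 2))).1 h, le_abs_self (α / 2)]

lemma Gamma_add_sub_pos (hn : 1 ≤ n) {k : ℕ} (h : α < 2 * n ∨ ⌊|α / 2|⌋₊ < k) :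
    0 < Real.Gamma (k + n - α / 2) :=
  Real.Gamma_pos_of_pos (add_sub_half_pos hn h)

lemma kernelCoeff_pos (hn : 1 ≤ n) (α : ℝ) (k : ℕ) : 0 < kernelCoeff n α k := by
  unfold kernelCoeff
  split_ifs with h
  · exact div_pos (Gamma_add_pos hn k) (Gamma_add_sub_pos hn h)
  · exact one_pos

lemma kernelCoeff_mul_Gamma_ratio (hn : 1 ≤ n) {k : ℕ} (h : α < 2 * n ∨ ⌊|α / 2|⌋₊ < k) :
    kernelCoeff n α k * (Real.Gamma (k + n - α / 2) / Real.Gamma (k + n)) = 1 := by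
  rw [kernelCoeff, if_pos h, div_mul_div_cancel₀ (Gamma_add_sub_pos hn h).ne',
    div_self (Gamma_add_pos hn k).ne']

lemma expSeriesGrowth_kernelCoeff (hn : 1 ≤ n) (α : ℝ) :
    ExpSeriesGrowth (α / 2) (kernelCoeff n α) :=
  (expSeriesGrowth_Gamma_ratio (by exact_mod_cast hn) (α / 2)).congr_eventually
    (N := ⌊|α / 2|⌋₊ + 1) fun _ hk => if_pos (.inr hk)

lemma pairing_kernel (hn : 1 ≤ n) (hα : α < 2 * n) {f : Cn n → ℂ} (hf : f ∈ spaceF n 2 α)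
    (z : Cn n) : pairing n α f (kernel n α z) = f z :=
  pairing_expSeries_eq_apply hn hf (fun k => (kernelCoeff_pos hn α k).le)
    (expSeriesGrowth_kernelCoeff hn α) (m := 0) (by simp) (by simp)
    (by rw [Nat.cast_zero]; linarith)
    fun _ _ => kernelCoeff_mul_Gamma_ratio hn (.inl hα)

lemma pairing_lowPart_kernel (hn : 1 ≤ n) (hα : 2 * n ≤ α) (f : Cn n → ℂ) (z : Cn n) :
    pairing n 0 (lowPart (α / 2) f) (lowPart (α / 2) (kernel n α z)) = lowPart (α / 2) f z := by
  unfold kernel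
  rw [(expSeriesGrowth_kernelCoeff hn α).lowPart_expSeries_inner]
  refine pairing_expSeries_eq_apply hn (lowPart_mem_spaceF one_le_two _ f)
    (fun k => ?_) (ExpSeriesGrowth.lowCoeff 0 _ _) (m := 0) (by simp) (by simp)
    (by simpa using Nat.zero_lt_of_lt hn) fun k hk => ?_
  · unfold lowCoeff
    split_ifs
    exacts [(kernelCoeff_pos hn α k).le, le_rfl]
  · rw [homPart_lowPart, ite_ne_right_iff] at hk
    rw [lowCoeff, if_pos hk.1, kernelCoeff, if_neg (by simpa using ⟨hα, hk.1⟩), zero_div, sub_zero,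
      div_self (Gamma_add_pos hn k).ne', one_mul]

lemma pairing_highPart_kernel (hn : 1 ≤ n) {f : Cn n → ℂ} (hf : f ∈ spaceF n 2 α) (z : Cn n) :
    pairing n α (highPart (α / 2) f) (highPart (α / 2) (kernel n α z)) =
      highPart (α / 2) f z := by
  have hgrowth := expSeriesGrowth_kernelCoeff hn α
  unfold kernel
  rw [hgrowth.highPart_expSeries_inner]
  refine pairing_expSeries_eq_apply hn (highPart_mem_spaceF one_le_two _ hf)
    (fun k => ?_) (hgrowth.highCoeff _) (m := ⌊|α / 2|⌋₊ + 1)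
    (fun k hk z => by rw [homPart_highPart hf.1, if_pos (by omega)])
    (fun k hk => if_pos (by omega)) ?_ fun k hk => ?_
  · unfold highCoeff
    split_ifs
    exacts [le_rfl, (kernelCoeff_pos hn α k).le]
  · push_cast
    linarith [Nat.lt_floor_add_one |α / 2|, le_abs_self (α / 2), (n.cast_nonneg : (0 : ℝ) ≤ n)]
  · rw [homPart_highPart hf.1, ite_ne_left_iff] at hk
    rw [highCoeff, if_neg hk.1, kernelCoeff_mul_Gamma_ratio hn (.inr (not_le.1 hk.1))]

lemma isReproducingKernel_kernel (hn : 1 ≤ n) (α : ℝ) :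
    IsReproducingKernel n α (kernel n α) where
  mem := (expSeriesGrowth_kernelCoeff hn α).expSeries_inner_mem_spaceF one_le_two
  reproducing f hf z := by
    unfold innerF
    split_ifs with hα
    · exact (pairing_kernel hn hα hf z).symm
    · rw [pairing_lowPart_kernel hn (not_lt.1 hα), pairing_highPart_kernel hn hf, highPart,
        add_sub_cancel]

lemma conj_pairing (α : ℝ) (f g : Cn n → ℂ) : conj (pairing n α f g) = pairing n α g f := by
  unfold pairing
  rw [← integral_conj]
  simp only [map_mul, Complex.conj_conj, Complex.conj_ofReal, mul_comm (conj (f _))]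

lemma conj_innerF (α : ℝ) (f g : Cn n → ℂ) : conj (innerF n α f g) = innerF n α g f := by
  unfold innerF
  split_ifs <;> simp [conj_pairing]

lemma IsReproducingKernel.unique {K K' : Cn n → Cn n → ℂ}
    (h : IsReproducingKernel n α K) (h' : IsReproducingKernel n α K') : K = K' := by
  ext z w
  rw [h'.reproducing (K z) (h.mem z) w, ← conj_innerF, ← h.reproducing (K' w) (h'.mem w) z,
    h'.reproducing (K' w) (h'.mem w) z, conj_innerF, ← h'.reproducing (K' z) (h'.mem z) w]

end Kernel

section Minkowski

variable {X Y : Type*} [MeasurableSpace X] [MeasurableSpace Y] {μ : Measure X} {ν : Measure Y}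

lemma lintegral_rpow_le {q : ℝ} (hq : 1 ≤ q) {f : Y → ℝ≥0∞} (hf : AEMeasurable f ν) :
    (∫⁻ y, f y ∂ν) ^ q ≤ ν Set.univ ^ (q - 1) * ∫⁻ y, f y ^ q ∂ν := by
  have hq0 : 0 < q := one_pos.trans_le hq
  have hholder : ∫⁻ y, f y ∂ν ≤ (∫⁻ y, f y ^ q ∂ν) ^ q⁻¹ * ν Set.univ ^ (1 - q⁻¹) := by
    simpa [eLpNorm'] using eLpNorm'_le_eLpNorm'_mul_rpow_measure_univ one_pos hq
      hf.aestronglyMeasurable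
  calc (∫⁻ y, f y ∂ν) ^ q
      ≤ ((∫⁻ y, f y ^ q ∂ν) ^ q⁻¹ * ν Set.univ ^ (1 - q⁻¹)) ^ q := by gcongr
    _ = ν Set.univ ^ (q - 1) * ∫⁻ y, f y ^ q ∂ν := by
        rw [ENNReal.mul_rpow_of_nonneg _ _ hq0.le, ← ENNReal.rpow_mul, ← ENNReal.rpow_mul,
          inv_mul_cancel₀ hq0.ne', ENNReal.rpow_one, sub_mul, inv_mul_cancel₀ hq0.ne', one_mul,
          mul_comm]

lemma lintegral_rpow_lintegral_le [SFinite μ] [IsFiniteMeasure ν] {q : ℝ} (hq : 1 ≤ q)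
    {F : X → Y → ℝ≥0∞} (hF : Measurable (Function.uncurry F)) {A : ℝ≥0∞}
    (hA : ∀ y, ∫⁻ x, F x y ^ q ∂μ ≤ A) :
    ∫⁻ x, (∫⁻ y, F x y ∂ν) ^ q ∂μ ≤ ν Set.univ ^ q * A := by
  calc ∫⁻ x, (∫⁻ y, F x y ∂ν) ^ q ∂μ
      ≤ ∫⁻ x, ν Set.univ ^ (q - 1) * ∫⁻ y, F x y ^ q ∂ν ∂μ :=
        lintegral_mono fun x => lintegral_rpow_le hq (hF.comp measurable_prodMk_left).aemeasurable
    _ = ν Set.univ ^ (q - 1) * ∫⁻ x, ∫⁻ y, F x y ^ q ∂ν ∂μ :=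
        lintegral_const_mul' _ _ (ENNReal.rpow_ne_top_of_nonneg (by linarith) (measure_ne_top ν _))
    _ = ν Set.univ ^ (q - 1) * ∫⁻ y, ∫⁻ x, F x y ^ q ∂μ ∂ν := by
        rw [lintegral_lintegral_swap (hF.pow_const q).aemeasurable]
    _ ≤ ν Set.univ ^ (q - 1) * ∫⁻ _, A ∂ν := by
        gcongr with y
        exact hA y
    _ = ν Set.univ ^ (q - 1) * ν Set.univ ^ (1 : ℝ) * A := by
        rw [lintegral_const, ENNReal.rpow_one]
        ring
    _ = ν Set.univ ^ q * A := by
        rw [← ENNReal.rpow_add_of_nonneg _ _ (by linarith) zero_le_one, sub_add_cancel]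

lemma eLpNormEssSup_lintegral_le [SFinite μ] [SFinite ν] {F : X → Y → ℝ≥0∞}
    (hF : Measurable (Function.uncurry F)) {A : ℝ≥0∞}
    (hA : ∀ y, eLpNormEssSup (fun x => F x y) μ ≤ A) :
    eLpNormEssSup (fun x => ∫⁻ y, F x y ∂ν) μ ≤ ν Set.univ * A := by
  have hle : ∀ᵐ x ∂μ, ∀ᵐ y ∂ν, F x y ≤ A := by
    refine (Measure.ae_ae_comm (p := fun x y => F x y ≤ A)
      (measurableSet_le hF measurable_const)).2 (.of_forall fun y => ?_)
    filter_upwards [enorm_ae_le_eLpNormEssSup (fun x => F x y) μ] with x hx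
    exact hx.trans (hA y)
  refine eLpNormEssSup_le_of_ae_enorm_bound ?_
  filter_upwards [hle] with x hx
  calc ∫⁻ y, F x y ∂ν ≤ ∫⁻ _, A ∂ν := lintegral_mono_ae hx
    _ = ν Set.univ * A := by rw [lintegral_const, mul_comm]

/-- A form of Minkowski's integral inequality. -/
lemma eLpNorm_lintegral_le [SFinite μ] [IsFiniteMeasure ν] {p : ℝ≥0∞} (hp : 1 ≤ p)
    {F : X → Y → ℝ≥0∞} (hF : Measurable (Function.uncurry F)) {A : ℝ≥0∞}
    (hA : ∀ y, eLpNorm (fun x => F x y) p μ ≤ A) :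
    eLpNorm (fun x => ∫⁻ y, F x y ∂ν) p μ ≤ ν Set.univ * A := by
  obtain rfl | htop := eq_or_ne p ∞
  · exact eLpNormEssSup_lintegral_le hF hA
  have hp0 : p ≠ 0 := (zero_lt_one.trans_le hp).ne'
  have hq : 0 < p.toReal := ENNReal.toReal_pos hp0 htop
  have hq1 : 1 ≤ p.toReal := by simpa using ENNReal.toReal_mono htop hp
  simp only [eLpNorm_eq_lintegral_rpow_enorm_toReal hp0 htop, enorm_eq_self, one_div,
    ENNReal.rpow_inv_le_iff hq] at hA ⊢
  rw [ENNReal.mul_rpow_of_nonneg _ _ hq.le]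
  exact lintegral_rpow_lintegral_le hq1 hF hA

end Minkowski

section KernelEstimate

lemma rpow_le_rpow_abs_mul_rpow {x y K : ℝ} (hx : 0 < x) (hy : 0 < y) (hK : 0 < K)
    (hxy : x ≤ K * y) (hyx : y ≤ K * x) (s : ℝ) : x ^ s ≤ K ^ |s| * y ^ s := by
  obtain hs | hs := le_total 0 s
  · rw [abs_of_nonneg hs, ← Real.mul_rpow hK.le hy.le]
    exact Real.rpow_le_rpow hx.le hxy hs
  · rw [abs_of_nonpos hs, Real.rpow_neg hK.le, ← Real.inv_rpow hK.le,
      ← Real.mul_rpow (by positivity) hy.le]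
    exact Real.rpow_le_rpow_of_nonpos (by positivity) ((inv_mul_le_iff₀ hK).2 hyx) hs

/-- Peetre's inequality. -/
lemma one_add_norm_rpow_le {E : Type*} [SeminormedAddCommGroup E] (z w : E) (s : ℝ) :
    (1 + ‖z‖) ^ s ≤ (1 + ‖z - w‖) ^ |s| * (1 + ‖w‖) ^ s := by
  have hz := norm_le_norm_add_norm_sub' z w
  have hw := norm_le_norm_add_norm_sub z w
  refine rpow_le_rpow_abs_mul_rpow (by positivity) (by positivity) (by positivity) ?_ ?_ s
  · nlinarith [norm_nonneg (z - w), norm_nonneg w]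
  · nlinarith [norm_nonneg (z - w), norm_nonneg z]

variable {E : Type*} [NormedAddCommGroup E] [InnerProductSpace ℂ E]

lemma one_add_norm_inner_rpow_le (z w : E) (s : ℝ) :
    (1 + ‖inner ℂ z w‖) ^ s ≤ (4 * (1 + ‖z - w‖) ^ 2) ^ |s| * ((1 + ‖w‖) ^ 2) ^ s := by
  have hz := norm_le_norm_add_norm_sub' z w
  have hinner := norm_inner_le_norm (𝕜 := ℂ) z w
  have hre := Complex.re_le_norm (inner ℂ z w)
  have hsub : ‖z - w‖ ^ 2 = ‖z‖ ^ 2 - 2 * (inner ℂ z w).re + ‖w‖ ^ 2 := norm_sub_sq (𝕜 := ℂ) z w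
  have hx := norm_nonneg (inner ℂ z w)
  have hd := norm_nonneg (z - w)
  have hw := norm_nonneg w
  generalize ‖inner ℂ z w‖ = t at *
  generalize ‖z - w‖ = d at *
  refine rpow_le_rpow_abs_mul_rpow (by positivity) (by positivity) (by positivity) ?_ ?_ s
  · have ht : t ≤ (‖w‖ + d) * ‖w‖ := hinner.trans (by gcongr)
    nlinarith [mul_nonneg hd hw, mul_nonneg hd (sq_nonneg ‖w‖), sq_nonneg d, sq_nonneg ‖w‖,
      mul_nonneg (sq_nonneg d) hw, mul_nonneg (sq_nonneg d) (sq_nonneg ‖w‖)]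
  · have : ‖w‖ ^ 2 ≤ 2 * t + d ^ 2 := by nlinarith [sq_nonneg ‖z‖]
    nlinarith [mul_nonneg hd hx, mul_nonneg (sq_nonneg d) hx, sq_nonneg (‖w‖ - 1), sq_nonneg d]

lemma exp_re_inner_add_exp_mul_le (z w : E) :
    (Real.exp (inner ℂ z w).re + Real.exp (‖inner ℂ z w‖ / 2)) *
      (Real.exp (-‖z‖ ^ 2 / 2) * Real.exp (-‖w‖ ^ 2 / 2)) ≤ 2 * Real.exp (-‖z - w‖ ^ 2 / 8) := by
  have hinner := norm_inner_le_norm (𝕜 := ℂ) z w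
  have hre : -(‖z‖ * ‖w‖) ≤ (inner ℂ z w).re :=
    (neg_le_neg hinner).trans (neg_le_of_abs_le (Complex.abs_re_le_norm _))
  have hsub : ‖z - w‖ ^ 2 = ‖z‖ ^ 2 - 2 * (inner ℂ z w).re + ‖w‖ ^ 2 := norm_sub_sq (𝕜 := ℂ) z w
  rw [← Real.exp_add, add_mul, ← Real.exp_add, ← Real.exp_add, two_mul]
  refine add_le_add (Real.exp_le_exp.2 ?_) (Real.exp_le_exp.2 ?_)
  · nlinarith [sq_nonneg ‖z - w‖]
  · nlinarith [sq_nonneg (‖z‖ - ‖w‖)]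

lemma exists_kernelBound_inner_mul_le (σ γ : ℝ) :
    ∃ C : ℝ, 0 < C ∧ ∀ z w : E,
      kernelBound σ (inner ℂ z w) * Real.exp (-‖w‖ ^ 2 / 2) *
          (Real.exp (-‖z‖ ^ 2 / 2) * (1 + ‖z‖) ^ γ) ≤
        C * Real.exp (-(1 / 16) * ‖z - w‖ ^ 2) * (1 + ‖w‖) ^ (2 * σ + γ) := by
  obtain ⟨C, hC, hpoly⟩ :=
    exists_one_add_rpow_mul_exp_le_exp_sq (2 * |σ| + |γ|) 0 (c := 1 / 16) (by norm_num)
  refine ⟨4 ^ |σ| * 2 * C, by positivity, fun z w => ?_⟩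
  have hw (s : ℝ) : ((1 + ‖w‖) ^ 2) ^ s = (1 + ‖w‖) ^ (2 * s) := by
    rw [Real.rpow_mul (by positivity), Real.rpow_two]
  have hd : (4 * (1 + ‖z - w‖) ^ 2) ^ |σ| = 4 ^ |σ| * (1 + ‖z - w‖) ^ (2 * |σ|) := by
    rw [Real.mul_rpow (by norm_num) (by positivity), Real.rpow_mul (by positivity), Real.rpow_two]
  have hpoly := hpoly ‖z - w‖ (norm_nonneg _)
  rw [zero_mul, Real.exp_zero, mul_one] at hpoly
  calc kernelBound σ (inner ℂ z w) * Real.exp (-‖w‖ ^ 2 / 2) *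
        (Real.exp (-‖z‖ ^ 2 / 2) * (1 + ‖z‖) ^ γ)
      = (1 + ‖inner ℂ z w‖) ^ σ *
          ((Real.exp (inner ℂ z w).re + Real.exp (‖inner ℂ z w‖ / 2)) *
            (Real.exp (-‖z‖ ^ 2 / 2) * Real.exp (-‖w‖ ^ 2 / 2))) * (1 + ‖z‖) ^ γ := by
        unfold kernelBound
        ring
    _ ≤ 4 ^ |σ| * (1 + ‖z - w‖) ^ (2 * |σ|) * (1 + ‖w‖) ^ (2 * σ) *
          (2 * Real.exp (-‖z - w‖ ^ 2 / 8)) * ((1 + ‖z - w‖) ^ |γ| * (1 + ‖w‖) ^ γ) := by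
        rw [← hd, ← hw]
        gcongr ?_ * ?_ * ?_
        exacts [one_add_norm_inner_rpow_le z w σ, exp_re_inner_add_exp_mul_le z w,
          one_add_norm_rpow_le z w γ]
    _ = 4 ^ |σ| * 2 * (1 + ‖z - w‖) ^ (2 * |σ| + |γ|) * Real.exp (-‖z - w‖ ^ 2 / 8) *
          (1 + ‖w‖) ^ (2 * σ + γ) := by
        rw [Real.rpow_add (by positivity), Real.rpow_add (by positivity)]
        ring
    _ ≤ 4 ^ |σ| * 2 * (C * Real.exp (1 / 16 * ‖z - w‖ ^ 2)) * Real.exp (-‖z - w‖ ^ 2 / 8) *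
          (1 + ‖w‖) ^ (2 * σ + γ) := by gcongr
    _ = 4 ^ |σ| * 2 * C * (Real.exp (1 / 16 * ‖z - w‖ ^ 2) * Real.exp (-‖z - w‖ ^ 2 / 8)) *
          (1 + ‖w‖) ^ (2 * σ + γ) := by ring
    _ = 4 ^ |σ| * 2 * C * Real.exp (-(1 / 16) * ‖z - w‖ ^ 2) * (1 + ‖w‖) ^ (2 * σ + γ) := by
        rw [← Real.exp_add]
        ring_nf

lemma exists_norm_kernel_mul_weightF_le {n : ℕ} (hn : 1 ≤ n) (α γ : ℝ) {r : ℝ} (hr : 0 < r) :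
    ∃ C : ℝ, 0 ≤ C ∧ ∀ z : Cn n, ∀ w ∈ Om n r,
      ‖kernel n α z w‖ * radialDensity α ‖w‖ * weightF γ z ≤
        C * Real.exp (-(1 / 16) * ‖z - w‖ ^ 2) * weightL γ w := by
  obtain ⟨-, C₁, hC₁, hkernel⟩ := expSeriesGrowth_kernelCoeff hn α
  obtain ⟨C₂, hC₂, hpow⟩ := exists_rpow_le_one_add_rpow hr (-α)
  obtain ⟨C₃, hC₃, hbound⟩ := exists_kernelBound_inner_mul_le (E := Cn n) (α / 2) (-γ)
  obtain ⟨C₄, hC₄, hweight⟩ := exists_weightF_le_weightL (n := n) hr γ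
  refine ⟨C₁ * C₂ * C₃ * C₄, by positivity, fun z w hw => ?_⟩
  have hF := (weightF_pos γ z).le
  have hK := kernelBound_nonneg (α / 2) (inner ℂ z w)
  have hexp : Real.exp (-‖w‖ ^ 2) = Real.exp (-‖w‖ ^ 2 / 2) * Real.exp (-‖w‖ ^ 2 / 2) := by
    rw [← Real.exp_add, add_halves]
  calc ‖kernel n α z w‖ * radialDensity α ‖w‖ * weightF γ z
      ≤ C₁ * kernelBound (α / 2) (inner ℂ z w) *
          (C₂ * (1 + ‖w‖) ^ (-α) * Real.exp (-‖w‖ ^ 2)) * weightF γ z := by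
        unfold radialDensity
        gcongr
        exacts [hkernel _, hpow _ (mem_Om.1 hw)]
    _ = C₁ * C₂ * (kernelBound (α / 2) (inner ℂ z w) * Real.exp (-‖w‖ ^ 2 / 2) *
          (Real.exp (-‖z‖ ^ 2 / 2) * (1 + ‖z‖) ^ (-γ))) *
          (Real.exp (-‖w‖ ^ 2 / 2) * (1 + ‖w‖) ^ (-α)) := by
        rw [hexp, weightF]
        ring
    _ ≤ C₁ * C₂ * (C₃ * Real.exp (-(1 / 16) * ‖z - w‖ ^ 2) *
          (1 + ‖w‖) ^ (2 * (α / 2) + -γ)) *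
          (Real.exp (-‖w‖ ^ 2 / 2) * (1 + ‖w‖) ^ (-α)) := by
        gcongr C₁ * C₂ * ?_ * _
        exact hbound z w
    _ = C₁ * C₂ * C₃ * Real.exp (-(1 / 16) * ‖z - w‖ ^ 2) * weightF γ w := by
        have hcancel : (1 + ‖w‖) ^ (2 * (α / 2) + -γ) * (1 + ‖w‖) ^ (-α) = (1 + ‖w‖) ^ (-γ) := by
          rw [← Real.rpow_add (by positivity)]
          ring_nf
        rw [weightF, ← hcancel]
        ring
    _ ≤ C₁ * C₂ * C₃ * Real.exp (-(1 / 16) * ‖z - w‖ ^ 2) * (C₄ * weightL γ w) := by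
        gcongr
        exact hweight w hw
    _ = C₁ * C₂ * C₃ * C₄ * Real.exp (-(1 / 16) * ‖z - w‖ ^ 2) * weightL γ w := by ring

lemma exists_eLpNorm_gaussian_convolution_le {n : ℕ} {p : ℝ≥0∞} (hp : 1 ≤ p) {c : ℝ}
    (hc : 0 < c) :
    ∃ C : ℝ≥0, ∀ v : Cn n → ℝ≥0∞, AEMeasurable v (V n) →
      eLpNorm (fun z => ∫⁻ w, v w * ENNReal.ofReal (Real.exp (-c * ‖z - w‖ ^ 2)) ∂(V n)) p (V n) ≤
        C * eLpNorm v p (V n) := by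
  let ν : Measure (Cn n) := (V n).withDensity fun u => ENNReal.ofReal (Real.exp (-c * ‖u‖ ^ 2))
  have : IsFiniteMeasure ν :=
    isFiniteMeasure_withDensity (integrable_gaussian hc).lintegral_lt_top.ne
  refine ⟨(ν Set.univ).toNNReal, fun v hv => ?_⟩
  let v' := hv.mk v
  have hv' : Measurable v' := hv.measurable_mk
  have hconv (z : Cn n) :
      ∫⁻ w, v w * ENNReal.ofReal (Real.exp (-c * ‖z - w‖ ^ 2)) ∂(V n) = ∫⁻ u, v' (z - u) ∂ν := by
    rw [lintegral_congr_ae (hv.ae_eq_mk.mono fun w hw =>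
        congrArg (· * ENNReal.ofReal (Real.exp (-c * ‖z - w‖ ^ 2))) hw),
      lintegral_withDensity_eq_lintegral_mul _ (by fun_prop) (by fun_prop),
      ← lintegral_sub_left_eq_self _ z]
    simp only [sub_sub_cancel, Pi.mul_apply, mul_comm, v']
  rw [ENNReal.coe_toNNReal (measure_ne_top _ _), eLpNorm_congr_ae hv.ae_eq_mk]
  simp only [hconv]
  exact eLpNorm_lintegral_le hp (F := fun z u => v' (z - u))
    (hv'.comp (measurable_fst.sub measurable_snd)) fun u =>
    (eLpNorm_comp_measurePreserving hv'.aestronglyMeasurable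
      (measurePreserving_sub_right (V n) u)).le

end KernelEstimate

section Projection

variable {n : ℕ} {p : ℝ≥0∞} {β r σ : ℝ} {ψ : Cn n → ℂ} {a : ℕ → ℝ}

lemma rpow_smul_integrandP_kernel (α : ℝ) (ψ : Cn n → ℂ) (z w : Cn n) :
    ‖w‖ ^ (-α) • integrandP (kernel n α) ψ z w =
      radialDensity α ‖w‖ • (ψ w * expSeries (kernelCoeff n α) (inner ℂ w z)) := by
  rw [integrandP, kernel, conj_expSeries, inner_conj_symm, radialDensity, mul_smul,
    mul_comm _ ((Real.exp _ : ℝ) : ℂ), ← Complex.real_smul]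

lemma opP_kernel (α r : ℝ) (ψ : Cn n → ℂ) (z : Cn n) : opP n α r (kernel n α) ψ z =
    ∫ w in Om n r, radialDensity α ‖w‖ • (ψ w * expSeries (kernelCoeff n α) (inner ℂ w z))
      ∂(V n) := by
  simp only [opP, integral_W_restrict, rpow_smul_integrandP_kernel]

lemma integrableOn_radialDensity_smul_mul_expSeries (hp : 1 ≤ p) (hr : 0 < r) (α : ℝ)
    (hψ : ψ ∈ spaceL n p r β) (h : ExpSeriesGrowth σ a) (z : Cn n) :
    IntegrableOn (fun w => radialDensity α ‖w‖ • (ψ w * expSeries a (inner ℂ w z))) (Om n r)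
      (V n) := by
  obtain ⟨C, hC, hexp⟩ := h.exists_norm_expSeries_le_exp
  have hseries : Continuous fun w : Cn n => expSeries a (inner ℂ w z) :=
    h.differentiable_expSeries.continuous.comp (by fun_prop)
  refine ((integrableOn_radialDensity_mul_exp hp hr α hψ (2 * ‖z‖)).const_mul C).mono'
    (((measurable_radialDensity α).comp measurable_norm).aestronglyMeasurable.smul
      (hψ.1.mul hseries.aestronglyMeasurable)) (.of_forall fun w => ?_)
  have hρ := radialDensity_nonneg α (norm_nonneg w)
  rw [norm_smul, norm_mul, Real.norm_of_nonneg hρ]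
  calc radialDensity α ‖w‖ * (‖ψ w‖ * ‖expSeries a (inner ℂ w z)‖)
      ≤ radialDensity α ‖w‖ * (‖ψ w‖ * (C * Real.exp (2 * (‖w‖ * ‖z‖)))) := by
        gcongr
        exact (hexp _).trans (by gcongr; exact norm_inner_le_norm w z)
    _ = C * (radialDensity α ‖w‖ * (‖ψ w‖ * Real.exp (2 * ‖z‖ * ‖w‖))) := by
        ring_nf

lemma integrableOn_integrandP_kernel (hn : 1 ≤ n) (hp : 1 ≤ p) (α : ℝ) (hr : 0 < r)
    (hψ : ψ ∈ spaceL n p r β) (z : Cn n) :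
    IntegrableOn (integrandP (kernel n α) ψ z) (Om n r) (W n α) := by
  simp only [integrableOn_W_iff, rpow_smul_integrandP_kernel]
  exact integrableOn_radialDensity_smul_mul_expSeries hp hr α hψ
    (expSeriesGrowth_kernelCoeff hn α) z

lemma exists_enorm_weightF_smul_opP_le (hn : 1 ≤ n) (α γ : ℝ) (hr : 0 < r) :
    ∃ C : ℝ≥0, ∀ (ψ : Cn n → ℂ) (z : Cn n), ‖weightF γ z • opP n α r (kernel n α) ψ z‖ₑ ≤
      C * ∫⁻ w in Om n r,
        ‖weightL γ w • ψ w‖ₑ * ENNReal.ofReal (Real.exp (-(1 / 16) * ‖z - w‖ ^ 2)) ∂(V n) := by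
  obtain ⟨C, hC, hkernel⟩ := exists_norm_kernel_mul_weightF_le hn α γ hr
  refine ⟨C.toNNReal, fun ψ z => ?_⟩
  rw [opP_kernel, ← integral_smul, ← lintegral_const_mul' _ _ ENNReal.coe_ne_top]
  refine (enorm_integral_le_lintegral_enorm _).trans
    (setLIntegral_mono' (measurableSet_Om r) fun w hw => ?_)
  have hL := weightL_nonneg γ w
  have hF := (weightF_pos γ z).le
  have hρ := radialDensity_nonneg α (norm_nonneg w)
  have hconj : ‖expSeries (kernelCoeff n α) (inner ℂ w z)‖ = ‖kernel n α z w‖ := by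
    rw [kernel, ← inner_conj_symm w z, ← conj_expSeries, RCLike.norm_conj]
  rw [← ofReal_norm, ← ofReal_norm, ← ENNReal.ofReal_mul (norm_nonneg _),
    ← ENNReal.ofReal.eq_1, ← ENNReal.ofReal_mul hC]
  refine ENNReal.ofReal_le_ofReal ?_
  simp only [norm_smul, norm_mul, hconj, Real.norm_of_nonneg, hL, hF, hρ]
  calc weightF γ z * (radialDensity α ‖w‖ * (‖ψ w‖ * ‖kernel n α z w‖))
      = ‖kernel n α z w‖ * radialDensity α ‖w‖ * weightF γ z * ‖ψ w‖ := by ring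
    _ ≤ C * Real.exp (-(1 / 16) * ‖z - w‖ ^ 2) * weightL γ w * ‖ψ w‖ := by
        gcongr ?_ * _
        exact hkernel z w hw
    _ = C * (weightL γ w * ‖ψ w‖ * Real.exp (-(1 / 16) * ‖z - w‖ ^ 2)) := by ring

lemma exists_normF_opP_le (hn : 1 ≤ n) (hp : 1 ≤ p) (α β : ℝ) (hr : 0 < r) :
    ∃ C : ℝ≥0, ∀ ψ ∈ spaceL n p r β,
      normF n p β (opP n α r (kernel n α) ψ) ≤ C * normL n p r β ψ := by
  obtain ⟨C₁, hpointwise⟩ := exists_enorm_weightF_smul_opP_le (n := n) hn α (weightExp p β) hr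
  obtain ⟨C₂, hconv⟩ := exists_eLpNorm_gaussian_convolution_le (n := n) hp (c := 1 / 16)
    (by norm_num)
  refine ⟨C₁ * C₂, fun ψ hψ => ?_⟩
  let v : Cn n → ℝ≥0∞ := (Om n r).indicator fun w => ‖weightL (weightExp p β) w • ψ w‖ₑ
  have hv : AEMeasurable v (V n) := (aemeasurable_indicator_iff (measurableSet_Om r)).2
    ((measurable_weightL _).aestronglyMeasurable.smul hψ.1).enorm
  have hvnorm : eLpNorm v p (V n) = normL n p r β ψ := by
    rw [normL_eq hp, eLpNorm_indicator_eq_eLpNorm_restrict (measurableSet_Om r), eLpNorm_enorm]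
  have hvconv (z : Cn n) : ‖weightF (weightExp p β) z • opP n α r (kernel n α) ψ z‖ₑ ≤
      C₁ * ∫⁻ w, v w * ENNReal.ofReal (Real.exp (-(1 / 16) * ‖z - w‖ ^ 2)) ∂(V n) := by
    refine (hpointwise ψ z).trans_eq ?_
    simp only [v, ← lintegral_indicator (measurableSet_Om r), Set.indicator_mul_left]
  rw [normF_eq hp, ENNReal.coe_mul, mul_assoc, ← hvnorm]
  refine (eLpNorm_le_nnreal_smul_eLpNorm_of_ae_le_mul' (g := fun z => ∫⁻ w, _ ∂(V n))
    (.of_forall hvconv) p).trans ?_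
  exact mul_le_mul_right (hconv v hv) _

lemma ExpSeriesGrowth.exists_norm_deriv_expSeries_le_exp (h : ExpSeriesGrowth σ a) :
    ∃ C : ℝ, 0 ≤ C ∧ ∀ x : ℂ, ‖deriv (expSeries a) x‖ ≤ C * Real.exp (2 * ‖x‖) := by
  obtain ⟨C, hC, hexp⟩ := h.exists_norm_expSeries_le_exp
  refine ⟨C * Real.exp 2, by positivity, fun x => ?_⟩
  have hsphere (y : ℂ) (hy : y ∈ Metric.sphere x 1) :
      ‖expSeries a y‖ ≤ C * Real.exp (2 * (‖x‖ + 1)) := by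
    refine (hexp y).trans ?_
    gcongr
    rw [← mem_sphere_iff_norm.1 hy]
    exact norm_le_norm_add_norm_sub' y x
  have hcauchy := Complex.norm_deriv_le_of_forall_mem_sphere_norm_le one_pos
    h.differentiable_expSeries.diffContOnCl hsphere
  rw [div_one, mul_add, Real.exp_add, mul_one] at hcauchy
  linarith

lemma ExpSeriesGrowth.exists_norm_deriv_expSeries_inner_mul_norm_le (h : ExpSeriesGrowth σ a) :
    ∃ C : ℝ, 0 ≤ C ∧ ∀ (R : ℝ) (w x : Cn n), ‖x‖ ≤ R →
      ‖deriv (expSeries a) (inner ℂ w x)‖ * ‖w‖ ≤ C * Real.exp ((2 * R + 1) * ‖w‖) := by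
  obtain ⟨C, hC, hderiv⟩ := h.exists_norm_deriv_expSeries_le_exp
  refine ⟨C, hC, fun R w x hx => ?_⟩
  have hinner : ‖inner ℂ w x‖ ≤ ‖w‖ * R := (norm_inner_le_norm w x).trans (by gcongr)
  have hw : ‖w‖ ≤ Real.exp ‖w‖ := by linarith [Real.add_one_le_exp ‖w‖]
  calc ‖deriv (expSeries a) (inner ℂ w x)‖ * ‖w‖
      ≤ C * Real.exp (2 * (‖w‖ * R)) * Real.exp ‖w‖ := by
        gcongr
        exact (hderiv _).trans (by gcongr)
    _ = C * Real.exp ((2 * R + 1) * ‖w‖) := by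
        rw [mul_assoc, ← Real.exp_add]
        ring_nf

lemma differentiable_integral_radialDensity_smul_mul_expSeries (hp : 1 ≤ p) (α : ℝ) (hr : 0 < r)
    (hψ : ψ ∈ spaceL n p r β) (h : ExpSeriesGrowth σ a) :
    Differentiable ℂ fun z : Cn n =>
      ∫ w in Om n r, radialDensity α ‖w‖ • (ψ w * expSeries a (inner ℂ w z)) ∂(V n) := by
  intro z
  obtain ⟨C, -, hderiv⟩ := h.exists_norm_deriv_expSeries_inner_mul_norm_le (n := n)
  let F' (x w : Cn n) : Cn n →L[ℂ] ℂ :=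
    radialDensity α ‖w‖ • ψ w • deriv (expSeries a) (inner ℂ w x) • innerSL ℂ w
  have hF'meas : AEStronglyMeasurable (F' z) ((V n).restrict (Om n r)) := by
    have hderivcont : Continuous (deriv (expSeries a : ℂ → ℂ)) :=
      (h.differentiable_expSeries.contDiff (n := 1)).continuous_deriv le_rfl
    have hcont : Continuous fun w : Cn n => deriv (expSeries a) (inner ℂ w z) • innerSL ℂ w :=
      (hderivcont.comp (by fun_prop)).smul (innerSL ℂ).continuous
    exact ((measurable_radialDensity α).comp measurable_norm).aestronglyMeasurable.smul
      (hψ.1.smul hcont.aestronglyMeasurable)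
  have hF'bound (w x : Cn n) (hx : x ∈ Metric.ball z 1) : ‖F' x w‖ ≤
      C * (radialDensity α ‖w‖ * (‖ψ w‖ * Real.exp ((2 * (‖z‖ + 1) + 1) * ‖w‖))) := by
    have hxz : ‖x‖ ≤ ‖z‖ + 1 :=
      (norm_le_norm_add_norm_sub' x z).trans (by gcongr; exact (mem_ball_iff_norm.1 hx).le)
    have hρ := radialDensity_nonneg α (norm_nonneg w)
    calc ‖F' x w‖
        = radialDensity α ‖w‖ * (‖ψ w‖ * (‖deriv (expSeries a) (inner ℂ w x)‖ * ‖w‖)) := by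
          simp only [F', norm_smul, innerSL_apply_norm, Real.norm_of_nonneg hρ]
      _ ≤ radialDensity α ‖w‖ * (‖ψ w‖ * (C * Real.exp ((2 * (‖z‖ + 1) + 1) * ‖w‖))) := by
          gcongr radialDensity α ‖w‖ * (‖ψ w‖ * ?_)
          exact hderiv _ w x hxz
      _ = C * (radialDensity α ‖w‖ * (‖ψ w‖ * Real.exp ((2 * (‖z‖ + 1) + 1) * ‖w‖))) := by
          ring
  have hF' (w x : Cn n) : HasFDerivAt
      (fun x => radialDensity α ‖w‖ • (ψ w * expSeries a (inner ℂ w x))) (F' x w) x :=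
    (((h.differentiable_expSeries _).hasDerivAt.comp_hasFDerivAt x
      (innerSL ℂ w).hasFDerivAt).const_mul (ψ w)).const_smul (radialDensity α ‖w‖)
  have hint := integrableOn_radialDensity_smul_mul_expSeries hp hr α hψ h
  exact (hasFDerivAt_integral_of_dominated_of_fderiv_le (Metric.ball_mem_nhds z one_pos)
    (.of_forall fun x => (hint x).aestronglyMeasurable) (hint z) hF'meas
    (.of_forall hF'bound) ((integrableOn_radialDensity_mul_exp hp hr α hψ _).const_mul C)
    (.of_forall fun w x _ => hF' w x)).differentiableAt

lemma differentiable_opP (hn : 1 ≤ n) (hp : 1 ≤ p) (α : ℝ) (hr : 0 < r)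
    (hψ : ψ ∈ spaceL n p r β) : Differentiable ℂ (opP n α r (kernel n α) ψ) := by
  simp only [funext (opP_kernel α r ψ)]
  exact differentiable_integral_radialDensity_smul_mul_expSeries hp α hr hψ
    (expSeriesGrowth_kernelCoeff hn α)

/-- The operator `P^r_α` from `𝓛^{p,r}_β` to `F^p_β`. -/
def projL (hn : 1 ≤ n) (hp : 1 ≤ p) (α β : ℝ) (hr : 0 < r) :
    spaceL n p r β →ₗ[ℂ] spaceF n p β where
  toFun ψ := ⟨opP n α r (kernel n α) ψ, differentiable_opP hn hp α hr ψ.2, by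
    obtain ⟨C, hC⟩ := exists_normF_opP_le (n := n) hn hp α β hr
    exact (hC ψ ψ.2).trans_lt (ENNReal.mul_lt_top ENNReal.coe_lt_top ψ.2.2)⟩
  map_add' ψ₁ ψ₂ := by
    have hint (ψ : spaceL n p r β) := integrableOn_radialDensity_smul_mul_expSeries hp hr α ψ.2
      (expSeriesGrowth_kernelCoeff hn α)
    ext z
    simp only [Submodule.coe_add, Pi.add_apply, opP_kernel, add_mul, smul_add]
    exact integral_add (hint ψ₁ z) (hint ψ₂ z)
  map_smul' c ψ := by
    ext z
    simp only [Submodule.coe_smul, Pi.smul_apply, RingHom.id_apply, smul_eq_mul, opP_kernel,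
      mul_assoc, ← integral_const_mul, mul_smul_comm]

end Projection

section Multiplier

variable {n : ℕ}

/-- The radial density of `e^{-|z|²} dW_α(z)` on `Ω_r`, extended by zero. -/
def truncatedDensity (α r : ℝ) : ℝ → ℝ := (Set.Ici r).indicator (radialDensity α)

/-- The factor by which `P^r_α` multiplies homogeneous polynomials of degree `k`. -/
def multiplier (n : ℕ) (α r : ℝ) (k : ℕ) : ℝ :=
  kernelCoeff n α k * (radialMoment n (truncatedDensity α r) k /
    radialMoment n (fun t => Real.exp (-t ^ 2)) k)

/-- The integrand of the radial moments of `e^{-|z|²} dW_α(z)`. -/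
def momentIntegrand (n : ℕ) (α : ℝ) (k : ℕ) (t : ℝ) : ℝ :=
  t ^ (2 * n - 1) * (t ^ (2 * k) * radialDensity α t)

lemma hasSum_opP_kernel (hn : 1 ≤ n) {p : ℝ≥0∞} (hp : 1 ≤ p) (α : ℝ) {β r : ℝ} (hr : 0 < r)
    {f : Cn n → ℂ} (hf : f ∈ spaceF n p β) (z : Cn n) :
    HasSum (fun k => (multiplier n α r k : ℂ) * homPart k f z)
      (opP n α r (kernel n α) f z) := by
  have hgrowth := expSeriesGrowth_kernelCoeff hn α
  have hcoeff (k : ℕ) := (kernelCoeff_pos hn α k).le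
  have hρ (w : Cn n) : truncatedDensity α r ‖w‖ =
      (Om n r).indicator (fun w => radialDensity α ‖w‖) w := by
    simp only [truncatedDensity, Set.indicator, Set.mem_Ici, mem_Om]
  have hint := (integrable_indicator_iff (measurableSet_Om r)).2
    (integrableOn_radialDensity_mul_expSeries hp hr α (spaceF_le_spaceL hp hr β hf) hcoeff hgrowth
      (norm_nonneg z))
  have hsum := hasSum_integral_radial_smul_mul_expSeries_inner hn hf.1
    ((measurable_radialDensity α).indicator measurableSet_Ici) hcoeff hgrowth.summable_real
    (ρ := truncatedDensity α r) (z := z) (hint.congr (.of_forall fun w => by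
      simp only [Set.indicator_mul_left, hρ, Real.norm_of_nonneg
        (Set.indicator_nonneg (fun w _ => radialDensity_nonneg α (norm_nonneg w)) w)]))
  simpa only [multiplier, opP_kernel, ← integral_indicator (measurableSet_Om r), hρ,
    Set.indicator_smul_left] using hsum

lemma momentIntegrand_pos {α : ℝ} {k : ℕ} {t : ℝ} (ht : 0 < t) : 0 < momentIntegrand n α k t := by
  unfold momentIntegrand radialDensity
  positivity

lemma momentIntegrand_eq_pow_mul (α : ℝ) {N k : ℕ} (h : N ≤ k) (t : ℝ) :
    momentIntegrand n α k t = (t ^ 2) ^ (k - N) * momentIntegrand n α N t := by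
  obtain ⟨j, rfl⟩ := Nat.exists_eq_add_of_le h
  rw [momentIntegrand, momentIntegrand, Nat.add_sub_cancel_left]
  ring

lemma integrableOn_Ioi_momentIntegrand (α : ℝ) (k : ℕ) {r : ℝ} (hr : 0 < r) :
    IntegrableOn (momentIntegrand n α k) (Set.Ioi r) := by
  obtain ⟨C, -, hdensity⟩ := exists_radialDensity_mul_exp_le hr α 0 (c := 1 / 2) (by norm_num)
  have hgauss := integrable_rpow_mul_exp_neg_mul_sq (b := 1 / 2) (by norm_num)
    (s := (2 * n - 1 + 2 * k : ℕ)) (neg_one_lt_zero.trans_le (Nat.cast_nonneg _))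
  refine (hgauss.integrableOn.const_mul C).mono' ?_ ?_
  · unfold momentIntegrand
    have hρ := measurable_radialDensity α
    exact Measurable.aestronglyMeasurable (by fun_prop)
  filter_upwards [ae_restrict_mem measurableSet_Ioi] with t ht
  have ht0 : 0 < t := hr.trans ht
  have hle := hdensity t (le_of_lt ht)
  rw [zero_mul, Real.exp_zero, mul_one] at hle
  rw [Real.norm_of_nonneg (momentIntegrand_pos ht0).le, Real.rpow_natCast, pow_add]
  calc momentIntegrand n α k t
      ≤ t ^ (2 * n - 1) * (t ^ (2 * k) * (C * Real.exp (-(1 / 2) * t ^ 2))) := by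
        unfold momentIntegrand
        gcongr
    _ = C * (t ^ (2 * n - 1) * t ^ (2 * k) * Real.exp (-(1 / 2) * t ^ 2)) := by ring

lemma integral_Ioi_momentIntegrand_pos (α : ℝ) (k : ℕ) {r : ℝ} (hr : 0 < r) :
    0 < ∫ t in Set.Ioi r, momentIntegrand n α k t := by
  have hpos (t : ℝ) (ht : t ∈ Set.Ioi r) : 0 < momentIntegrand n α k t :=
    momentIntegrand_pos (hr.trans ht)
  have hsupport : Set.Ioi r ⊆ Function.support (momentIntegrand n α k) :=
    fun t ht => (hpos t ht).ne'
  rw [setIntegral_pos_iff_support_of_nonneg_ae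
    (ae_restrict_of_forall_mem measurableSet_Ioi fun t ht => (hpos t ht).le)
    (integrableOn_Ioi_momentIntegrand α k hr), Set.inter_eq_right.2 hsupport]
  simp

lemma integral_Ioc_momentIntegrand_nonneg (α : ℝ) (k : ℕ) (r : ℝ) :
    0 ≤ ∫ t in Set.Ioc 0 r, momentIntegrand n α k t :=
  setIntegral_nonneg measurableSet_Ioc fun _ ht => (momentIntegrand_pos ht.1).le

lemma radialMoment_truncatedDensity (α : ℝ) (k : ℕ) {r : ℝ} (hr : 0 < r) :
    radialMoment n (truncatedDensity α r) k = ∫ t in Set.Ioi r, momentIntegrand n α k t := by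
  have hind (t : ℝ) : t ^ (2 * n - 1) * (t ^ (2 * k) * truncatedDensity α r t) =
      (Set.Ici r).indicator (momentIntegrand n α k) t := by
    unfold truncatedDensity momentIntegrand
    rw [Set.indicator_mul_right, Set.indicator_mul_right]
  simp only [radialMoment, hind]
  rw [setIntegral_indicator measurableSet_Ici, Set.inter_eq_right.2 (Set.Ici_subset_Ioi.2 hr),
    integral_Ici_eq_integral_Ioi]

lemma multiplier_pos (hn : 1 ≤ n) (α : ℝ) {r : ℝ} (hr : 0 < r) (k : ℕ) :
    0 < multiplier n α r k := by
  rw [multiplier, radialMoment_truncatedDensity α k hr]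
  exact mul_pos (kernelCoeff_pos hn α k)
    (div_pos (integral_Ioi_momentIntegrand_pos α k hr) (radialMoment_gaussian_pos hn k))

lemma integral_Ioi_zero_momentIntegrand (hn : 1 ≤ n) {α : ℝ} {k : ℕ} (hk : ⌊|α / 2|⌋₊ < k) :
    ∫ t in Set.Ioi 0, momentIntegrand n α k t = Real.Gamma (k + n - α / 2) / 2 :=
  radialMoment_rpow_mul_exp hn (add_sub_half_pos hn (.inr hk))

lemma integrableOn_Ioi_zero_momentIntegrand (hn : 1 ≤ n) {α : ℝ} {k : ℕ} (hk : ⌊|α / 2|⌋₊ < k) :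
    IntegrableOn (momentIntegrand n α k) (Set.Ioi 0) := by
  refine Integrable.of_integral_ne_zero ?_
  rw [integral_Ioi_zero_momentIntegrand hn hk]
  exact (half_pos (Gamma_add_sub_pos hn (.inr hk))).ne'

lemma inv_multiplier_sub_one (hn : 1 ≤ n) {α r : ℝ} (hr : 0 < r) {k : ℕ} (hk : ⌊|α / 2|⌋₊ < k) :
    (multiplier n α r k)⁻¹ - 1 = (∫ t in Set.Ioc 0 r, momentIntegrand n α k t) /
      ∫ t in Set.Ioi r, momentIntegrand n α k t := by
  have hsplit : (∫ t in Set.Ioc 0 r, momentIntegrand n α k t) +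
      ∫ t in Set.Ioi r, momentIntegrand n α k t = Real.Gamma (k + n - α / 2) / 2 := by
    rw [← integral_Ioi_zero_momentIntegrand hn hk, ← Set.Ioc_union_Ioi_eq_Ioi hr.le]
    exact (setIntegral_union (Set.Ioc_disjoint_Ioi le_rfl) measurableSet_Ioi
      ((integrableOn_Ioi_zero_momentIntegrand hn hk).mono_set Set.Ioc_subset_Ioi_self)
      (integrableOn_Ioi_momentIntegrand α k hr)).symm
  have htail := (integral_Ioi_momentIntegrand_pos (n := n) α k hr).ne'
  have hΓ := (Gamma_add_pos hn k).ne'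
  have := (Gamma_add_sub_pos hn (.inr hk)).ne'
  rw [multiplier, radialMoment_truncatedDensity α k hr, radialMoment_gaussian hn, kernelCoeff,
    if_pos (.inr hk), eq_div_iff htail, eq_sub_of_add_eq hsplit]
  field_simp

lemma integral_Ioc_momentIntegrand_le {α r : ℝ} {N k : ℕ} (h : N ≤ k)
    (hN : IntegrableOn (momentIntegrand n α N) (Set.Ioc 0 r))
    (hk : IntegrableOn (momentIntegrand n α k) (Set.Ioc 0 r)) :
    ∫ t in Set.Ioc 0 r, momentIntegrand n α k t ≤
      (r ^ 2) ^ (k - N) * ∫ t in Set.Ioc 0 r, momentIntegrand n α N t := by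
  rw [← integral_const_mul]
  refine setIntegral_mono_on hk (hN.const_mul _) measurableSet_Ioc fun t ht => ?_
  rw [momentIntegrand_eq_pow_mul α h]
  have hpos := (momentIntegrand_pos (n := n) (α := α) (k := N) ht.1).le
  have ht0 := ht.1.le
  gcongr
  exact ht.2

lemma le_integral_Ioi_momentIntegrand (α : ℝ) {r R : ℝ} (hr : 0 < r) (hrR : r ≤ R) {N k : ℕ}
    (h : N ≤ k) : (R ^ 2) ^ (k - N) * ∫ t in Set.Ioi R, momentIntegrand n α N t ≤
      ∫ t in Set.Ioi r, momentIntegrand n α k t := by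
  have hR := hr.trans_le hrR
  rw [← integral_const_mul]
  calc ∫ t in Set.Ioi R, (R ^ 2) ^ (k - N) * momentIntegrand n α N t
      ≤ ∫ t in Set.Ioi R, momentIntegrand n α k t := by
        refine setIntegral_mono_on ((integrableOn_Ioi_momentIntegrand α N hR).const_mul _)
          (integrableOn_Ioi_momentIntegrand α k hR) measurableSet_Ioi fun t ht => ?_
        rw [momentIntegrand_eq_pow_mul α h]
        have hpos := (momentIntegrand_pos (n := n) (α := α) (k := N) (hR.trans ht)).le
        gcongr
        exact le_of_lt ht
    _ ≤ ∫ t in Set.Ioi r, momentIntegrand n α k t :=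
        setIntegral_mono_set (integrableOn_Ioi_momentIntegrand α k hr)
          (ae_restrict_of_forall_mem measurableSet_Ioi fun t ht =>
            (momentIntegrand_pos (hr.trans ht)).le) (Set.Ioi_subset_Ioi hrR).eventuallyLE

lemma summable_norm_inv_multiplier_sub_one (hn : 1 ≤ n) (α : ℝ) {r : ℝ} (hr : 0 < r) :
    Summable fun k => ‖(multiplier n α r k : ℂ)⁻¹ - 1‖ := by
  let N := ⌊|α / 2|⌋₊ + 1
  let A := ∫ t in Set.Ioc 0 r, momentIntegrand n α N t
  let B := ∫ t in Set.Ioi (2 * r), momentIntegrand n α N t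
  have hA : 0 ≤ A := integral_Ioc_momentIntegrand_nonneg α N r
  have hB : 0 < B := integral_Ioi_momentIntegrand_pos α N (by positivity)
  have hint (k : ℕ) : IntegrableOn (momentIntegrand n α (k + N)) (Set.Ioc 0 r) :=
    (integrableOn_Ioi_zero_momentIntegrand hn (by lia)).mono_set Set.Ioc_subset_Ioi_self
  refine (summable_nat_add_iff N).1 (Summable.of_nonneg_of_le (fun k => norm_nonneg _)
    (fun k => ?_) ((summable_geometric_of_lt_one (r := 1 / 4) (by norm_num) (by norm_num)).mul_left
      (A / B)))
  have hnum : ∫ t in Set.Ioc 0 r, momentIntegrand n α (k + N) t ≤ (r ^ 2) ^ k * A := by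
    simpa using integral_Ioc_momentIntegrand_le (Nat.le_add_left N k) (by simpa using hint 0)
      (hint k)
  have hden : ((2 * r) ^ 2) ^ k * B ≤ ∫ t in Set.Ioi r, momentIntegrand n α (k + N) t := by
    simpa using le_integral_Ioi_momentIntegrand (n := n) α hr (by linarith : r ≤ 2 * r)
      (Nat.le_add_left N k)
  have hcast : (multiplier n α r (k + N) : ℂ)⁻¹ - 1 =
      ((multiplier n α r (k + N))⁻¹ - 1 : ℝ) := by
    push_cast
    rfl
  rw [hcast, Complex.norm_real, inv_multiplier_sub_one hn hr (by lia), Real.norm_of_nonneg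
    (div_nonneg (integral_Ioc_momentIntegrand_nonneg α _ r)
      (integral_Ioi_momentIntegrand_pos α _ hr).le)]
  calc _ ≤ (r ^ 2) ^ k * A / (((2 * r) ^ 2) ^ k * B) :=
        div_le_div₀ (by positivity) hnum (by positivity) hden
    _ = A / B * (1 / 4) ^ k := by
        rw [mul_pow 2 r, mul_pow, one_div, inv_pow, show (2 : ℝ) ^ 2 = 4 by norm_num]
        field_simp

end Multiplier

section CircleMultiplier

open AddCircle

variable {n : ℕ} {e : ℕ → ℂ} {f g : Cn n → ℂ}

/-- The function on the circle with Fourier coefficients `e k` at `-k`. -/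
def fourierSum (e : ℕ → ℂ) (t : UnitAddCircle) : ℂ := ∑' k : ℕ, e k * fourier (-k : ℤ) t

/-- The operator multiplying the homogeneous part of degree `k` by `e k`, as an average over
rotations. -/
def circleMultiplier (e : ℕ → ℂ) (f : Cn n → ℂ) (z : Cn n) : ℂ :=
  ∫ t, fourierSum e t * f (toCircle t • z) ∂haarAddCircle

lemma norm_mul_fourier (c : ℂ) (m : ℤ) (t : UnitAddCircle) : ‖c * fourier m t‖ = ‖c‖ := by
  rw [norm_mul, fourier_apply, Circle.norm_coe, mul_one]

lemma hasSum_fourierSum (he : Summable fun k => ‖e k‖) (t : UnitAddCircle) :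
    HasSum (fun k : ℕ => e k * fourier (-k : ℤ) t) (fourierSum e t) :=
  (Summable.of_norm_bounded he fun _ => (norm_mul_fourier _ _ t).le).hasSum

lemma continuous_fourierSum (he : Summable fun k => ‖e k‖) : Continuous (fourierSum e) :=
  continuous_tsum (fun k => by fun_prop) he fun k t => (norm_mul_fourier _ _ t).le

lemma norm_fourierSum_le (he : Summable fun k => ‖e k‖) (t : UnitAddCircle) :
    ‖fourierSum e t‖ ≤ ∑' k, ‖e k‖ :=
  tsum_of_norm_bounded he.hasSum fun _ => (norm_mul_fourier _ _ t).le

lemma hasSum_circleMultiplier (he : Summable fun k => ‖e k‖) (hf : Differentiable ℂ f)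
    (z : Cn n) : HasSum (fun k => e k * homPart k f z) (circleMultiplier e f z) := by
  have hfc := hf.continuous
  have hcoeff (k : ℕ) : e k * homPart k f z =
      ∫ t : UnitAddCircle, e k * fourier (-k : ℤ) t * f (toCircle t • z) ∂haarAddCircle := by
    simp only [homPart_eq_fourierCoeff hf, fourierCoeff, ← integral_const_mul, smul_eq_mul,
      mul_assoc]
  simp only [hcoeff]
  refine hasSum_integral_of_dominated_convergence
    (fun k (t : UnitAddCircle) => ‖e k‖ * ‖f (toCircle t • z)‖)
    (fun k => Continuous.aestronglyMeasurable (by fun_prop))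
    (fun k => .of_forall fun t => by rw [norm_mul, norm_mul_fourier])
    (.of_forall fun t => he.mul_right _) ?_
    (.of_forall fun t => (hasSum_fourierSum he t).mul_right _)
  simp only [tsum_mul_right]
  exact integrable_of_continuous_of_compactSpace (by fun_prop)

lemma differentiable_circleMultiplier (he : Summable fun k => ‖e k‖) (hf : Differentiable ℂ f) :
    Differentiable ℂ (circleMultiplier e f) := by
  have hfc := hf.continuous
  have hf' := continuous_fderiv_of_entire hf
  have hsum := continuous_fourierSum he
  refine differentiable_integral_of_compactSpace
    (G' := fun z t => fourierSum e t •
      fderiv ℂ f ((toCircle t : ℂ) • z) ∘L ((toCircle t : ℂ) • ContinuousLinearMap.id ℂ (Cn n)))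
    (fun z => by fun_prop) (by unfold Function.HasUncurry.uncurry; fun_prop) fun z t => ?_
  exact ((hf _).hasFDerivAt.comp z ((hasFDerivAt_id z).const_smul (toCircle t : ℂ))).const_mul _

lemma normF_circleMultiplier_le (he : Summable fun k => ‖e k‖) {p : ℝ≥0∞} (hp : 1 ≤ p) (β : ℝ)
    (hf : Continuous f) :
    normF n p β (circleMultiplier e f) ≤ (∑' k, ‖e k‖).toNNReal * normF n p β f := by
  rw [normF_eq hp, normF_eq hp]
  let u (z : Cn n) : ℂ := weightF (weightExp p β) z • f z
  have hu : Continuous u := (continuous_weightF _).smul hf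
  have hpointwise (z : Cn n) : ‖weightF (weightExp p β) z • circleMultiplier e f z‖ₑ ≤
      (∑' k, ‖e k‖).toNNReal * ∫⁻ t : UnitAddCircle, ‖u (toCircle t • z)‖ₑ ∂haarAddCircle := by
    rw [circleMultiplier, ← integral_smul, ← lintegral_const_mul' _ _ ENNReal.coe_ne_top]
    refine (enorm_integral_le_lintegral_enorm _).trans (lintegral_mono fun t => ?_)
    have hrot : weightF (weightExp p β) (toCircle t • z) = weightF (weightExp p β) z := by
      simp only [weightF, Circle.norm_smul]
    simp only [u, hrot]
    rw [← mul_smul_comm, enorm_mul]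
    gcongr
    rw [← ofReal_norm]
    exact ENNReal.ofReal_le_ofReal (norm_fourierSum_le he t)
  have hminkowski := eLpNorm_lintegral_le (μ := V n) (ν := haarAddCircle) hp
    (F := fun z (t : UnitAddCircle) => ‖u (toCircle t • z)‖ₑ) (A := eLpNorm u p (V n))
    (Continuous.measurable (by unfold Function.uncurry; fun_prop)) (fun t => by
      rw [eLpNorm_enorm]
      exact (eLpNorm_comp_measurePreserving hu.aestronglyMeasurable
        (measurePreserving_circle_smul _)).le)
  rw [measure_univ, one_mul] at hminkowski
  exact (eLpNorm_le_nnreal_smul_eLpNorm_of_ae_le_mul'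
    (g := fun z => ∫⁻ t : UnitAddCircle, ‖u (toCircle t • z)‖ₑ ∂haarAddCircle)
    (.of_forall hpointwise) p).trans (mul_le_mul_right hminkowski _)

lemma normF_add_le {p : ℝ≥0∞} (hp : 1 ≤ p) (β : ℝ) (hf : Continuous f) (hg : Continuous g) :
    normF n p β (f + g) ≤ normF n p β f + normF n p β g := by
  have hw := continuous_weightF (n := n) (weightExp p β)
  simp only [normF_eq hp, Pi.add_apply, smul_add]
  exact eLpNorm_add_le (hw.smul hf).aestronglyMeasurable (hw.smul hg).aestronglyMeasurable hp

end CircleMultiplier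

section Inverse

variable {n : ℕ} {p : ℝ≥0∞} {β r : ℝ} {f g : Cn n → ℂ}

/-- The inverse of `P^r_α` on entire functions, in the form `1 + ((P^r_α)⁻¹ - 1)` where the second
summand is an average over rotations. -/
def invP (n : ℕ) (α r : ℝ) (f : Cn n → ℂ) : Cn n → ℂ :=
  f + circleMultiplier (fun k => (multiplier n α r k : ℂ)⁻¹ - 1) f

lemma hasSum_invP (hn : 1 ≤ n) (α : ℝ) (hr : 0 < r) (hf : Differentiable ℂ f) (z : Cn n) :
    HasSum (fun k => (multiplier n α r k : ℂ)⁻¹ * homPart k f z) (invP n α r f z) := by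
  have h := (hasSum_homPart hf z).add
    (hasSum_circleMultiplier (summable_norm_inv_multiplier_sub_one hn α hr) hf z)
  simpa only [invP, Pi.add_apply, sub_one_mul, add_sub_cancel] using h

lemma differentiable_invP (hn : 1 ≤ n) (α : ℝ) (hr : 0 < r) (hf : Differentiable ℂ f) :
    Differentiable ℂ (invP n α r f) :=
  hf.add (differentiable_circleMultiplier (summable_norm_inv_multiplier_sub_one hn α hr) hf)

lemma exists_normF_invP_le (hn : 1 ≤ n) (hp : 1 ≤ p) (α β : ℝ) (hr : 0 < r) :
    ∃ C : ℝ≥0, ∀ f : Cn n → ℂ, Differentiable ℂ f →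
      normF n p β (invP n α r f) ≤ C * normF n p β f := by
  have hsum := summable_norm_inv_multiplier_sub_one hn α hr
  refine ⟨1 + (∑' k, ‖(multiplier n α r k : ℂ)⁻¹ - 1‖).toNNReal, fun f hf => ?_⟩
  rw [ENNReal.coe_add, ENNReal.coe_one, add_mul, one_mul]
  exact (normF_add_le hp β hf.continuous (differentiable_circleMultiplier hsum hf).continuous).trans
    (add_le_add_right (normF_circleMultiplier_le hsum hp β hf.continuous) _)

lemma invP_mem_spaceF (hn : 1 ≤ n) (hp : 1 ≤ p) (α : ℝ) (hr : 0 < r) (hf : f ∈ spaceF n p β) :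
    invP n α r f ∈ spaceF n p β := by
  obtain ⟨C, hC⟩ := exists_normF_invP_le (n := n) hn hp α β hr
  exact ⟨differentiable_invP hn α hr hf.1,
    (hC f hf.1).trans_lt (ENNReal.mul_lt_top ENNReal.coe_lt_top hf.2)⟩

lemma homPart_eq_mul_of_hasSum {m : ℕ → ℂ} (hg : Differentiable ℂ g)
    (h : ∀ z, HasSum (fun k => m k * homPart k f z) (g z)) (k : ℕ) (z : Cn n) :
    homPart k g z = m k * homPart k f z := by
  refine homPart_eq_of_hasSum hg (b := fun k => m k * homPart k f z) (fun c => ?_) k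
  simpa only [homPart_smul, mul_left_comm] using h (c • z)

lemma homPart_opP_kernel (hn : 1 ≤ n) (hp : 1 ≤ p) (α : ℝ) (hr : 0 < r) (hf : f ∈ spaceF n p β)
    (k : ℕ) (z : Cn n) :
    homPart k (opP n α r (kernel n α) f) z = multiplier n α r k * homPart k f z :=
  homPart_eq_mul_of_hasSum (differentiable_opP hn hp α hr (spaceF_le_spaceL hp hr β hf))
    (hasSum_opP_kernel hn hp α hr hf) k z

lemma homPart_invP (hn : 1 ≤ n) (α : ℝ) (hr : 0 < r) (hf : Differentiable ℂ f) (k : ℕ)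
    (z : Cn n) : homPart k (invP n α r f) z = (multiplier n α r k : ℂ)⁻¹ * homPart k f z :=
  homPart_eq_mul_of_hasSum (differentiable_invP hn α hr hf) (hasSum_invP hn α hr hf) k z

lemma opP_invP (hn : 1 ≤ n) (hp : 1 ≤ p) (α : ℝ) (hr : 0 < r) (hf : f ∈ spaceF n p β) :
    opP n α r (kernel n α) (invP n α r f) = f := by
  have hinv := invP_mem_spaceF hn hp α hr hf
  refine eq_of_homPart_eq (differentiable_opP hn hp α hr (spaceF_le_spaceL hp hr β hinv)) hf.1
    fun k z => ?_
  rw [homPart_opP_kernel hn hp α hr hinv, homPart_invP hn α hr hf.1,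
    mul_inv_cancel_left₀ (Complex.ofReal_ne_zero.2 (multiplier_pos hn α hr k).ne')]

lemma invP_opP (hn : 1 ≤ n) (hp : 1 ≤ p) (α : ℝ) (hr : 0 < r) (hf : f ∈ spaceF n p β) :
    invP n α r (opP n α r (kernel n α) f) = f := by
  have hop := differentiable_opP hn hp α hr (spaceF_le_spaceL hp hr β hf)
  refine eq_of_homPart_eq (differentiable_invP hn α hr hop) hf.1 fun k z => ?_
  rw [homPart_invP hn α hr hop, homPart_opP_kernel hn hp α hr hf,
    inv_mul_cancel_left₀ (Complex.ofReal_ne_zero.2 (multiplier_pos hn α hr k).ne')]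

/-- The operator `P^r_α` as a linear automorphism of `F^p_β`, with inverse `invP`. -/
def projF (hn : 1 ≤ n) (hp : 1 ≤ p) (α β : ℝ) (hr : 0 < r) : spaceF n p β ≃ₗ[ℂ] spaceF n p β where
  toLinearMap := projL hn hp α β hr ∘ₗ Submodule.inclusion (spaceF_le_spaceL hp hr β)
  invFun f := ⟨invP n α r f, invP_mem_spaceF hn hp α hr f.2⟩
  left_inv f := Subtype.ext (invP_opP hn hp α hr f.2)
  right_inv f := Subtype.ext (opP_invP hn hp α hr f.2)

lemma exists_normF_projL_le (hn : 1 ≤ n) (hp : 1 ≤ p) (α β : ℝ) (hr : 0 < r) :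
    ∃ C : ℝ≥0, ∀ ψ : spaceL n p r β,
      normF n p β (projL hn hp α β hr ψ) ≤ C * normL n p r β ψ := by
  obtain ⟨C, hC⟩ := exists_normF_opP_le (n := n) hn hp α β hr
  exact ⟨C, fun ψ => hC ψ ψ.2⟩

lemma exists_normF_projF_le (hn : 1 ≤ n) (hp : 1 ≤ p) (α β : ℝ) (hr : 0 < r) :
    ∃ C : ℝ≥0, ∀ f : spaceF n p β, normF n p β (projF hn hp α β hr f) ≤ C * normF n p β f ∧
      normF n p β ((projF hn hp α β hr).symm f) ≤ C * normF n p β f := by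
  obtain ⟨C₁, hop⟩ := exists_normF_opP_le (n := n) hn hp α β hr
  obtain ⟨C₂, hrestrict⟩ := exists_normL_le_normF (n := n) hp hr β
  obtain ⟨C₃, hinv⟩ := exists_normF_invP_le (n := n) hn hp α β hr
  refine ⟨max (C₁ * C₂) C₃, fun f => ⟨?_, ?_⟩⟩
  · calc normF n p β (projF hn hp α β hr f)
        ≤ C₁ * normL n p r β f := hop f (spaceF_le_spaceL hp hr β f.2)
      _ ≤ C₁ * (C₂ * normF n p β f) := by
          gcongr
          exact hrestrict f
      _ = (C₁ * C₂ : ℝ≥0) * normF n p β f := by rw [ENNReal.coe_mul, mul_assoc]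
      _ ≤ (max (C₁ * C₂) C₃ : ℝ≥0) * normF n p β f := by
          gcongr
          exact le_max_left _ _
  · refine (hinv f f.2.1).trans ?_
    gcongr
    exact le_max_right _ _

end Inverse

end Fock

end

theorem theorem5p4_general (n : ℕ) (hn : 1 ≤ n) (p : ENNReal) (hp : 1 ≤ p) (α β : ℝ) :
    (∃! K : Fock.Cn n → Fock.Cn n → ℂ, Fock.IsReproducingKernel n α K) ∧
    ∀ K : Fock.Cn n → Fock.Cn n → ℂ, Fock.IsReproducingKernel n α K →
      (∀ r : ℝ, 0 < r →
        (∀ ψ ∈ Fock.spaceL n p r β, ∀ z : Fock.Cn n,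
          MeasureTheory.IntegrableOn (Fock.integrandP K ψ z) (Fock.Om n r) (Fock.W n α)) ∧
        ∃ T : Fock.spaceL n p r β →ₗ[ℂ] Fock.spaceF n p β,
          (∀ (ψ : Fock.spaceL n p r β) (z : Fock.Cn n),
            (T ψ : Fock.Cn n → ℂ) z = Fock.opP n α r K ψ z) ∧
          ∃ C : NNReal, ∀ ψ : Fock.spaceL n p r β,
            Fock.normF n p β (T ψ) ≤ C * Fock.normL n p r β ψ) ∧
      (∀ r : ℝ, 0 < r →
        (∀ f ∈ Fock.spaceF n p β, ∀ z : Fock.Cn n,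
          MeasureTheory.IntegrableOn (Fock.integrandP K f z) (Fock.Om n r) (Fock.W n α)) ∧
        ∃ T : Fock.spaceF n p β ≃ₗ[ℂ] Fock.spaceF n p β,
          (∀ (f : Fock.spaceF n p β) (z : Fock.Cn n),
            (T f : Fock.Cn n → ℂ) z = Fock.opP n α r K f z) ∧
          ∃ C : NNReal, ∀ f : Fock.spaceF n p β,
            Fock.normF n p β (T f) ≤ C * Fock.normF n p β f ∧
            Fock.normF n p β (T.symm f) ≤ C * Fock.normF n p β f) := by
  have hker := Fock.isReproducingKernel_kernel hn α
  refine ⟨⟨_, hker, fun K hK => hK.unique hker⟩, fun K hK => ?_⟩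
  obtain rfl : K = Fock.kernel n α := hK.unique hker
  refine ⟨fun r hr => ⟨fun ψ hψ z => ?_, Fock.projL hn hp α β hr, fun ψ z => rfl,
    Fock.exists_normF_projL_le hn hp α β hr⟩, fun r hr => ⟨fun f hf z => ?_,
    Fock.projF hn hp α β hr, fun f z => rfl, Fock.exists_normF_projF_le hn hp α β hr⟩⟩
  · exact Fock.integrableOn_integrandP_kernel hn hp α hr hψ z
  · exact Fock.integrableOn_integrandP_kernel hn hp α hr (Fock.spaceF_le_spaceL hp hr β hf) z

theorem theorem5p4 (n : ℕ) (hn : 1 ≤ n) (p : ENNReal) (hp : 1 ≤ p) (α β : ℝ) :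
    -- the reproducing kernel `K^α` of `F^2_α` exists and is unique
    (∃! K : Fock.Cn n → Fock.Cn n → ℂ, Fock.IsReproducingKernel n α K) ∧
    ∀ K : Fock.Cn n → Fock.Cn n → ℂ, Fock.IsReproducingKernel n α K →
      -- `P_α^r : 𝓛^{p,r}_β → F^p_β` is a well-defined bounded linear operator for every `r > 0`
      (∀ r : ℝ, 0 < r →
        (∀ ψ ∈ Fock.spaceL n p r β, ∀ z : Fock.Cn n,
          MeasureTheory.IntegrableOn (Fock.integrandP K ψ z) (Fock.Om n r) (Fock.W n α)) ∧
        ∃ T : Fock.spaceL n p r β →ₗ[ℂ] Fock.spaceF n p β,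
          (∀ (ψ : Fock.spaceL n p r β) (z : Fock.Cn n),
            (T ψ : Fock.Cn n → ℂ) z = Fock.opP n α r K ψ z) ∧
          ∃ C : NNReal, ∀ ψ : Fock.spaceL n p r β,
            Fock.normF n p β (T ψ) ≤ C * Fock.normL n p r β ψ) ∧
      -- `P_α^r : F^p_β → F^p_β` is well defined, bounded and boundedly invertible for small `r`
      (∃ r₀ : ℝ, 0 < r₀ ∧ ∀ r : ℝ, 0 < r → r < r₀ →
        (∀ f ∈ Fock.spaceF n p β, ∀ z : Fock.Cn n,
          MeasureTheory.IntegrableOn (Fock.integrandP K f z) (Fock.Om n r) (Fock.W n α)) ∧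
        ∃ T : Fock.spaceF n p β ≃ₗ[ℂ] Fock.spaceF n p β,
          (∀ (f : Fock.spaceF n p β) (z : Fock.Cn n),
            (T f : Fock.Cn n → ℂ) z = Fock.opP n α r K f z) ∧
          ∃ C : NNReal, ∀ f : Fock.spaceF n p β,
            Fock.normF n p β (T f) ≤ C * Fock.normF n p β f ∧
            Fock.normF n p β (T.symm f) ≤ C * Fock.normF n p β f) := by
  obtain ⟨hK, h⟩ := theorem5p4_general n hn p hp α β
  exact ⟨hK, fun K hrep => ⟨(h K hrep).1, 1, one_pos, fun r hr _ => (h K hrep).2 r hr⟩⟩
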